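/- \textbf{Delivery problem.} An instance consists of a connected undirected graph $G=(V,E)$ on $n$ nodes with edge lengths $\ell_e\ge 0$, $m$ packages, each with a source node $s_j$ and a target node $t_j$, and $k\ge 2$ agents located initially at distinct nodes $p_1,\dots,p_k$. Agents walk along edges. An agent carries at most one package at a time; it can pick up a package that lies at its current node and drop the package it carries at its current node (so packages may be handed over between agents at nodes). A feasible solution $x$ is a finite schedule of such moves, pickups and drops after which every package $j$, initially at $s_j$, lies at $t_j$. Let $d_i(x)$ be the total length that agent $i$ travels in $x$, and for weights $w\in\mathbb{R}_{\ge 0}^k$ let $\mathrm{cost}(x,w)=\sum_{i=1}^k w_i\, d_i(x)$. The graph, the packages and the starting positions are public; the weight $w_i$ is known only to agent $i$. A mechanism $(A,P)$ maps each vector $w'\in\mathbb{R}_{\ge0}^k$ of reported weights to a feasible solution $A(w')$ and payments $P_1(w'),\dots,P_k(w')\in\mathbb{R}$. \textbf{Theorem.} There are a single algorithm and a polynomial $p$ such that, for every number $k\ge 2$ of agents and every instance with $n$ nodes, $m$ packages and $k$ agents, the algorithm computes a mechanism $(A^k,P)$: given the instance and any reported weights $w'$, it outputs the solution $A^k(w')$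 and the payments $P(w')$ after at most $p(n,m,k)\cdot k^m$ steps (thus, for constant $k$, in exponential time), and the following hold. \begin{itemize} \item \emph{VCG payments:} for each $i$ there is a function $Q_i$ of the reports $w'_{-i}$ of the other agents such that $P_i(w')=Q_i(w'_{-i})-\sum_{j\ne i}w'_j\, d_j(A^k(w'))$ for all $w'$. \item \emph{Truthfulness:} for all $w'$, all $i$ and all $w_i\ge0$, $P_i(w')-w_i d_i(A^k(w'))\le P_i(w_i,w'_{-i})-w_i d_i(A^k(w_i,w'_{-i}))$. \item \emph{Voluntary participation:} $P_i(w')-w'_i d_i(A^k(w'))\ge 0$ for all $w'$ and all $i$. \item \emph{Approximation:} $\mathrm{cost}(A^k(w'),w')\le 3.6\cdot \mathrm{cost}(x,w')$ for all $w'$ and all feasible solutions $x$; that is, the cost is at most $3.6$ times the optimum. \end{itemize} Here an algorithm is a program for the real random access machine: it has registers and arrays of natural numbers (with addition, truncated subtraction, comparison, and indexing of arrays) and of real numbers (with addition, subtraction, multiplication and comparison), natural numbers are the only constants, and every operation costs one step. The input consists of $n,m,k$, the adjacency matrix and the length matrix of $G$, the sources, targets and starting nodes, and the reported weights. -/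

import Mathlib

open scoped NNReal

/-! ## The delivery problem -/

namespace Delivery

/-- An instance of the delivery problem without the weights (the public data): a connected graph on
`n` nodes with nonnegative edge lengths, `m` packages given by source and target, and `k` agents
at distinct starting nodes. Only the values of `len` on edges of the graph are ever used. -/
structure Instance (n m k : ℕ) where
  graph : SimpleGraph (Fin n)
  connected : graph.Connected
  len : Sym2 (Fin n) → ℝ≥0
  source : Fin m → Fin n
  target : Fin m → Fin n
  start : Fin k → Fin n
  start_injective : Function.Injective start

/-- Elementary actions: agent `i` walks over the edge from `u` to `v`; agent `i` picks up package
`j` at its current node; agent `i` drops package `j` at its current node. -/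
inductive Action (n m k : ℕ) where
  | move (i : Fin k) (u v : Fin n)
  | pickup (i : Fin k) (j : Fin m)
  | drop (i : Fin k) (j : Fin m)

/-- Where the agents are, and for each package the node at which it lies (`Sum.inl`) or the agent
that carries it (`Sum.inr`). -/
structure Config (n m k : ℕ) where
  pos : Fin k → Fin n
  loc : Fin m → Fin n ⊕ Fin k

variable {n m k : ℕ}

/-- `I.Step c a c'`: action `a` is allowed in `c` and leads to `c'`. An agent can pick up a package
only at the node where it stands, and only when it carries no other package. -/
inductive Instance.Step (I : Instance n m k) :
    Config n m k → Action n m k → Config n m k → Prop where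
  | move (c : Config n m k) (i : Fin k) (u v : Fin n) (hu : c.pos i = u) (huv : I.graph.Adj u v) :
      I.Step c (.move i u v) ⟨Function.update c.pos i v, c.loc⟩
  | pickup (c : Config n m k) (i : Fin k) (j : Fin m) (hj : c.loc j = .inl (c.pos i))
      (hfree : ∀ j', c.loc j' ≠ .inr i) :
      I.Step c (.pickup i j) ⟨c.pos, Function.update c.loc j (.inr i)⟩
  | drop (c : Config n m k) (i : Fin k) (j : Fin m) (hj : c.loc j = .inr i) :
      I.Step c (.drop i j) ⟨c.pos, Function.update c.loc j (.inl (c.pos i))⟩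

/-- `I.Run c x c'`: performing the actions in the list `x` one after the other leads from `c`
to `c'`. -/
inductive Instance.Run (I : Instance n m k) :
    Config n m k → List (Action n m k) → Config n m k → Prop where
  | nil (c : Config n m k) : I.Run c [] c
  | cons {c c' c'' : Config n m k} {a : Action n m k} {x : List (Action n m k)}
      (h : I.Step c a c') (hx : I.Run c' x c'') : I.Run c (a :: x) c''

/-- Agents at their starting nodes, packages at their sources. -/
def Instance.initial (I : Instance n m k) : Config n m k :=
  ⟨I.start, fun j => .inl (I.source j)⟩

/-- A schedule is feasible if it can be carried out and delivers each package to its target.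
Packages may be handed over between agents, at any node. -/
def Instance.Feasible (I : Instance n m k) (x : List (Action n m k)) : Prop :=
  ∃ c, I.Run I.initial x c ∧ ∀ j, c.loc j = .inl (I.target j)

/-- Feasible solutions. -/
def Instance.Solution (I : Instance n m k) : Type :=
  {x : List (Action n m k) // I.Feasible x}

/-- The distance that agent `i` travels when action `a` is performed. -/
def Instance.actionDist (I : Instance n m k) (i : Fin k) (a : Action n m k) : ℝ≥0 :=
  match a with
  | .move i' u v => if i' = i then I.len s(u, v) else 0
  | .pickup _ _ => 0
  | .drop _ _ => 0

/-- The travel distance `d_i(x)` of agent `i` in solution `x`. -/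
def Instance.dist (I : Instance n m k) (i : Fin k) (x : I.Solution) : ℝ≥0 :=
  (x.1.map (I.actionDist i)).sum

/-- The total energy `cost(x, w) = ∑ i, w_i * d_i(x)`. -/
def Instance.cost (I : Instance n m k) (x : I.Solution) (w : Fin k → ℝ≥0) : ℝ≥0 :=
  ∑ i, w i * I.dist i x

/-! ## Mechanisms -/

/-- A mechanism for `I`: from the vector of reported weights it determines a feasible solution and
a payment to each agent. -/
structure Mechanism (I : Instance n m k) where
  alg : (Fin k → ℝ≥0) → I.Solution
  pay : (Fin k → ℝ≥0) → Fin k → ℝ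

/-- Payment minus incurred cost of agent `i` with true weight `wi`, when `w'` is reported. -/
noncomputable def Mechanism.utility {I : Instance n m k} (M : Mechanism I) (w' : Fin k → ℝ≥0)
    (i : Fin k) (wi : ℝ≥0) : ℝ :=
  M.pay w' i - (wi : ℝ) * (I.dist i (M.alg w') : ℝ)

/-- Truth-telling is a dominant strategy. -/
def Mechanism.Truthful {I : Instance n m k} (M : Mechanism I) : Prop :=
  ∀ (w' : Fin k → ℝ≥0) (i : Fin k) (wi : ℝ≥0),
    M.utility w' i wi ≤ M.utility (Function.update w' i wi) i wi

/-- Truth-telling agents never have negative utility. -/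
def Mechanism.VoluntaryParticipation {I : Instance n m k} (M : Mechanism I) : Prop :=
  ∀ (w' : Fin k → ℝ≥0) (i : Fin k), 0 ≤ M.utility w' i (w' i)

/-- The payments have the form `P_i(w') = Q_i(w'_{-i}) - ∑_{j ≠ i} w'_j * d_j(A(w'))`. -/
def Mechanism.IsVCG {I : Instance n m k} (M : Mechanism I) : Prop :=
  ∃ Q : (i : Fin k) → ({j : Fin k // j ≠ i} → ℝ≥0) → ℝ, ∀ (w' : Fin k → ℝ≥0) (i : Fin k),
    M.pay w' i = Q i (fun j => w' j.1) -
      ∑ j ∈ Finset.univ.erase i, (w' j : ℝ) * (I.dist j (M.alg w') : ℝ)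

/-- For every reported vector the cost of the computed solution is at most `c` times the cost of
every feasible solution, that is, at most `c` times the cost of an optimal one. -/
def Mechanism.IsApprox {I : Instance n m k} (M : Mechanism I) (c : ℝ) : Prop :=
  ∀ (w' : Fin k → ℝ≥0) (y : I.Solution),
    (I.cost (M.alg w') w' : ℝ) ≤ c * (I.cost y w' : ℝ)

end Delivery

/-! ## Real random access machines

Structured programs over a memory that consists of numbered natural-number registers and arrays and
numbered real registers and arrays. A program mentions only finitely many of them. Indices are
computed with natural numbers; there is no natural-number multiplication, no conversion between
reals and naturals, and no real constant other than naturals. -/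

namespace RealRAM

/-- Memory contents. -/
structure Store where
  nreg : ℕ → ℕ
  narr : ℕ → ℕ → ℕ
  rreg : ℕ → ℝ
  rarr : ℕ → ℕ → ℝ

/-- Natural-number expressions; `get a e` is the entry of array `a` with index `e`, and `sub` is
truncated subtraction. -/
inductive NExp where
  | const (c : ℕ)
  | var (r : ℕ)
  | get (a : ℕ) (e : NExp)
  | add (e₁ e₂ : NExp)
  | sub (e₁ e₂ : NExp)

/-- Real expressions. -/
inductive RExp where
  | const (c : ℕ)
  | var (r : ℕ)
  | get (a : ℕ) (e : NExp)
  | add (e₁ e₂ : RExp)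
  | sub (e₁ e₂ : RExp)
  | mul (e₁ e₂ : RExp)

/-- Tests. -/
inductive BExp where
  | nle (e₁ e₂ : NExp)
  | rle (e₁ e₂ : RExp)
  | not (b : BExp)
  | and (b₁ b₂ : BExp)

/-- Programs. -/
inductive Cmd where
  | skip
  | setN (r : ℕ) (e : NExp)
  | putN (a : ℕ) (i e : NExp)
  | setR (r : ℕ) (e : RExp)
  | putR (a : ℕ) (i : NExp) (e : RExp)
  | seq (p q : Cmd)
  | ite (b : BExp) (p q : Cmd)
  | loop (b : BExp) (p : Cmd)

/-- Value of a natural-number expression. -/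
def NExp.eval (s : Store) : NExp → ℕ
  | .const c => c
  | .var r => s.nreg r
  | .get a e => s.narr a (e.eval s)
  | .add e₁ e₂ => e₁.eval s + e₂.eval s
  | .sub e₁ e₂ => e₁.eval s - e₂.eval s

/-- Value of a real expression. -/
noncomputable def RExp.eval (s : Store) : RExp → ℝ
  | .const c => (c : ℝ)
  | .var r => s.rreg r
  | .get a e => s.rarr a (e.eval s)
  | .add e₁ e₂ => e₁.eval s + e₂.eval s
  | .sub e₁ e₂ => e₁.eval s - e₂.eval s
  | .mul e₁ e₂ => e₁.eval s * e₂.eval s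

/-- Truth of a test. -/
def BExp.Holds (s : Store) : BExp → Prop
  | .nle e₁ e₂ => e₁.eval s ≤ e₂.eval s
  | .rle e₁ e₂ => e₁.eval s ≤ e₂.eval s
  | .not b => ¬ b.Holds s
  | .and b₁ b₂ => b₁.Holds s ∧ b₂.Holds s

/-- Number of operations needed to evaluate an expression. -/
def NExp.size : NExp → ℕ
  | .const _ => 1
  | .var _ => 1
  | .get _ e => e.size + 1
  | .add e₁ e₂ => e₁.size + e₂.size + 1
  | .sub e₁ e₂ => e₁.size + e₂.size + 1

/-- Number of operations needed to evaluate an expression. -/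
def RExp.size : RExp → ℕ
  | .const _ => 1
  | .var _ => 1
  | .get _ e => e.size + 1
  | .add e₁ e₂ => e₁.size + e₂.size + 1
  | .sub e₁ e₂ => e₁.size + e₂.size + 1
  | .mul e₁ e₂ => e₁.size + e₂.size + 1

/-- Number of operations needed to evaluate a test. -/
def BExp.size : BExp → ℕ
  | .nle e₁ e₂ => e₁.size + e₂.size + 1
  | .rle e₁ e₂ => e₁.size + e₂.size + 1
  | .not b => b.size + 1
  | .and b₁ b₂ => b₁.size + b₂.size + 1

/-- `Exec p s t s'`: started in `s`, program `p` halts after exactly `t` steps in `s'`. -/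
inductive Exec : Cmd → Store → ℕ → Store → Prop where
  | skip (s : Store) : Exec .skip s 1 s
  | setN (s : Store) (r : ℕ) (e : NExp) :
      Exec (.setN r e) s (e.size + 1) { s with nreg := Function.update s.nreg r (e.eval s) }
  | putN (s : Store) (a : ℕ) (i e : NExp) :
      Exec (.putN a i e) s (i.size + e.size + 1)
        { s with narr := Function.update s.narr a
                  (Function.update (s.narr a) (i.eval s) (e.eval s)) }
  | setR (s : Store) (r : ℕ) (e : RExp) :
      Exec (.setR r e) s (e.size + 1) { s with rreg := Function.update s.rreg r (e.eval s) }
  | putR (s : Store) (a : ℕ) (i : NExp) (e : RExp) :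
      Exec (.putR a i e) s (i.size + e.size + 1)
        { s with rarr := Function.update s.rarr a
                  (Function.update (s.rarr a) (i.eval s) (e.eval s)) }
  | seq {p q : Cmd} {s s' s'' : Store} {t t' : ℕ} (hp : Exec p s t s') (hq : Exec q s' t' s'') :
      Exec (.seq p q) s (t + t') s''
  | ite_true {b : BExp} {p q : Cmd} {s s' : Store} {t : ℕ} (hb : b.Holds s) (hp : Exec p s t s') :
      Exec (.ite b p q) s (b.size + t) s'
  | ite_false {b : BExp} {p q : Cmd} {s s' : Store} {t : ℕ} (hb : ¬ b.Holds s)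
      (hq : Exec q s t s') : Exec (.ite b p q) s (b.size + t) s'
  | loop_stop {b : BExp} {p : Cmd} {s : Store} (hb : ¬ b.Holds s) : Exec (.loop b p) s b.size s
  | loop_step {b : BExp} {p : Cmd} {s s' s'' : Store} {t t' : ℕ} (hb : b.Holds s)
      (hp : Exec p s t s') (hl : Exec (.loop b p) s' t' s'') :
      Exec (.loop b p) s (b.size + t + t') s''

end RealRAM

/-! ## Input and output conventions -/

namespace Delivery

variable {n m k : ℕ}

open Classical in
/-- Entry of the adjacency matrix. -/
noncomputable def Instance.adjEntry (I : Instance n m k) (u v : ℕ) : ℕ :=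
  if ∃ (hu : u < n) (hv : v < n), I.graph.Adj ⟨u, hu⟩ ⟨v, hv⟩ then 1 else 0

open Classical in
/-- Entry of the length matrix (`0` for non-adjacent nodes). -/
noncomputable def Instance.lenEntry (I : Instance n m k) (u v : ℕ) : ℝ :=
  if h : ∃ (hu : u < n) (hv : v < n), I.graph.Adj ⟨u, hu⟩ ⟨v, hv⟩ then
    (I.len s(⟨u, h.1⟩, ⟨v, h.2.1⟩) : ℝ) else 0

/-- The initial memory: registers `0, 1, 2` hold `n, m, k`; natural-number array `0` is the
adjacency matrix (entry `(u, v)` at index `u * n + v`), arrays `1, 2, 3` hold the sources, the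
targets and the starting nodes; real array `0` is the length matrix and real array `1` holds the
reported weights. Everything else is `0`. -/
noncomputable def Instance.input (I : Instance n m k) (w : Fin k → ℝ≥0) : RealRAM.Store where
  nreg r := match r with
    | 0 => n
    | 1 => m
    | 2 => k
    | _ => 0
  narr a x := match a with
    | 0 => I.adjEntry (x / n) (x % n)
    | 1 => if h : x < m then (I.source ⟨x, h⟩ : ℕ) else 0
    | 2 => if h : x < m then (I.target ⟨x, h⟩ : ℕ) else 0
    | 3 => if h : x < k then (I.start ⟨x, h⟩ : ℕ) else 0
    | _ => 0
  rreg _ := 0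
  rarr a x := match a with
    | 0 => I.lenEntry (x / n) (x % n)
    | 1 => if h : x < k then (w ⟨x, h⟩ : ℝ) else 0
    | _ => 0

/-- An action as four numbers. -/
def Action.code : Action n m k → ℕ × ℕ × ℕ × ℕ
  | .move i u v => (0, i, u, v)
  | .pickup i j => (1, i, j, 0)
  | .drop i j => (2, i, j, 0)

/-- The memory contains the solution `x` (its number of actions in register `3`, the codes of its
actions in the natural-number arrays `4, 5, 6, 7`) and the payments `P` (in real array `2`). -/
def Instance.IsOutput (I : Instance n m k) (s : RealRAM.Store) (x : I.Solution)
    (P : Fin k → ℝ) : Prop :=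
  s.nreg 3 = x.1.length ∧
  (∀ (l : ℕ) (hl : l < x.1.length),
    (s.narr 4 l, s.narr 5 l, s.narr 6 l, s.narr 7 l) = (x.1[l]'hl).code) ∧
  ∀ i : Fin k, s.rarr 2 i = P i

/-- Program `prog` computes the mechanism `M`, i.e. both the solution and the payments, in at most
`T` steps on every vector of reported weights. -/
def Mechanism.ComputedBy {I : Instance n m k} (M : Mechanism I) (prog : RealRAM.Cmd) (T : ℕ) :
    Prop :=
  ∀ w' : Fin k → ℝ≥0, ∃ (t : ℕ) (s : RealRAM.Store),
    RealRAM.Exec prog (I.input w') t s ∧ t ≤ T ∧ I.IsOutput s (M.alg w') (M.pay w')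

end Delivery

/-! The mechanism minimizes the reported cost over a range of solutions that does not depend on the
reports, and pays by a VCG rule. The range consists of solutions without handovers: the agents act
one after another, each carries its packages one at a time from source to target and then walks
home. Such solutions are the walks with exactly `n * (k + 2 * m)` edges, from a fixed first to a
fixed last state, in a state graph whose states record the delivered packages, the load, the active
agent and its node.

Approximation: restricting to this range costs at most a factor 2, which is below 3.6
(`Instance.exists_tours_le`). For an arbitrary schedule, closed tours of the agents are maintained
action by action (`Instance.Covers.step`). A move of length `ℓ` by agent `i` is imitated, forth and
back, in the tour of an agent that is at most as expensive as `i`, for an extra cost of at most `2 *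
w i * ℓ`. When a package is handed over to a cheaper agent, the tour of the expensive owner is
spliced into a tour of a sufficiently cheap agent at the handover node; closed tours can be rotated,
so this costs nothing. At the end the tours contain a direct transport of every package, and all
other stops can be skipped. `Instance.exists_walk_of_tours` turns the tours into a walk of the
prescribed length, and `Instance.exists_run_of_isWalk` turns walks back into schedules.

Incentives: let `B` be the number of rounds times the sum of all entries of the length matrix; no
walk in the range makes an agent travel further (`Instance.travel_le`). With `Q i = B * ∑ j ≠ i, w
j`, the utility of agent `i` is `Q i` minus the cost of the chosen solution under the true weight of
`i` and the reports of the others. As the range is fixed, truth-telling minimizes this cost. The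
utility is nonnegative because the range contains a solution in which a single agent `j ≠ i` does
all the work, at cost at most `w j * B`; here `k ≥ 2` is used.

Computation: the edge list of the state graph is built by doubling, once per package
(`Instance.mem_edges`). A dynamic program over the number of edges finds a cheapest walk
(`Table.le_walkCost`, `runs_extractProg`). There are `2 ^ m` times polynomially many edges and
polynomially many rounds, and `2 ^ m ≤ k ^ m` (`mechanismTime_le`). The machine cannot multiply
naturals or convert them to reals, so products are accumulated by additions in loops. -/

/-! ## Shortest paths and delivery tours -/

namespace Delivery

variable {n m k : ℕ}

namespace Instance

/-- The length of a walk. -/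
def walkLen (I : Instance n m k) {u v : Fin n} (p : I.graph.Walk u v) : ℝ≥0 :=
  (p.edges.map I.len).sum

theorem walkLen_append (I : Instance n m k) {u v x : Fin n} (p : I.graph.Walk u v)
    (q : I.graph.Walk v x) : I.walkLen (p.append q) = I.walkLen p + I.walkLen q := by
  simp [walkLen]

/-- Lengths are nonnegative and `bypass` only deletes edges, so it is enough to minimize over the
finitely many paths. The bound on the number of edges is what later makes the number of rounds
polynomial. -/
theorem exists_shortest_walk (I : Instance n m k) (u v : Fin n) :
    ∃ p : I.graph.Walk u v, p.length < n ∧ ∀ q : I.graph.Walk u v, I.walkLen p ≤ I.walkLen q := by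
  classical
  obtain ⟨q₀⟩ := I.connected.preconnected u v
  have : Nonempty (I.graph.Path u v) := ⟨⟨q₀.bypass, q₀.bypass_isPath⟩⟩
  obtain ⟨p, hp⟩ := Finite.exists_min (fun p : I.graph.Path u v => I.walkLen p.1)
  refine ⟨p.1, by simpa using p.2.length_lt, fun q => (hp ⟨q.bypass, q.bypass_isPath⟩).trans ?_⟩
  exact List.Sublist.sum_le_sum (q.edges_bypass_sublist_edges.map _) (by simp)

/-- A shortest walk from `u` to `v` without repeated nodes. -/
noncomputable def route (I : Instance n m k) (u v : Fin n) : I.graph.Walk u v :=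
  (I.exists_shortest_walk u v).choose

theorem length_route_lt (I : Instance n m k) (u v : Fin n) : (I.route u v).length < n :=
  (I.exists_shortest_walk u v).choose_spec.1

/-- The shortest-path distance. -/
noncomputable def nodeDist (I : Instance n m k) (u v : Fin n) : ℝ≥0 :=
  I.walkLen (I.route u v)

theorem nodeDist_le (I : Instance n m k) {u v : Fin n} (p : I.graph.Walk u v) :
    I.nodeDist u v ≤ I.walkLen p :=
  (I.exists_shortest_walk u v).choose_spec.2 p

@[simp] theorem nodeDist_self (I : Instance n m k) (u : Fin n) : I.nodeDist u u = 0 :=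
  le_antisymm ((I.nodeDist_le .nil).trans (by simp [walkLen])) zero_le

theorem nodeDist_triangle (I : Instance n m k) (u v x : Fin n) :
    I.nodeDist u x ≤ I.nodeDist u v + I.nodeDist v x :=
  (I.nodeDist_le ((I.route u v).append (I.route v x))).trans (I.walkLen_append _ _).le

theorem nodeDist_le_len (I : Instance n m k) {u v : Fin n} (h : I.graph.Adj u v) :
    I.nodeDist u v ≤ I.len s(u, v) :=
  (I.nodeDist_le h.toWalk).trans (by simp [walkLen])

end Instance

/-- A stop of a tour: a visit of node `u`, or the transport of package `j` from its source
to `u`. -/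
inductive Stop (n m : ℕ) where
  | node (u : Fin n)
  | carry (j : Fin m) (u : Fin n)

namespace Instance

/-- The node at which a stop begins. -/
def stopIn (I : Instance n m k) : Stop n m → Fin n
  | .node u => u
  | .carry j _ => I.source j

/-- The node at which a stop ends. -/
def stopOut (_ : Instance n m k) : Stop n m → Fin n
  | .node u => u
  | .carry _ u => u

/-- The length of the shortest walk from `x` to `y` that makes the given stops in order. -/
noncomputable def tourLen (I : Instance n m k) : Fin n → List (Stop n m) → Fin n → ℝ≥0
  | x, [], y => I.nodeDist x y
  | x, a :: l, y =>
      I.nodeDist x (I.stopIn a) + I.nodeDist (I.stopIn a) (I.stopOut a) +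
        I.tourLen (I.stopOut a) l y

theorem tourLen_append_cons (I : Instance n m k) (x y : Fin n) (a : Stop n m)
    (l l' : List (Stop n m)) :
    I.tourLen x (l ++ a :: l') y = I.tourLen x l (I.stopIn a) +
      I.nodeDist (I.stopIn a) (I.stopOut a) + I.tourLen (I.stopOut a) l' y := by
  induction l generalizing x with
  | nil => rfl
  | cons b l ih => simp only [List.cons_append, tourLen, ih]; ring

theorem tourLen_triangle (I : Instance n m k) (x z y : Fin n) (l : List (Stop n m)) :
    I.tourLen x l y ≤ I.nodeDist x z + I.tourLen z l y := by
  cases l with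
  | nil => exact I.nodeDist_triangle x z y
  | cons b l =>
    simp only [tourLen, ← add_assoc]
    gcongr
    exact I.nodeDist_triangle _ _ _

/-- A forced visit of `z` between the two halves can only lengthen the tour. This is used when a
closed tour is rotated: the splice may skip the home node of its former owner. -/
theorem tourLen_append_le (I : Instance n m k) (x z y : Fin n) (l l' : List (Stop n m)) :
    I.tourLen x (l ++ l') y ≤ I.tourLen x l z + I.tourLen z l' y := by
  induction l generalizing x with
  | nil => exact I.tourLen_triangle x z y l'
  | cons b l ih =>
    simp only [List.cons_append, tourLen, add_assoc]
    gcongr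
    exact ih _

/-- Stops can be skipped by the triangle inequality; a skipped transport is just a detour. -/
theorem tourLen_mono (I : Instance n m k) {l l' : List (Stop n m)} (h : l.Sublist l')
    (x y : Fin n) : I.tourLen x l y ≤ I.tourLen x l' y := by
  induction h generalizing x with
  | slnil => exact le_rfl
  | cons a h ih =>
    refine (I.tourLen_triangle x (I.stopOut a) y _).trans ?_
    simp only [tourLen]
    gcongr
    · exact I.nodeDist_triangle _ _ _
    · exact ih _
  | cons_cons a h ih =>
    simp only [tourLen]
    gcongr
    exact ih _

/-! ## Delivery without handovers costs at most twice as much -/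

/-- The tours `T a` of the agents `a` cover everything that has happened up to configuration `c`,
in such a way that no agent performs work of a cheaper one, and their total cost is at
most `A`. -/
structure Covers (I : Instance n m k) (w : Fin k → ℝ≥0) (c : Config n m k)
    (T : Fin k → List (Stop n m)) (A : ℝ≥0) : Prop where
  agent : ∀ i, ∃ a, w a ≤ w i ∧ Stop.node (c.pos i) ∈ T a
  lying : ∀ j v, c.loc j = .inl v → v = I.source j ∨ ∃ a, Stop.carry j v ∈ T a
  carried : ∀ j i, c.loc j = .inr i → ∃ a, w a ≤ w i ∧ Stop.carry j (c.pos i) ∈ T a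
  unique : ∀ j j' i, c.loc j = .inr i → c.loc j' = .inr i → j = j'
  cost_le : ∑ a, w a * I.tourLen (I.start a) (T a) (I.start a) ≤ A

theorem covers_initial (I : Instance n m k) (w : Fin k → ℝ≥0) :
    I.Covers w I.initial (fun a => [.node (I.start a)]) 0 where
  agent i := ⟨i, le_rfl, by simp [initial]⟩
  lying j v h := by
    left
    simpa [initial, eq_comm] using h
  carried j i h := by simp [initial] at h
  unique j j' i h := by simp [initial] at h
  cost_le := by simp [tourLen, stopIn, stopOut]

theorem sum_update_le {I : Instance n m k} {w : Fin k → ℝ≥0} {T : Fin k → List (Stop n m)}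
    {A B : ℝ≥0} (a : Fin k) (l : List (Stop n m))
    (h : ∑ a, w a * I.tourLen (I.start a) (T a) (I.start a) ≤ A)
    (hl : w a * I.tourLen (I.start a) l (I.start a) ≤
      w a * I.tourLen (I.start a) (T a) (I.start a) + B) :
    ∑ b, w b * I.tourLen (I.start b) (Function.update T a l b) (I.start b) ≤ A + B := by
  classical
  rw [← Finset.add_sum_erase _ _ (Finset.mem_univ a)] at h ⊢
  rw [Function.update_self, Finset.sum_congr rfl (g := fun b =>
    w b * I.tourLen (I.start b) (T b) (I.start b))]
  · calc _ ≤ _ := add_le_add_left hl _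
      _ = _ := by ring
      _ ≤ _ := add_le_add_left h B
  · intro b hb
    rw [Function.update_of_ne (Finset.ne_of_mem_erase hb)]

/-- Only moves cost anything: each is imitated forth and back in a tour whose owner is at most as
expensive as the mover. Drops need no change. Pickups need work only if the package was last
transported in the tour of an agent more expensive than the new carrier. -/
theorem Covers.step {I : Instance n m k} {w : Fin k → ℝ≥0} {c c' : Config n m k}
    {T : Fin k → List (Stop n m)} {A : ℝ≥0} (h : I.Covers w c T A) {x : Action n m k}
    (hs : I.Step c x c') :
    ∃ T', I.Covers w c' T' (A + 2 * ∑ i, w i * I.actionDist i x) := by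
  classical
  cases hs with
  | move i u v hu huv =>
    have hcost : ∑ i', w i' * I.actionDist i' (.move i u v) = w i * I.len s(u, v) := by
      simp [actionDist]
    have huv' := I.nodeDist_le_len huv
    have hvu' : I.nodeDist v u ≤ I.len s(u, v) := by
      rw [Sym2.eq_swap]; exact I.nodeDist_le_len huv.symm
    rw [hcost]
    -- The tour to extend is the one that transports the load of `i`, if there is a load; otherwise
    -- it is one that visits the position of `i`.
    by_cases hc : ∃ j, c.loc j = .inr i
    · obtain ⟨j, hj⟩ := hc
      obtain ⟨a, haw, ha⟩ := h.carried j i hj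
      rw [hu] at ha
      obtain ⟨X, Y, hXY⟩ := List.append_of_mem ha
      have hmem : ∀ b (s : Stop n m), s ≠ .carry j u → s ∈ T b → s ∈ Function.update T a
          (X ++ .carry j v :: .node v :: .node u :: Y) b := by
        intro b s hs hb
        by_cases hba : b = a
        · subst hba
          rw [hXY] at hb
          simp only [Function.update_self, List.mem_append, List.mem_cons] at hb ⊢
          tauto
        · rwa [Function.update_of_ne hba]
      -- The transport is prolonged to `v`, `node v` witnesses the new position of `i`, and the
      -- return to `u` leaves the continuation `Y` unchanged. The stop `carry j u` may be lost, but
      -- the package is in the hands of `i`, so no clause needs it any more.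
      refine ⟨Function.update T a (X ++ .carry j v :: .node v :: .node u :: Y), ?_, ?_, ?_, ?_, ?_⟩
      · intro i'
        by_cases hi : i' = i
        · subst hi
          exact ⟨a, haw, by simp⟩
        · obtain ⟨b, hb, hb'⟩ := h.agent i'
          exact ⟨b, hb, by simpa [Function.update_of_ne hi] using hmem b _ (by simp) hb'⟩
      · intro j' v' hj'
        refine (h.lying j' v' hj').imp id ?_
        rintro ⟨b, hb⟩
        refine ⟨b, hmem b _ ?_ hb⟩
        rintro ⟨⟩
        simp only at hj'
        simp [hj] at hj'
      · intro j' i' hj'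
        by_cases hi : i' = i
        · subst hi
          obtain rfl := h.unique j j' i' hj hj'
          exact ⟨a, haw, by simp⟩
        · obtain ⟨b, hb, hb'⟩ := h.carried j' i' hj'
          refine ⟨b, hb, ?_⟩
          simp only [Function.update_of_ne hi]
          refine hmem b _ ?_ hb'
          intro he
          obtain rfl : j' = j := (Stop.carry.inj he).1
          simp only at hj'
          rw [hj] at hj'
          exact hi (Sum.inr.inj hj').symm
      · exact h.unique
      · refine sum_update_le a _ h.cost_le ?_
        rw [hXY, tourLen_append_cons, tourLen_append_cons]
        simp only [tourLen, stopIn, stopOut, nodeDist_self, zero_add, add_zero]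
        have h1 := I.nodeDist_triangle (I.source j) u v
        calc _ ≤ w a * (I.tourLen (I.start a) X (I.source j) + (I.nodeDist (I.source j) u +
              I.len s(u, v)) + (I.len s(u, v) + I.tourLen u Y (I.start a))) := by
              gcongr
              exact h1.trans (by gcongr)
          _ = w a * (I.tourLen (I.start a) X (I.source j) + I.nodeDist (I.source j) u +
              I.tourLen u Y (I.start a)) + 2 * (w a * I.len s(u, v)) := by ring
          _ ≤ _ := by gcongr
    · push Not at hc
      obtain ⟨a, haw, ha⟩ := h.agent i
      rw [hu] at ha
      obtain ⟨X, Y, hXY⟩ := List.append_of_mem ha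
      have hmem : ∀ b (s : Stop n m), s ∈ T b → s ∈ Function.update T a
          (X ++ .node u :: .node v :: .node u :: Y) b := by
        intro b s hb
        by_cases hba : b = a
        · subst hba
          rw [hXY] at hb
          simp only [Function.update_self, List.mem_append, List.mem_cons] at hb ⊢
          tauto
        · rwa [Function.update_of_ne hba]
      -- Without a load the move becomes a detour from `u` to `v` and back.
      refine ⟨Function.update T a (X ++ .node u :: .node v :: .node u :: Y), ?_, ?_, ?_, ?_, ?_⟩
      · intro i'
        by_cases hi : i' = i
        · subst hi
          exact ⟨a, haw, by simp⟩
        · obtain ⟨b, hb, hb'⟩ := h.agent i'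
          exact ⟨b, hb, by simpa [Function.update_of_ne hi] using hmem b _ hb'⟩
      · intro j' v' hj'
        exact (h.lying j' v' hj').imp id fun ⟨b, hb⟩ => ⟨b, hmem b _ hb⟩
      · intro j' i' hj'
        have hi : i' ≠ i := fun hi => hc j' (hi ▸ hj')
        obtain ⟨b, hb, hb'⟩ := h.carried j' i' hj'
        exact ⟨b, hb, by simpa [Function.update_of_ne hi] using hmem b _ hb'⟩
      · exact h.unique
      · refine sum_update_le a _ h.cost_le ?_
        rw [hXY, tourLen_append_cons, tourLen_append_cons]
        simp only [tourLen, stopIn, stopOut, nodeDist_self, add_zero]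
        calc _ ≤ w a * (I.tourLen (I.start a) X u + (I.len s(u, v) +
              (I.len s(u, v) + I.tourLen u Y (I.start a)))) := by gcongr
          _ = w a * (I.tourLen (I.start a) X u +
              I.tourLen u Y (I.start a)) + 2 * (w a * I.len s(u, v)) := by ring
          _ ≤ _ := by gcongr
  | pickup i j hj hfree =>
    have hcost : ∑ i', w i' * I.actionDist i' (.pickup i j) = 0 := by simp [actionDist]
    rw [hcost, mul_zero, add_zero]
    -- it suffices to have tours in which the new carrier is not cheaper than the tour's owner
    have key : ∃ T', I.Covers w c T' A ∧ ∃ a, w a ≤ w i ∧ Stop.carry j (c.pos i) ∈ T' a := by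
      obtain ⟨a, haw, ha⟩ := h.agent i
      obtain ⟨X, Y, hXY⟩ := List.append_of_mem ha
      rcases h.lying j _ hj with hv | ⟨b, hb⟩
      · have hmem : ∀ b (s : Stop n m), s ∈ T b → s ∈ Function.update T a
            (X ++ .node (c.pos i) :: .carry j (c.pos i) :: Y) b := by
          intro b s hb
          by_cases hba : b = a
          · subst hba
            rw [hXY] at hb
            simp only [Function.update_self, List.mem_append, List.mem_cons] at hb ⊢
            tauto
          · rwa [Function.update_of_ne hba]
        -- The package still lies at its source, so a transport of length zero can be inserted for
        -- free.
        refine ⟨Function.update T a (X ++ .node (c.pos i) :: .carry j (c.pos i) :: Y),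
          ⟨?_, ?_, ?_, ?_, ?_⟩, a, haw, by simp⟩
        · exact fun i' => (h.agent i').imp fun b hb => ⟨hb.1, hmem b _ hb.2⟩
        · exact fun j' v' hj' => (h.lying j' v' hj').imp id fun ⟨b, hb⟩ => ⟨b, hmem b _ hb⟩
        · exact fun j' i' hj' => (h.carried j' i' hj').imp fun b hb => ⟨hb.1, hmem b _ hb.2⟩
        · exact h.unique
        · rw [← add_zero A]
          refine sum_update_le a _ h.cost_le ?_
          rw [hXY, tourLen_append_cons, tourLen_append_cons]
          simp [tourLen, stopIn, stopOut, ← hv]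
      · by_cases hbw : w b ≤ w i
        · exact ⟨T, h, b, hbw, hb⟩
        have hab : a ≠ b := fun hab => hbw (hab ▸ haw)
        have hwab : w a ≤ w b := haw.trans (not_le.1 hbw).le
        obtain ⟨X', Y', hXY'⟩ := List.append_of_mem hb
        -- The tour of `b` is cut open right after its delivery at `c.pos i` and rotated, so that it
        -- starts and ends at this node. It is then inserted into the tour of `a`, which visits the
        -- node, and `b` keeps the empty tour. Every stop of `b` passes to `a`, which is not more
        -- expensive.
        set l := X ++ .node (c.pos i) :: (Y' ++ X' ++ .carry j (c.pos i) :: Y) with hl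
        set T' := Function.update (Function.update T a l) b [] with hT'
        have hTa : T' a = l := by rw [hT', Function.update_of_ne hab, Function.update_self]
        have hmem : ∀ e (s : Stop n m), s ∈ T e → ∃ e', w e' ≤ w e ∧ s ∈ T' e' := by
          intro e s he
          by_cases heb : e = b
          · subst heb
            refine ⟨a, hwab, ?_⟩
            rw [hTa, hl]
            rw [hXY'] at he
            simp only [List.mem_append, List.mem_cons] at he ⊢
            tauto
          · refine ⟨e, le_rfl, ?_⟩
            by_cases hea : e = a
            · subst hea
              rw [hTa, hl]
              rw [hXY] at he
              simp only [List.mem_append, List.mem_cons] at he ⊢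
              tauto
            · rwa [hT', Function.update_of_ne heb, Function.update_of_ne hea]
        refine ⟨T', ⟨?_, ?_, ?_, ?_, ?_⟩, a, haw, by rw [hTa, hl]; simp⟩
        · intro i'
          obtain ⟨e, he, he'⟩ := h.agent i'
          obtain ⟨e', h1, h2⟩ := hmem e _ he'
          exact ⟨e', h1.trans he, h2⟩
        · intro j' v' hj'
          refine (h.lying j' v' hj').imp id fun ⟨e, he⟩ => ?_
          obtain ⟨e', h1, h2⟩ := hmem e _ he
          exact ⟨e', h2⟩
        · intro j' i' hj'
          obtain ⟨e, he, he'⟩ := h.carried j' i' hj'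
          obtain ⟨e', h1, h2⟩ := hmem e _ he'
          exact ⟨e', h1.trans he, h2⟩
        · exact h.unique
        · have hb0 : b ∈ Finset.univ.erase a := by simp [hab.symm]
          refine le_trans ?_ h.cost_le
          rw [← Finset.add_sum_erase _ _ (Finset.mem_univ a), ← Finset.add_sum_erase _ _ hb0,
            ← Finset.add_sum_erase _ _ (Finset.mem_univ a), ← Finset.add_sum_erase _ _ hb0]
          rw [← add_assoc, ← add_assoc]
          refine add_le_add ?_ (le_of_eq (Finset.sum_congr rfl fun e he => ?_))
          · rw [hTa, hT', Function.update_self, hXY, hXY', hl, tourLen_append_cons,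
              tourLen_append_cons, tourLen_append_cons, tourLen_append_cons]
            simp only [tourLen, stopIn, stopOut, nodeDist_self, add_zero, mul_zero]
            -- Between `Y'` and `X'` the old tour of `b` passes through `I.start b`; the new one may
            -- omit this visit.
            calc _ ≤ w a * (I.tourLen (I.start a) X (c.pos i) +
                  ((I.tourLen (c.pos i) Y' (I.start b) + I.tourLen (I.start b) X' (I.source j)) +
                    I.nodeDist (I.source j) (c.pos i) + I.tourLen (c.pos i) Y (I.start a))) := by
                  gcongr
                  exact I.tourLen_append_le _ _ _ _ _
              _ = w a * (I.tourLen (I.start a) X (c.pos i) + I.tourLen (c.pos i) Y (I.start a)) +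
                  w a * (I.tourLen (I.start b) X' (I.source j) +
                    I.nodeDist (I.source j) (c.pos i) + I.tourLen (c.pos i) Y' (I.start b)) := by
                  ring
              _ ≤ _ := by gcongr
          · rw [Finset.mem_erase, Finset.mem_erase] at he
            rw [hT', Function.update_of_ne he.1, Function.update_of_ne he.2.1]
    obtain ⟨T', h', a, haw, ha⟩ := key
    refine ⟨T', h'.agent, ?_, ?_, ?_, h'.cost_le⟩
    · intro j' v' hj'
      by_cases hjj : j' = j
      · subst hjj; simp at hj'
      · exact h'.lying j' v' (by simpa [Function.update_of_ne hjj] using hj')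
    · intro j' i' hj'
      by_cases hjj : j' = j
      · subst hjj
        simp only [Function.update_self, Sum.inr.injEq] at hj'
        subst hj'
        exact ⟨a, haw, ha⟩
      · exact h'.carried j' i' (by simpa [Function.update_of_ne hjj] using hj')
    · intro j₁ j₂ i' h₁ h₂
      by_cases e₁ : j₁ = j <;> by_cases e₂ : j₂ = j
      · rw [e₁, e₂]
      · subst e₁
        simp only [Function.update_self, Sum.inr.injEq, Function.update_of_ne e₂] at h₁ h₂
        subst h₁
        exact absurd h₂ (hfree j₂)
      · subst e₂
        simp only [Function.update_self, Sum.inr.injEq, Function.update_of_ne e₁] at h₁ h₂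
        subst h₂
        exact absurd h₁ (hfree j₁)
      · simp only [Function.update_of_ne e₁, Function.update_of_ne e₂] at h₁ h₂
        exact h.unique _ _ _ h₁ h₂
  | drop i j hj =>
    have hcost : ∑ i', w i' * I.actionDist i' (.drop i j) = 0 := by simp [actionDist]
    rw [hcost, mul_zero, add_zero]
    refine ⟨T, h.agent, ?_, ?_, ?_, h.cost_le⟩
    · intro j' v' hj'
      by_cases hjj : j' = j
      · subst hjj
        simp only [Function.update_self, Sum.inl.injEq] at hj'
        subst hj'
        obtain ⟨a, -, ha⟩ := h.carried j' i hj
        exact .inr ⟨a, ha⟩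
      · exact h.lying j' v' (by simpa [Function.update_of_ne hjj] using hj')
    · intro j' i' hj'
      by_cases hjj : j' = j
      · subst hjj; simp at hj'
      · exact h.carried j' i' (by simpa [Function.update_of_ne hjj] using hj')
    · intro j₁ j₂ i' h₁ h₂
      by_cases e₁ : j₁ = j
      · subst e₁; simp at h₁
      by_cases e₂ : j₂ = j
      · subst e₂; simp at h₂
      simp only [Function.update_of_ne e₁, Function.update_of_ne e₂] at h₁ h₂
      exact h.unique _ _ _ h₁ h₂

theorem Covers.run {I : Instance n m k} {w : Fin k → ℝ≥0} {c c' : Config n m k}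
    {x : List (Action n m k)} (hr : I.Run c x c') {T : Fin k → List (Stop n m)} {A : ℝ≥0}
    (h : I.Covers w c T A) :
    ∃ T', I.Covers w c' T' (A + 2 * ∑ i, w i * (x.map (I.actionDist i)).sum) := by
  induction hr generalizing T A with
  | nil c => exact ⟨T, by simpa using h⟩
  | cons hs _ ih =>
    obtain ⟨T₁, h₁⟩ := h.step hs
    obtain ⟨T₂, h₂⟩ := ih h₁
    refine ⟨T₂, ?_⟩
    convert h₂ using 1
    simp only [List.map_cons, List.sum_cons, mul_add, Finset.sum_add_distrib, Finset.mul_sum]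
    ring

/-- Whatever a feasible solution does, for at most twice its cost the packages can be divided among
the agents so that every agent carries its packages one after another from source to target and
returns to its starting node. -/
theorem exists_tours_le (I : Instance n m k) [NeZero k] (w : Fin k → ℝ≥0) (y : I.Solution) :
    ∃ (asg : Fin m → Fin k) (l : Fin k → List (Fin m)), (∀ a, (l a).Nodup) ∧
      (∀ a j, j ∈ l a ↔ I.source j ≠ I.target j ∧ asg j = a) ∧
      ∑ a, w a * I.tourLen (I.start a) ((l a).map fun j => .carry j (I.target j)) (I.start a) ≤
        2 * I.cost y w := by
  classical
  obtain ⟨c, hr, hc⟩ := y.2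
  obtain ⟨T, hT⟩ := (I.covers_initial w).run hr
  -- Packages that start at their targets may have no transport in any tour; they receive the dummy
  -- agent `0` and appear in no list.
  have hex : ∀ j, ∃ a, I.source j ≠ I.target j → Stop.carry j (I.target j) ∈ T a := by
    intro j
    rcases hT.lying j _ (hc j) with h | ⟨a, ha⟩
    · exact ⟨0, fun hne => absurd h.symm hne⟩
    · exact ⟨a, fun _ => ha⟩
  choose asg hasg using hex
  -- Only transports that reach the target are kept, and only in the tour of the assigned agent,
  -- since the same transport may occur in several tours.
  let f : Fin k → Stop n m → Option (Fin m) := fun a s => match s with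
    | .node _ => none
    | .carry j u => if u = I.target j ∧ I.source j ≠ I.target j ∧ asg j = a then some j else none
  refine ⟨asg, fun a => ((T a).filterMap (f a)).dedup, fun a => List.nodup_dedup _, ?_, ?_⟩
  · intro a j
    simp only [List.mem_dedup, List.mem_filterMap]
    constructor
    · rintro ⟨s, hs, hf⟩
      cases s with
      | node u => simp [f] at hf
      | carry j' u =>
        simp only [f, Option.ite_none_right_eq_some, Option.some.injEq] at hf
        rw [← hf.2]
        exact hf.1.2
    · rintro ⟨hne, rfl⟩
      exact ⟨_, hasg j hne, by simp [f, hne]⟩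
  · refine le_trans (Finset.sum_le_sum fun a _ => ?_) (hT.cost_le.trans ?_)
    · gcongr
      refine I.tourLen_mono (((List.dedup_sublist _).map _).trans ?_) _ _
      generalize T a = L
      induction L with
      | nil => simp
      | cons s L ih =>
        cases s with
        | node u => simpa [f] using ih.cons _
        | carry j u =>
          by_cases hu : u = I.target j ∧ I.source j ≠ I.target j ∧ asg j = a
          · have : f a (.carry j u) = some j := by simp only [f]; rw [if_pos hu]
            rw [List.filterMap_cons_some this, List.map_cons, hu.1]
            exact ih.cons_cons _
          · have : f a (.carry j u) = none := by simp only [f]; rw [if_neg hu]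
            rw [List.filterMap_cons_none this]
            exact ih.cons _
    · rw [zero_add]; rfl

end Instance

end Delivery

/-! ## The state graph of delivery without handovers -/

namespace Delivery

/-- A weighted edge of the state graph, labelled with the code of an action (or with `3, 0, 0, 0`
if nothing happens). -/
structure Edge where
  src : ℕ
  dst : ℕ
  c0 : ℕ
  c1 : ℕ
  c2 : ℕ
  c3 : ℕ
  len : ℝ

/-- The edge between the states shifted by `N`. -/
def Edge.shift (N : ℕ) (e : Edge) : Edge := { e with src := e.src + N, dst := e.dst + N }

/-- The walks of the agent `i` that carries package `c - 1` (no package if `c = 0`). -/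
def walkEdges (n m k : ℕ) (adj : ℕ → ℕ) (len : ℕ → ℝ) : List Edge :=
  (List.range (m + 1)).flatMap fun c => (List.range k).flatMap fun i =>
    (List.range n).flatMap fun u => (List.range n).flatMap fun v =>
      if 1 ≤ adj (u * n + v) then
        [⟨(c * k + i) * n + u, (c * k + i) * n + v, 0, i, u, v, len (u * n + v)⟩] else []

/-- When an agent has returned to its starting node, the next one becomes active. -/
def switchEdges (n k : ℕ) (p : ℕ → ℕ) : List Edge :=
  (List.range (k - 1)).flatMap fun i => [⟨i * n + p i, i * n + n + p (i + 1), 3, 0, 0, 0, 0⟩]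

/-- At the end nothing happens any more. -/
def stayEdge (n k : ℕ) (p : ℕ → ℕ) : Edge :=
  ⟨(k - 1) * n + p (k - 1), (k - 1) * n + p (k - 1), 3, 0, 0, 0, 0⟩

/-- Pickup and drop of package `j` when the set of delivered packages is `S`. -/
def deliveryEdges (n m k : ℕ) (s t : ℕ → ℕ) (j : ℕ) : List Edge :=
  (List.range (2 ^ j)).flatMap fun S => (List.range k).flatMap fun i =>
    [⟨S * ((m + 1) * (k * n)) + i * n + s j,
      S * ((m + 1) * (k * n)) + i * n + (j + 1) * (k * n) + s j, 1, i, j, 0, 0⟩,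
     ⟨S * ((m + 1) * (k * n)) + i * n + (j + 1) * (k * n) + t j,
      S * ((m + 1) * (k * n)) + i * n + 2 ^ j * ((m + 1) * (k * n)) + t j, 2, i, j, 0, 0⟩]

/-- The edges of the state graph when only the packages below `j` can be delivered. -/
def stateEdges (n m k : ℕ) (adj : ℕ → ℕ) (len : ℕ → ℝ) (s t p : ℕ → ℕ) : ℕ → List Edge
  | 0 => walkEdges n m k adj len ++ switchEdges n k p ++ [stayEdge n k p]
  | j + 1 => stateEdges n m k adj len s t p j ++
      (stateEdges n m k adj len s t p j).map (Edge.shift (2 ^ j * ((m + 1) * (k * n)))) ++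
      deliveryEdges n m k s t j

variable {n m k : ℕ}

/-- A state: the packages delivered so far, the package in transit, the active agent and its
node. -/
structure State (n m k : ℕ) where
  done : Finset (Fin m)
  load : Option (Fin m)
  agent : Fin k
  node : Fin n

/-! ### Mixed-radix numbering of the states -/

/-- Number of a load. -/
def loadCode : Option (Fin m) → ℕ
  | none => 0
  | some j => j + 1

theorem loadCode_injective : Function.Injective (loadCode : Option (Fin m) → ℕ) := by
  rintro (_ | a) (_ | b) h
  · rfl
  · simp [loadCode] at h
  · simp [loadCode] at h
  · simp only [loadCode, Nat.add_right_cancel_iff] at h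
    rw [Fin.ext h]

theorem loadCode_lt (c : Option (Fin m)) : loadCode c < m + 1 := by
  cases c with
  | none => simp [loadCode]
  | some j => simp [loadCode]

theorem exists_loadCode_eq {c : ℕ} (h : c < m + 1) : ∃ x : Option (Fin m), loadCode x = c := by
  cases c with
  | zero => exact ⟨none, rfl⟩
  | succ c => exact ⟨some ⟨c, by lia⟩, rfl⟩

/-- A set of packages as a binary number. -/
def bits (S : Finset (Fin m)) : ℕ := ∑ j ∈ S, 2 ^ (j : ℕ)

theorem bits_insert {S : Finset (Fin m)} {j : Fin m} (h : j ∉ S) :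
    bits (insert j S) = bits S + 2 ^ (j : ℕ) := by
  rw [bits, Finset.sum_insert h, add_comm]; rfl

theorem bits_injective : Function.Injective (bits : Finset (Fin m) → ℕ) := by
  intro S T h
  have : S.map Fin.valEmbedding = T.map Fin.valEmbedding :=
    Finset.geomSum_injective le_rfl (by simpa [bits] using h)
  simpa using this

theorem bits_lt {S : Finset (Fin m)} {J : ℕ} (h : ∀ j ∈ S, (j : ℕ) < J) : bits S < 2 ^ J := by
  have : bits S = ∑ i ∈ S.map Fin.valEmbedding, 2 ^ i := by simp [bits]
  rw [this]
  exact Nat.geomSum_lt le_rfl (by simpa using fun i => by simpa using h i)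

/-- The loops of the construction run over numbers; this reads each of them as a set of packages.
The induction splits off the top bit. -/
theorem exists_bits_eq {J x : ℕ} (hJ : J ≤ m) (hx : x < 2 ^ J) :
    ∃ S : Finset (Fin m), (∀ j ∈ S, (j : ℕ) < J) ∧ bits S = x := by
  induction J generalizing x with
  | zero => exact ⟨∅, by simp, by simp [bits] at hx ⊢; lia⟩
  | succ J ih =>
    by_cases h : x < 2 ^ J
    · obtain ⟨S, hS, rfl⟩ := ih (by lia) h
      exact ⟨S, fun j hj => (hS j hj).trans (by lia), rfl⟩
    · obtain ⟨S, hS, hx'⟩ := ih (x := x - 2 ^ J) (by lia) (by rw [pow_succ] at hx; lia)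
      have hJS : (⟨J, hJ⟩ : Fin m) ∉ S := fun hj => lt_irrefl _ (hS _ hj)
      refine ⟨insert ⟨J, hJ⟩ S, ?_, ?_⟩
      · intro j hj
        rcases Finset.mem_insert.1 hj with rfl | hj
        · simp
        · exact (hS j hj).trans (by lia)
      · rw [bits_insert hJS, hx']
        simp only
        lia

theorem bits_univ : bits (Finset.univ : Finset (Fin m)) + 1 = 2 ^ m := by
  rw [bits, Fin.sum_univ_eq_sum_range (fun i => 2 ^ i), Nat.geomSum_eq le_rfl]
  have := Nat.one_le_two_pow (n := m)
  simp
  lia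

/-- Number of a state. -/
def State.code (x : State n m k) : ℕ :=
  bits x.done * ((m + 1) * (k * n)) + (loadCode x.load * (k * n) + (x.agent * n + x.node))

theorem mul_add_inj {a b c d N : ℕ} (hb : b < N) (hd : d < N) (h : a * N + b = c * N + d) :
    a = c ∧ b = d := by
  have hN : 0 < N := by lia
  have h1 := congrArg (· / N) h
  have h2 := congrArg (· % N) h
  simpa [Nat.add_div_of_dvd_right, Nat.mul_add_mod', Nat.mod_eq_of_lt, Nat.div_eq_of_lt, hb, hd,
    hN, Nat.add_div_of_dvd_right (Nat.dvd_mul_left N _)] using And.intro h1 h2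

theorem mul_add_lt {a b N A : ℕ} (hb : b < N) (ha : a < A) : a * N + b < A * N := by
  calc a * N + b < (a + 1) * N := by rw [add_mul]; lia
    _ ≤ _ := Nat.mul_le_mul_right _ ha

theorem State.position_lt (x : State n m k) : x.agent * n + x.node < k * n :=
  mul_add_lt x.node.2 x.agent.2

theorem State.local_lt (x : State n m k) :
    loadCode x.load * (k * n) + (x.agent * n + x.node) < (m + 1) * (k * n) :=
  mul_add_lt x.position_lt (loadCode_lt _)

/-- The code is a mixed-radix number with digits set, load, agent and node, so the digits can be
peeled off one by one. Hence a walk along numbered edges determines its sequence of states. -/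
theorem State.code_injective : Function.Injective (State.code : State n m k → ℕ) := by
  intro x y h
  obtain ⟨h1, h2⟩ := mul_add_inj x.local_lt y.local_lt h
  obtain ⟨h2, h3⟩ := mul_add_inj x.position_lt y.position_lt h2
  obtain ⟨h3, h4⟩ := mul_add_inj x.node.2 y.node.2 h3
  cases x; cases y
  simp only [State.mk.injEq]
  exact ⟨bits_injective h1, loadCode_injective h2, Fin.ext h3, Fin.ext h4⟩

theorem State.code_lt (x : State n m k) {J : ℕ} (h : ∀ j ∈ x.done, (j : ℕ) < J) :
    x.code < 2 ^ J * ((m + 1) * (k * n)) :=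
  mul_add_lt x.local_lt (bits_lt h)

/-! ### Transitions, and their agreement with the constructed edge list -/

/-- Transitions between states in which only packages below `J` are delivered. -/
inductive Instance.Trans (I : Instance n m k) (J : ℕ) :
    State n m k → Option (Action n m k) → State n m k → Prop where
  | walk (S : Finset (Fin m)) (c : Option (Fin m)) (i : Fin k) (u v : Fin n)
      (hS : ∀ j ∈ S, (j : ℕ) < J) (huv : I.graph.Adj u v) :
      I.Trans J ⟨S, c, i, u⟩ (some (.move i u v)) ⟨S, c, i, v⟩
  | switch (S : Finset (Fin m)) (i i' : Fin k) (hS : ∀ j ∈ S, (j : ℕ) < J)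
      (hi : (i' : ℕ) = i + 1) :
      I.Trans J ⟨S, none, i, I.start i⟩ none ⟨S, none, i', I.start i'⟩
  | stay (S : Finset (Fin m)) (i : Fin k) (hS : ∀ j ∈ S, (j : ℕ) < J) (hi : (i : ℕ) = k - 1) :
      I.Trans J ⟨S, none, i, I.start i⟩ none ⟨S, none, i, I.start i⟩
  | pickup (S : Finset (Fin m)) (i : Fin k) (j : Fin m) (hS : ∀ j ∈ S, (j : ℕ) < J)
      (hj : j ∉ S) (hJ : (j : ℕ) < J) :
      I.Trans J ⟨S, none, i, I.source j⟩ (some (.pickup i j)) ⟨S, some j, i, I.source j⟩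
  | drop (S : Finset (Fin m)) (i : Fin k) (j : Fin m) (hS : ∀ j ∈ S, (j : ℕ) < J)
      (hj : j ∉ S) (hJ : (j : ℕ) < J) :
      I.Trans J ⟨S, some j, i, I.target j⟩ (some (.drop i j))
        ⟨insert j S, none, i, I.target j⟩

/-- Code of an action that may be void. -/
def optionCode : Option (Action n m k) → ℕ × ℕ × ℕ × ℕ
  | none => (3, 0, 0, 0)
  | some a => a.code

/-- Length of the edge of the graph used by an action. -/
noncomputable def Instance.moveLen (I : Instance n m k) : Option (Action n m k) → ℝ≥0
  | some (.move _ u v) => I.len s(u, v)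
  | _ => 0

/-- The edge of the state graph that belongs to a transition. -/
noncomputable def Instance.edgeOf (I : Instance n m k) (x : State n m k)
    (a : Option (Action n m k)) (y : State n m k) : Edge :=
  ⟨x.code, y.code, (optionCode a).1, (optionCode a).2.1, (optionCode a).2.2.1,
    (optionCode a).2.2.2, (I.moveLen a : ℝ)⟩

/-- The edges of the state graph of an instance. -/
noncomputable def Instance.edges (I : Instance n m k) (J : ℕ) : List Edge :=
  stateEdges n m k ((I.input 0).narr 0) ((I.input 0).rarr 0) ((I.input 0).narr 1)
    ((I.input 0).narr 2) ((I.input 0).narr 3) J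

theorem Instance.input_adj (I : Instance n m k) (w : Fin k → ℝ≥0) (u v : Fin n) :
    1 ≤ (I.input w).narr 0 (u * n + v) ↔ I.graph.Adj u v := by
  have hn : 0 < n := u.pos
  have h1 : ((u : ℕ) * n + v) / n = u := by
    rw [mul_comm, Nat.mul_add_div hn, Nat.div_eq_of_lt v.2, add_zero]
  have h2 : ((u : ℕ) * n + v) % n = v := by
    rw [Nat.mul_add_mod', Nat.mod_eq_of_lt v.2]
  change 1 ≤ I.adjEntry ((u * n + v) / n) ((u * n + v) % n) ↔ _
  rw [h1, h2, adjEntry]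
  split_ifs with h
  · simpa using h.2.2
  · simpa using fun hh => h ⟨u.2, v.2, hh⟩

theorem Instance.input_len (I : Instance n m k) (w : Fin k → ℝ≥0) {u v : Fin n}
    (h : I.graph.Adj u v) : (I.input w).rarr 0 (u * n + v) = I.len s(u, v) := by
  have hn : 0 < n := u.pos
  have h1 : ((u : ℕ) * n + v) / n = u := by
    rw [mul_comm, Nat.mul_add_div hn, Nat.div_eq_of_lt v.2, add_zero]
  have h2 : ((u : ℕ) * n + v) % n = v := by
    rw [Nat.mul_add_mod', Nat.mod_eq_of_lt v.2]
  change I.lenEntry ((u * n + v) / n) ((u * n + v) % n) = _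
  rw [h1, h2, lenEntry, dif_pos ⟨u.2, v.2, h⟩]

theorem Instance.input_source (I : Instance n m k) (w : Fin k → ℝ≥0) (j : Fin m) :
    (I.input w).narr 1 j = I.source j := by
  simp [input]

theorem Instance.input_target (I : Instance n m k) (w : Fin k → ℝ≥0) (j : Fin m) :
    (I.input w).narr 2 j = I.target j := by
  simp [input]

theorem Instance.input_start (I : Instance n m k) (w : Fin k → ℝ≥0) (i : Fin k) :
    (I.input w).narr 3 i = I.start i := by
  simp [input]

/-- This is the base of the doubling: the delivered set is empty, but all loads are present already,
so later stages only have to copy walks. -/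
theorem Instance.mem_walkEdges (I : Instance n m k) (w : Fin k → ℝ≥0) (e : Edge) :
    e ∈ walkEdges n m k ((I.input w).narr 0) ((I.input w).rarr 0) ↔
      ∃ (c : Option (Fin m)) (i : Fin k) (u v : Fin n), I.graph.Adj u v ∧
        e = I.edgeOf ⟨∅, c, i, u⟩ (some (.move i u v)) ⟨∅, c, i, v⟩ := by
  simp only [walkEdges, List.mem_flatMap, List.mem_range]
  constructor
  · rintro ⟨c, hc, i, hi, u, hu, v, hv, he⟩
    obtain ⟨c, rfl⟩ := exists_loadCode_eq hc
    have h := I.input_adj w ⟨u, hu⟩ ⟨v, hv⟩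
    simp only at h
    split_ifs at he with hadj
    · have hl := I.input_len w (h.1 hadj)
      simp only at hl
      rw [List.mem_singleton] at he
      refine ⟨c, ⟨i, hi⟩, ⟨u, hu⟩, ⟨v, hv⟩, h.1 hadj, he.trans ?_⟩
      simp only [edgeOf, State.code, optionCode, Action.code, bits, moveLen, hl, Finset.sum_empty,
        Edge.mk.injEq, and_true]
      constructor <;> ring
    · simp at he
  · rintro ⟨c, i, u, v, hadj, rfl⟩
    refine ⟨loadCode c, loadCode_lt c, i, i.2, u, u.2, v, v.2, ?_⟩
    rw [if_pos ((I.input_adj w u v).2 hadj), List.mem_singleton, I.input_len w hadj]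
    simp only [edgeOf, State.code, optionCode, Action.code, bits, moveLen, Finset.sum_empty,
      Edge.mk.injEq, and_true]
    constructor <;> ring

theorem Instance.mem_switchEdges (I : Instance n m k) (w : Fin k → ℝ≥0) (e : Edge) :
    e ∈ switchEdges n k ((I.input w).narr 3) ↔
      ∃ (i i' : Fin k), (i' : ℕ) = i + 1 ∧
        e = I.edgeOf ⟨∅, none, i, I.start i⟩ none ⟨∅, none, i', I.start i'⟩ := by
  simp only [switchEdges, List.mem_flatMap, List.mem_range, List.mem_singleton]
  constructor
  · rintro ⟨i, hi, he⟩
    refine ⟨⟨i, by lia⟩, ⟨i + 1, by lia⟩, rfl, he.trans ?_⟩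
    have h1 := I.input_start w ⟨i, by lia⟩
    have h2 := I.input_start w ⟨i + 1, by lia⟩
    simp only at h1 h2
    simp [edgeOf, State.code, optionCode, bits, moveLen, loadCode, h1, h2]
    ring
  · rintro ⟨i, i', hi, rfl⟩
    refine ⟨i, by lia, ?_⟩
    have := I.input_start w i'
    rw [hi] at this
    simp [edgeOf, State.code, optionCode, bits, moveLen, loadCode, I.input_start w i, this, hi]
    ring

theorem Instance.eq_stayEdge (I : Instance n m k) (w : Fin k → ℝ≥0) (i : Fin k)
    (hi : (i : ℕ) = k - 1) :
    stayEdge n k ((I.input w).narr 3) =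
        I.edgeOf ⟨∅, none, i, I.start i⟩ none ⟨∅, none, i, I.start i⟩ := by
  have := I.input_start w i
  rw [hi] at this
  simp [stayEdge, edgeOf, State.code, optionCode, bits, moveLen, loadCode, this, hi]

theorem Instance.mem_deliveryEdges (I : Instance n m k) (w : Fin k → ℝ≥0) (j : Fin m) (e : Edge) :
    e ∈ deliveryEdges n m k ((I.input w).narr 1) ((I.input w).narr 2) j ↔
      ∃ (S : Finset (Fin m)) (i : Fin k), (∀ j' ∈ S, (j' : ℕ) < j) ∧
        (e = I.edgeOf ⟨S, none, i, I.source j⟩ (some (.pickup i j)) ⟨S, some j, i, I.source j⟩ ∨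
         e = I.edgeOf ⟨S, some j, i, I.target j⟩ (some (.drop i j))
          ⟨insert j S, none, i, I.target j⟩) := by
  have key : ∀ (S : Finset (Fin m)) (i : Fin k), (∀ j' ∈ S, (j' : ℕ) < j) →
      (I.edgeOf ⟨S, none, i, I.source j⟩ (some (.pickup i j)) ⟨S, some j, i, I.source j⟩ =
       ⟨bits S * ((m + 1) * (k * n)) + i * n + (I.input w).narr 1 j,
        bits S * ((m + 1) * (k * n)) + i * n + (j + 1) * (k * n) + (I.input w).narr 1 j,
        1, i, j, 0, 0⟩ ∧
       I.edgeOf ⟨S, some j, i, I.target j⟩ (some (.drop i j)) ⟨insert j S, none, i, I.target j⟩ =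
       ⟨bits S * ((m + 1) * (k * n)) + i * n + (j + 1) * (k * n) + (I.input w).narr 2 j,
        bits S * ((m + 1) * (k * n)) + i * n + 2 ^ (j : ℕ) * ((m + 1) * (k * n)) +
          (I.input w).narr 2 j, 2, i, j, 0, 0⟩) := by
    intro S i hS
    have hj : j ∉ S := fun h => lt_irrefl _ (hS j h)
    simp only [edgeOf, State.code, optionCode, moveLen, loadCode, I.input_source w,
      I.input_target w, bits_insert hj, Action.code, Edge.mk.injEq, and_true, NNReal.coe_zero,
      zero_mul, zero_add]
    refine ⟨⟨?_, ?_⟩, ?_, ?_⟩ <;> ring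
  simp only [deliveryEdges, List.mem_flatMap, List.mem_range, List.mem_cons, List.not_mem_nil,
    or_false]
  constructor
  · rintro ⟨x, hx, i, hi, he⟩
    obtain ⟨S, hS, rfl⟩ := exists_bits_eq (m := m) j.2.le hx
    exact ⟨S, ⟨i, hi⟩, hS, he.imp (fun h => h.trans (key S ⟨i, hi⟩ hS).1.symm)
      (fun h => h.trans (key S ⟨i, hi⟩ hS).2.symm)⟩
  · rintro ⟨S, i, hS, he⟩
    exact ⟨bits S, bits_lt hS, i, i.2, he.imp (fun h => h.trans (key S i hS).1)
      (fun h => h.trans (key S i hS).2)⟩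

/-- A new delivered package sets one new bit at both ends of the edge, which shifts both numbers by
the same amount. This is why one stage of the construction is a shifted copy. -/
theorem Instance.edgeOf_insert (I : Instance n m k) {x y : State n m k} (a : Option (Action n m k))
    {j : Fin m} (hx : j ∉ x.done) (hy : j ∉ y.done) :
    I.edgeOf { x with done := insert j x.done } a { y with done := insert j y.done } =
      (I.edgeOf x a y).shift (2 ^ (j : ℕ) * ((m + 1) * (k * n))) := by
  simp only [edgeOf, Edge.shift, State.code, bits_insert hx, bits_insert hy, Edge.mk.injEq,
    and_true]
  constructor <;> ring

theorem Instance.Trans.done_lt {I : Instance n m k} {J : ℕ} {x y : State n m k}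
    {a : Option (Action n m k)} (h : I.Trans J x a y) :
    (∀ j ∈ x.done, (j : ℕ) < J) ∧ (∀ j ∈ y.done, (j : ℕ) < J) := by
  cases h <;> simp_all

theorem Instance.Trans.insert {I : Instance n m k} {J : Fin m} {x y : State n m k}
    {a : Option (Action n m k)} (h : I.Trans J x a y) :
    I.Trans (J + 1) { x with done := insert J x.done } a { y with done := insert J y.done } := by
  have hS' : ∀ S : Finset (Fin m), (∀ j ∈ S, (j : ℕ) < J) → ∀ j ∈ Insert.insert J S,
      (j : ℕ) < J + 1 := by
    intro S hS j hj
    rcases Finset.mem_insert.1 hj with rfl | hj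
    · simp
    · exact (hS j hj).trans (by simp)
  cases h with
  | walk S c i u v hS huv => exact .walk _ _ _ _ _ (hS' S hS) huv
  | switch S i i' hS hi => exact .switch _ _ _ (hS' S hS) hi
  | stay S i hS hi => exact .stay _ _ (hS' S hS) hi
  | pickup S i j hS hj hJ =>
    exact .pickup _ _ _ (hS' S hS) (by simp [hj, Fin.ext_iff, hJ.ne]) (by lia)
  | drop S i j hS hj hJ =>
    have := Trans.drop (I := I) _ i j (hS' S hS) (by simp [hj, Fin.ext_iff, hJ.ne]) (by lia)
    rwa [Finset.insert_comm] at this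

theorem Instance.Trans.mono {I : Instance n m k} {J J' : ℕ} (hJ : J ≤ J') {x y : State n m k}
    {a : Option (Action n m k)} (h : I.Trans J x a y) : I.Trans J' x a y := by
  have hS' : ∀ S : Finset (Fin m), (∀ j ∈ S, (j : ℕ) < J) → ∀ j ∈ S, (j : ℕ) < J' :=
    fun S hS j hj => (hS j hj).trans_le hJ
  cases h with
  | walk S c i u v hS huv => exact .walk _ _ _ _ _ (hS' S hS) huv
  | switch S i i' hS hi => exact .switch _ _ _ (hS' S hS) hi
  | stay S i hS hi => exact .stay _ _ (hS' S hS) hi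
  | pickup S i j hS hj hJ' => exact .pickup _ _ _ (hS' S hS) hj (hJ'.trans_le hJ)
  | drop S i j hS hj hJ' => exact .drop _ _ _ (hS' S hS) hj (hJ'.trans_le hJ)

/-- A transition for packages up to `J` either does not concern package `J`, or takes place after
its delivery, or is its pickup or drop. -/
theorem Instance.Trans.cases_succ {I : Instance n m k} {J : Fin m} {x y : State n m k}
    {a : Option (Action n m k)} (h : I.Trans (J + 1) x a y) :
    I.Trans J x a y ∨
    (∃ x' y', I.Trans J x' a y' ∧ x = { x' with done := Insert.insert J x'.done } ∧
      y = { y' with done := Insert.insert J y'.done }) ∨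
    ∃ (S : Finset (Fin m)) (i : Fin k), (∀ j' ∈ S, (j' : ℕ) < J) ∧
      (x = ⟨S, none, i, I.source J⟩ ∧ a = some (.pickup i J) ∧ y = ⟨S, some J, i, I.source J⟩ ∨
       x = ⟨S, some J, i, I.target J⟩ ∧ a = some (.drop i J) ∧
        y = ⟨Insert.insert J S, none, i, I.target J⟩) := by
  have herase : ∀ S : Finset (Fin m), (∀ j ∈ S, (j : ℕ) < J + 1) → ∀ j ∈ S.erase J,
      (j : ℕ) < J := by
    intro S hS j hj
    have h1 := hS j (Finset.mem_of_mem_erase hj)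
    have h2 : (j : ℕ) ≠ J := fun h => Finset.ne_of_mem_erase hj (Fin.ext h)
    lia
  have hnot : ∀ S : Finset (Fin m), (∀ j ∈ S, (j : ℕ) < J + 1) → J ∉ S → ∀ j ∈ S,
      (j : ℕ) < J := fun S hS hJ j hj => herase S hS j (by
        rw [Finset.erase_eq_of_notMem hJ]; exact hj)
  cases h with
  | walk S c i u v hS huv =>
    by_cases hJS : J ∈ S
    · exact .inr (.inl ⟨_, _, .walk _ c i _ _ (herase S hS) huv, by
        simp [Finset.insert_erase hJS]⟩)
    · exact .inl (.walk _ _ _ _ _ (hnot S hS hJS) huv)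
  | switch S i i' hS hi =>
    by_cases hJS : J ∈ S
    · exact .inr (.inl ⟨_, _, .switch _ i i' (herase S hS) hi, by
        simp [Finset.insert_erase hJS]⟩)
    · exact .inl (.switch _ _ _ (hnot S hS hJS) hi)
  | stay S i hS hi =>
    by_cases hJS : J ∈ S
    · exact .inr (.inl ⟨_, _, .stay _ i (herase S hS) hi, by
        simp [Finset.insert_erase hJS]⟩)
    · exact .inl (.stay _ _ (hnot S hS hJS) hi)
  | pickup S i j hS hj hJ =>
    by_cases hjJ : j = J
    · subst hjJ
      exact .inr (.inr ⟨S, i, hnot S hS hj, .inl ⟨rfl, rfl, rfl⟩⟩)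
    have hJ' : (j : ℕ) < J := by
      have : (j : ℕ) ≠ J := fun h => hjJ (Fin.ext h)
      lia
    by_cases hJS : J ∈ S
    · exact .inr (.inl ⟨_, _, .pickup _ i j (herase S hS) (by simp [hj]) hJ', by
        simp [Finset.insert_erase hJS]⟩)
    · exact .inl (.pickup _ _ _ (hnot S hS hJS) hj hJ')
  | drop S i j hS hj hJ =>
    by_cases hjJ : j = J
    · subst hjJ
      exact .inr (.inr ⟨S, i, hnot S hS hj, .inr ⟨rfl, rfl, rfl⟩⟩)
    have hJ' : (j : ℕ) < J := by
      have : (j : ℕ) ≠ J := fun h => hjJ (Fin.ext h)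
      lia
    by_cases hJS : J ∈ S
    · exact .inr (.inl ⟨_, _, .drop _ i j (herase S hS) (by simp [hj]) hJ', by
        simp [Finset.insert_erase hJS, Finset.insert_comm J j]⟩)
    · exact .inl (.drop _ _ _ (hnot S hS hJS) hj hJ')

/-- The recursion of `stateEdges` mirrors the trichotomy `Trans.cases_succ`: transitions before the
delivery of package `J` form the old list, those after it form the shifted copy, and its pickups and
drops connect the two. -/
theorem Instance.mem_edges [NeZero k] (I : Instance n m k) {J : ℕ} (hJ : J ≤ m) (e : Edge) :
    e ∈ I.edges J ↔ ∃ x a y, I.Trans J x a y ∧ e = I.edgeOf x a y := by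
  induction J generalizing e with
  | zero =>
    have hk : k - 1 < k := Nat.sub_lt (NeZero.pos k) one_pos
    rw [edges, stateEdges, List.mem_append, List.mem_append, I.mem_walkEdges, I.mem_switchEdges,
      List.mem_singleton, I.eq_stayEdge 0 ⟨k - 1, hk⟩ rfl]
    constructor
    · rintro ((⟨c, i, u, v, h, rfl⟩ | ⟨i, i', h, rfl⟩) | rfl)
      · exact ⟨_, _, _, .walk ∅ c i u v (by simp) h, rfl⟩
      · exact ⟨_, _, _, .switch ∅ i i' (by simp) h, rfl⟩
      · exact ⟨_, _, _, .stay ∅ _ (by simp) rfl, rfl⟩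
    · rintro ⟨x, a, y, h, rfl⟩
      have hS0 : ∀ S : Finset (Fin m), (∀ j ∈ S, (j : ℕ) < 0) → S = ∅ := fun S hS =>
        Finset.eq_empty_of_forall_notMem fun j hj => by simpa using hS j hj
      cases h with
      | walk S c i u v hS huv =>
        rw [hS0 S hS]; exact .inl (.inl ⟨c, i, u, v, huv, rfl⟩)
      | switch S i i' hS hi => rw [hS0 S hS]; exact .inl (.inr ⟨i, i', hi, rfl⟩)
      | stay S i hS hi =>
        rw [hS0 S hS]
        right
        obtain rfl : i = ⟨k - 1, hk⟩ := Fin.ext hi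
        rfl
      | pickup S i j hS hj hJ => simp at hJ
      | drop S i j hS hj hJ => simp at hJ
  | succ J ih =>
    have ih := fun e => ih (by lia) e
    have hrec : I.edges (J + 1) = I.edges J ++
      (I.edges J).map (Edge.shift (2 ^ J * ((m + 1) * (k * n)))) ++
      deliveryEdges n m k ((I.input 0).narr 1) ((I.input 0).narr 2) J := rfl
    have hd := I.mem_deliveryEdges 0 ⟨J, hJ⟩ e
    simp only at hd
    rw [hrec, List.mem_append, List.mem_append, hd, ih, List.mem_map]
    have hnot : ∀ x : State n m k, (∀ j ∈ x.done, (j : ℕ) < J) → ⟨J, hJ⟩ ∉ x.done :=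
      fun x hx h => lt_irrefl _ (hx _ h)
    constructor
    · rintro ((⟨x, a, y, h, rfl⟩ | ⟨e, he, rfl⟩) | ⟨S, i, hS, rfl | rfl⟩)
      · exact ⟨x, a, y, h.mono (by lia), rfl⟩
      · obtain ⟨x, a, y, h, rfl⟩ := (ih e).1 he
        refine ⟨_, a, _, Trans.insert (J := ⟨J, hJ⟩) h, ?_⟩
        exact (I.edgeOf_insert a (hnot x h.done_lt.1) (hnot y h.done_lt.2)).symm
      · exact ⟨_, _, _, .pickup S i ⟨J, hJ⟩ (fun j hj => (hS j hj).trans (by simp))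
          (fun h => lt_irrefl _ (hS _ h)) (by simp), rfl⟩
      · exact ⟨_, _, _, .drop S i ⟨J, hJ⟩ (fun j hj => (hS j hj).trans (by simp))
          (fun h => lt_irrefl _ (hS _ h)) (by simp), rfl⟩
    · rintro ⟨x, a, y, h, rfl⟩
      rcases Trans.cases_succ (J := ⟨J, hJ⟩) h with h | ⟨x', y', h', rfl, rfl⟩ |
        ⟨S, i, hS, ⟨rfl, rfl, rfl⟩ | ⟨rfl, rfl, rfl⟩⟩
      · exact .inl (.inl ⟨x, a, y, h, rfl⟩)
      · refine .inl (.inr ⟨_, (ih _).2 ⟨x', a, y', h', rfl⟩, ?_⟩)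
        exact (I.edgeOf_insert a (hnot x' h'.done_lt.1) (hnot y' h'.done_lt.2)).symm
      · exact .inr ⟨S, i, hS, .inl rfl⟩
      · exact .inr ⟨S, i, hS, .inr rfl⟩

end Delivery

namespace Delivery

/-! ## Walks in the state graph -/

/-- `ω` is a walk from `x` to `y` along edges in `L`. -/
def IsWalk (L : List Edge) : ℕ → List Edge → ℕ → Prop
  | x, [], y => x = y
  | x, e :: ω, y => e ∈ L ∧ e.src = x ∧ IsWalk L e.dst ω y

/-- The distance that agent `i` travels in a walk. -/
def travel (i : ℕ) (ω : List Edge) : ℝ := (ω.map fun e => if e.c1 = i then e.len else 0).sum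

/-- The cost of a walk. -/
def walkCost (W : ℕ → ℝ) (ω : List Edge) : ℝ := (ω.map fun e => W e.c1 * e.len).sum

theorem isWalk_append {L : List Edge} {x y z : ℕ} {ω ω' : List Edge} (h : IsWalk L x ω y)
    (h' : IsWalk L y ω' z) : IsWalk L x (ω ++ ω') z := by
  induction ω generalizing x with
  | nil => obtain rfl : x = y := h; exact h'
  | cons e ω ih => exact ⟨h.1, h.2.1, ih h.2.2⟩

theorem IsWalk.mem {L : List Edge} {x y : ℕ} {ω : List Edge} (h : IsWalk L x ω y) :
    ∀ e ∈ ω, e ∈ L := by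
  induction ω generalizing x with
  | nil => simp
  | cons e ω ih => simpa using ⟨h.1, ih h.2.2⟩

theorem travel_append (i : ℕ) (ω ω' : List Edge) :
    travel i (ω ++ ω') = travel i ω + travel i ω' := by simp [travel]

variable {n m k : ℕ}

namespace Instance

/-- The configuration described by a state. -/
def config (I : Instance n m k) (x : State n m k) : Config n m k where
  pos := Function.update I.start x.agent x.node
  loc j := if x.load = some j then .inr x.agent else
    if j ∈ x.done then .inl (I.target j) else .inl (I.source j)

/-- The first state; packages that are already at their targets count as delivered. -/
def firstState [NeZero k] (I : Instance n m k) : State n m k :=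
  ⟨{j | I.source j = I.target j}, none, 0, I.start 0⟩

/-- The index of the last agent. -/
def lastAgent (k : ℕ) [NeZero k] : Fin k := ⟨k - 1, Nat.sub_lt (NeZero.pos k) one_pos⟩

/-- The last state. -/
def lastState [NeZero k] (I : Instance n m k) : State n m k :=
  ⟨Finset.univ, none, lastAgent k, I.start (lastAgent k)⟩

/-- Counting a package as delivered when its source is its target does not change where it lies. -/
theorem config_firstState [NeZero k] (I : Instance n m k) : I.config I.firstState = I.initial := by
  simp only [config, firstState, initial, Function.update_eq_self, Config.mk.injEq, true_and]
  ext1 j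
  by_cases h : I.source j = I.target j <;> simp [h]

theorem config_lastState_loc [NeZero k] (I : Instance n m k) (j : Fin m) :
    (I.config I.lastState).loc j = .inl (I.target j) := by
  simp [config, lastState]

/-- In a configuration every inactive agent is at home. A switch also leaves the old agent at home
and starts the next one there, so nothing moves. -/
theorem Trans.config_eq {I : Instance n m k} {J : ℕ} {x y : State n m k}
    (h : I.Trans J x none y) : I.config x = I.config y := by
  cases h <;> simp [config]

theorem Trans.step {I : Instance n m k} {J : ℕ} {x y : State n m k} {a : Action n m k}
    (h : I.Trans J x (some a) y) : I.Step (I.config x) a (I.config y) := by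
  cases h with
  | walk S c i u v hS huv =>
    have := Step.move (I := I) (I.config ⟨S, c, i, u⟩) i u v (by simp [config]) huv
    simpa [config] using this
  | pickup S i j hS hj hJ =>
    have := Step.pickup (I := I) (I.config ⟨S, none, i, I.source j⟩) i j (by simp [config, hj])
      -- The state has no load, so no package is carried by anybody.
      (fun j' => by simp only [config]; split_ifs <;> simp_all)
    convert this using 1
    simp only [config, Config.mk.injEq, true_and]
    ext1 j'
    by_cases hjj : j' = j
    · subst hjj; simp
    · simp [hjj, Ne.symm hjj]
  | drop S i j hS hj hJ =>
    have := Step.drop (I := I) (I.config ⟨S, some j, i, I.target j⟩) i j (by simp [config])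
    convert this using 1
    simp only [config, Config.mk.injEq, true_and]
    ext1 j'
    by_cases hjj : j' = j
    · subst hjj; simp
    · simp [hjj, Ne.symm hjj]

theorem actionDist_eq (I : Instance n m k) (i : Fin k) (a : Action n m k) :
    I.actionDist i a = if a.code.2.1 = i then I.moveLen (some a) else 0 := by
  cases a with
  | move i' u v =>
    by_cases h : i' = i
    · exact (if_pos h).trans (if_pos (congrArg Fin.val h)).symm
    · exact (if_neg h).trans (if_neg fun h' => h (Fin.ext h')).symm
  | pickup i' j => exact (ite_self _).symm
  | drop i' j => exact (ite_self _).symm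

/-- A walk in the state graph describes a sequence of actions. -/
theorem exists_run_of_isWalk [NeZero k] (I : Instance n m k) {ω : List Edge} {x y : State n m k}
    (h : IsWalk (I.edges m) x.code ω y.code) :
    ∃ acts : List (Action n m k), I.Run (I.config x) acts (I.config y) ∧
      acts.map Action.code =
        (ω.filter fun e => e.c0 ≠ 3).map (fun e => (e.c0, e.c1, e.c2, e.c3)) ∧
      ∀ i : Fin k, (((acts.map (I.actionDist i)).sum : ℝ≥0) : ℝ) = travel i ω := by
  induction ω generalizing x with
  | nil =>
    obtain rfl := State.code_injective h
    exact ⟨[], .nil _, by simp, by simp [travel]⟩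
  | cons e ω ih =>
    obtain ⟨he, hx, hω⟩ := h
    -- Each numbered edge comes from a transition. Void transitions are removed by the filter on
    -- code `3` and leave the configuration unchanged.
    obtain ⟨x', a, z, ht, rfl⟩ := (I.mem_edges le_rfl e).1 he
    obtain rfl := State.code_injective hx
    obtain ⟨acts, h1, h2, h3⟩ := ih hω
    cases a with
    | none =>
      refine ⟨acts, ht.config_eq ▸ h1, ?_, fun i => ?_⟩
      · rw [h2]; simp [edgeOf, optionCode]
      · rw [h3]; simp [travel, edgeOf, moveLen]
    | some a =>
      refine ⟨a :: acts, .cons ht.step h1, ?_, fun i => ?_⟩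
      · have : a.code.1 ≠ 3 := by cases a <;> simp [Action.code]
        rw [List.map_cons, h2, List.filter_cons_of_pos (p := fun e : Edge => decide (e.c0 ≠ 3))
          (a := I.edgeOf x' (some a) z) (decide_eq_true this)]
        simp [edgeOf, optionCode]
      · rw [List.map_cons, List.sum_cons, NNReal.coe_add, h3, actionDist_eq]
        simp only [travel, edgeOf, optionCode, List.map_cons, List.sum_cons]
        split_ifs <;> simp

theorem mem_edges_bounds [NeZero k] (I : Instance n m k) {e : Edge} (h : e ∈ I.edges m) :
    e.src < 2 ^ m * ((m + 1) * (k * n)) ∧ e.dst < 2 ^ m * ((m + 1) * (k * n)) ∧ e.c1 < k := by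
  obtain ⟨x, a, y, ht, rfl⟩ := (I.mem_edges le_rfl e).1 h
  refine ⟨x.code_lt ht.done_lt.1, y.code_lt ht.done_lt.2, ?_⟩
  cases ht <;> simp [edgeOf, optionCode, Action.code, NeZero.pos]

/-- Every edge is charged to exactly one genuine agent. Void edges name agent `0`, which is harmless
because their length is zero. -/
theorem walkCost_eq [NeZero k] (I : Instance n m k) (W : ℕ → ℝ) {ω : List Edge}
    (h : ∀ e ∈ ω, e ∈ I.edges m) : walkCost W ω = ∑ i : Fin k, W i * travel i ω := by
  induction ω with
  | nil => simp [walkCost, travel]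
  | cons e ω ih =>
    have hc := (I.mem_edges_bounds (h e (by simp))).2.2
    have ih := ih fun e he => h e (by simp [he])
    simp only [walkCost, travel, List.map_cons, List.sum_cons, mul_add,
      Finset.sum_add_distrib] at ih ⊢
    rw [ih]
    congr 1
    rw [Finset.sum_eq_single ⟨e.c1, hc⟩]
    · simp
    · intro b _ hb
      rw [if_neg (fun h => hb (Fin.ext h.symm)), mul_zero]
    · simp

/-! ### Tours as walks in the state graph -/

/-- There is a walk of `ℓ` edges from `x` to `y` in which the agents travel the distances `f`. -/
def Conn (I : Instance n m k) (x y : State n m k) (ℓ : ℕ) (f : Fin k → ℝ≥0) : Prop :=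
  ∃ ω, IsWalk (I.edges m) x.code ω y.code ∧ ω.length = ℓ ∧ ∀ a : Fin k, travel a ω = f a

theorem Conn.refl (I : Instance n m k) (x : State n m k) : I.Conn x x 0 0 :=
  ⟨[], rfl, rfl, by simp [travel]⟩

theorem Conn.append {I : Instance n m k} {x y z : State n m k} {ℓ ℓ' : ℕ} {f f' : Fin k → ℝ≥0}
    (h : I.Conn x y ℓ f) (h' : I.Conn y z ℓ' f') : I.Conn x z (ℓ + ℓ') (f + f') := by
  obtain ⟨ω, h1, h2, h3⟩ := h
  obtain ⟨ω', h1', h2', h3'⟩ := h'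
  exact ⟨ω ++ ω', isWalk_append h1 h1', by simp [h2, h2'], fun a => by
    rw [travel_append, h3, h3']; simp⟩

theorem Conn.of_trans [NeZero k] {I : Instance n m k} {x y : State n m k}
    {a : Option (Action n m k)} (h : I.Trans m x a y) {f : Fin k → ℝ≥0}
    (hf : ∀ i : Fin k, f i = if (optionCode a).2.1 = i then I.moveLen a else 0) :
    I.Conn x y 1 f :=
  ⟨[I.edgeOf x a y], ⟨(I.mem_edges le_rfl _).2 ⟨x, a, y, h, rfl⟩, rfl, rfl⟩, rfl, fun i => by
    rw [hf]; simp only [travel, edgeOf]; split_ifs <;> simp [*]⟩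

theorem Conn.walk [NeZero k] (I : Instance n m k) (S : Finset (Fin m)) (c : Option (Fin m))
    (i : Fin k) {u v : Fin n} (p : I.graph.Walk u v) :
    I.Conn ⟨S, c, i, u⟩ ⟨S, c, i, v⟩ p.length (Pi.single i (I.walkLen p)) := by
  induction p with
  | nil => simpa [walkLen] using Conn.refl I _
  | @cons u v x h p ih =>
    have h1 : I.Conn ⟨S, c, i, u⟩ ⟨S, c, i, v⟩ 1 (Pi.single i (I.len s(u, v))) :=
      .of_trans (.walk S c i u v (by simp) h) fun i' => by
        simp only [optionCode, Action.code, moveLen, Pi.single_apply, Fin.ext_iff, @eq_comm _ (i : ℕ)]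
    have h2 := h1.append ih
    rw [← Pi.single_add] at h2
    simpa [walkLen, add_comm] using h2

theorem Conn.route [NeZero k] (I : Instance n m k) (S : Finset (Fin m)) (c : Option (Fin m))
    (i : Fin k) (u v : Fin n) :
    ∃ ℓ, ℓ + 1 ≤ n ∧
      I.Conn ⟨S, c, i, u⟩ ⟨S, c, i, v⟩ ℓ (Pi.single i (I.nodeDist u v)) :=
  ⟨_, I.length_route_lt u v, .walk I S c i (I.route u v)⟩

/-- Two routes of at most `n - 1` edges each, one pickup and one drop make at most `2 * n` edges. -/
theorem Conn.deliver [NeZero k] (I : Instance n m k) (S : Finset (Fin m)) (i : Fin k) (u : Fin n)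
    {j : Fin m} (hj : j ∉ S) :
    ∃ ℓ ≤ 2 * n, I.Conn ⟨S, none, i, u⟩ ⟨insert j S, none, i, I.target j⟩ ℓ
      (Pi.single i (I.nodeDist u (I.source j) + I.nodeDist (I.source j) (I.target j))) := by
  obtain ⟨ℓ₁, h₁, h₁'⟩ := Conn.route I S none i u (I.source j)
  obtain ⟨ℓ₂, h₂, h₂'⟩ := Conn.route I S (some j) i (I.source j) (I.target j)
  have hp : I.Conn ⟨S, none, i, I.source j⟩ ⟨S, some j, i, I.source j⟩ 1 0 :=
    .of_trans (.pickup S i j (by simp) hj (by simp)) fun i' => by simp [moveLen]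
  have hd : I.Conn ⟨S, some j, i, I.target j⟩ ⟨insert j S, none, i, I.target j⟩ 1 0 :=
    .of_trans (.drop S i j (by simp) hj (by simp)) fun i' => by simp [moveLen]
  have h := ((h₁'.append hp).append h₂').append hd
  rw [add_zero, add_zero, ← Pi.single_add] at h
  exact ⟨_, by lia, h⟩

/-- The edge count is measured by the potential `2 * n * card`: each delivery spends at most `2 * n`
edges and adds one package, and the final route takes at most `n - 1`. The estimate is in additive
form to avoid truncated subtraction. -/
theorem Conn.tour [NeZero k] (I : Instance n m k) (S S' : Finset (Fin m)) (i : Fin k) (u v : Fin n)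
    (l : List (Fin m)) (hl : l.Nodup) (hlS : ∀ j ∈ l, j ∉ S)
    (hS' : ∀ j, j ∈ S' ↔ j ∈ S ∨ j ∈ l) :
    ∃ ℓ, ℓ + 2 * n * S.card + 1 ≤ 2 * n * S'.card + n ∧ I.Conn ⟨S, none, i, u⟩ ⟨S', none, i, v⟩ ℓ
      (Pi.single i (I.tourLen u (l.map fun j => .carry j (I.target j)) v)) := by
  induction l generalizing S u with
  | nil =>
    obtain ⟨ℓ, h, h'⟩ := Conn.route I S none i u v
    obtain rfl : S' = S := by ext j; simp [hS']
    exact ⟨ℓ, by lia, h'⟩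
  | cons j l ih =>
    have hj : j ∉ S := hlS j (by simp)
    obtain ⟨ℓ₁, h₁, h₁'⟩ := Conn.deliver I S i u hj
    obtain ⟨ℓ₂, h₂, h₂'⟩ := ih (insert j S) (I.target j) (List.nodup_cons.1 hl).2
      (fun j' hj' => by
        rw [Finset.mem_insert, not_or]
        exact ⟨fun h => (List.nodup_cons.1 hl).1 (h ▸ hj'), hlS j' (by simp [hj'])⟩)
      (fun j' => by rw [hS', Finset.mem_insert, List.mem_cons]; tauto)
    have h := h₁'.append h₂'
    rw [← Pi.single_add] at h
    rw [Finset.card_insert_of_notMem hj] at h₂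
    exact ⟨_, by lia, h⟩

/-- Closed tours of all agents that deliver all packages give a walk through the state graph. -/
theorem exists_walk_of_tours [NeZero k] (I : Instance n m k) (asg : Fin m → Fin k)
    (l : Fin k → List (Fin m)) (hl : ∀ a, (l a).Nodup)
    (hasg : ∀ a j, j ∈ l a ↔ I.source j ≠ I.target j ∧ asg j = a) :
    ∃ ω, IsWalk (I.edges m) I.firstState.code ω I.lastState.code ∧
      ω.length = n * (k + 2 * m) ∧ ∀ a : Fin k, travel a ω =
        I.tourLen (I.start a) ((l a).map fun j => .carry j (I.target j)) (I.start a) := by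
  classical
  set F : Fin k → ℝ≥0 := fun a =>
    I.tourLen (I.start a) ((l a).map fun j => .carry j (I.target j)) (I.start a) with hF
  -- Induction over the agents. Each one adds at most `n` edges beyond its deliveries; the slack `+
  -- 1` pays for the switch to the next agent.
  have key : ∀ (r : ℕ) (hr : r < k), ∃ ℓ S, ℓ + 1 ≤ 2 * n * S.card + n * (r + 1) ∧
      (∀ j, j ∈ S ↔ I.source j = I.target j ∨ (asg j : ℕ) ≤ r) ∧
      I.Conn I.firstState ⟨S, none, ⟨r, hr⟩, I.start ⟨r, hr⟩⟩ ℓ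
        (fun a => if (a : ℕ) ≤ r then F a else 0) := by
    intro r
    induction r with
    | zero =>
      intro hr
      obtain ⟨ℓ, h, h'⟩ := Conn.tour I I.firstState.done
        {j | I.source j = I.target j ∨ (asg j : ℕ) ≤ 0} 0 (I.start 0) (I.start 0) (l 0) (hl 0)
        (fun j hj => by simpa [firstState] using ((hasg 0 j).1 hj).1)
        (fun j => by simp [firstState, hasg]; tauto)
      refine ⟨ℓ, Finset.univ.filter fun j => I.source j = I.target j ∨ (asg j : ℕ) ≤ 0,
        by lia, fun j => by simp, ?_⟩
      · have h0 : (⟨0, hr⟩ : Fin k) = 0 := Fin.ext (by simp)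
        rw [h0]
        change I.Conn I.firstState _ _ _ at h'
        convert h' using 1
        ext a
        have ha : a = 0 ↔ (a : ℕ) ≤ 0 := by simp
        by_cases h : a = 0
        · subst h; simp [hF]
        · simp [h, (ha.not.1 h)]
    | succ r ih =>
      intro hr
      obtain ⟨ℓ₁, S, h₁, hS, h₁'⟩ := ih (by lia)
      obtain ⟨ℓ, h, h'⟩ := Conn.tour I S
        {j | I.source j = I.target j ∨ (asg j : ℕ) ≤ r + 1} ⟨r + 1, hr⟩ (I.start ⟨r + 1, hr⟩)
        (I.start ⟨r + 1, hr⟩) (l ⟨r + 1, hr⟩) (hl _)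
        (fun j hj => by
          have := (hasg _ j).1 hj
          simp [hS, this])
        (fun j => by
          simp only [Finset.mem_filter, Finset.mem_univ, true_and, hS, hasg, Fin.ext_iff]
          by_cases hh : I.source j = I.target j
          · simp [hh]
          · simp [hh]; lia)
      have hsw : I.Conn ⟨S, none, ⟨r, by lia⟩, I.start ⟨r, by lia⟩⟩
          ⟨S, none, ⟨r + 1, hr⟩, I.start ⟨r + 1, hr⟩⟩ 1 0 :=
        .of_trans (.switch S _ _ (by simp) rfl) fun i' => by simp [moveLen]
      refine ⟨ℓ₁ + 1 + ℓ, Finset.univ.filter fun j => I.source j = I.target j ∨ (asg j : ℕ) ≤ r + 1, ?_,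
        fun j => by simp, ?_⟩
      rotate_left
      · convert (h₁'.append hsw).append h' using 1
        ext a
        simp only [Pi.single_apply, Pi.add_apply, add_zero, Fin.ext_iff]
        by_cases h1 : (a : ℕ) ≤ r
        · simp [h1, show (a : ℕ) ≤ r + 1 by lia, show (a : ℕ) ≠ r + 1 by lia]
        · by_cases h2 : (a : ℕ) = r + 1
          · have : a = ⟨r + 1, hr⟩ := Fin.ext h2
            subst this
            simp [hF]
          · simp [h1, h2, show ¬ (a : ℕ) ≤ r + 1 by lia]
      · have : n * (r + 1 + 1) = n * (r + 1) + n := by ring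
        lia
  obtain ⟨ℓ, S, h, hS, hc⟩ := key (k - 1) (lastAgent k).2
  obtain rfl : S = Finset.univ := by
    ext j
    have := (asg j).2
    simp only [hS, Finset.mem_univ, iff_true]
    right; lia
  have hle : ℓ ≤ n * (k + 2 * m) := by
    have hk : k - 1 + 1 = k := Nat.sub_add_cancel (NeZero.pos k)
    rw [Finset.card_univ, Fintype.card_fin, hk] at h
    nlinarith
  -- The loop at the last state fills the walk up to the prescribed number of edges without any
  -- travel.
  have hstay : ∀ r, I.Conn I.lastState I.lastState r 0 := by
    intro r
    induction r with
    | zero => exact .refl I _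
    | succ r ih =>
      have : I.Conn I.lastState I.lastState 1 0 :=
        .of_trans (.stay _ _ (by simp) rfl) fun i' => by simp [moveLen]
      simpa using ih.append this
  obtain ⟨ω, h1, h2, h3⟩ := hc.append (hstay (n * (k + 2 * m) - ℓ))
  refine ⟨ω, h1, by lia, fun a => ?_⟩
  rw [h3]
  have : (a : ℕ) ≤ k - 1 := by have := a.2; lia
  simp [this, hF]

end Instance

end Delivery

/-! ## Reasoning about programs -/

namespace RealRAM

infixr:60 " ;; " => Cmd.seq

/-! ### Frames: the memory that a program may change -/

/-- Natural-number registers assigned by a program. -/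
def Cmd.nregs : Cmd → List ℕ
  | .setN r _ => [r]
  | .seq p q => p.nregs ++ q.nregs
  | .ite _ p q => p.nregs ++ q.nregs
  | .loop _ p => p.nregs
  | _ => []

/-- Natural-number arrays assigned by a program. -/
def Cmd.narrs : Cmd → List ℕ
  | .putN a _ _ => [a]
  | .seq p q => p.narrs ++ q.narrs
  | .ite _ p q => p.narrs ++ q.narrs
  | .loop _ p => p.narrs
  | _ => []

/-- Real registers assigned by a program. -/
def Cmd.rregs : Cmd → List ℕ
  | .setR r _ => [r]
  | .seq p q => p.rregs ++ q.rregs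
  | .ite _ p q => p.rregs ++ q.rregs
  | .loop _ p => p.rregs
  | _ => []

/-- Real arrays assigned by a program. -/
def Cmd.rarrs : Cmd → List ℕ
  | .putR a _ _ => [a]
  | .seq p q => p.rarrs ++ q.rarrs
  | .ite _ p q => p.rarrs ++ q.rarrs
  | .loop _ p => p.rarrs
  | _ => []

/-- `s'` differs from `s` only in registers and arrays to which `c` assigns. -/
structure Frame (c : Cmd) (s s' : Store) : Prop where
  nreg : ∀ r, r ∉ c.nregs → s'.nreg r = s.nreg r
  narr : ∀ a, a ∉ c.narrs → s'.narr a = s.narr a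
  rreg : ∀ r, r ∉ c.rregs → s'.rreg r = s.rreg r
  rarr : ∀ a, a ∉ c.rarrs → s'.rarr a = s.rarr a

theorem Frame.refl (c : Cmd) (s : Store) : Frame c s s :=
  ⟨fun _ _ => rfl, fun _ _ => rfl, fun _ _ => rfl, fun _ _ => rfl⟩

theorem Frame.trans {c : Cmd} {s s' s'' : Store} (h : Frame c s s') (h' : Frame c s' s'') :
    Frame c s s'' :=
  ⟨fun r hr => (h'.nreg r hr).trans (h.nreg r hr), fun r hr => (h'.narr r hr).trans (h.narr r hr),
    fun r hr => (h'.rreg r hr).trans (h.rreg r hr), fun r hr => (h'.rarr r hr).trans (h.rarr r hr)⟩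

theorem Frame.mono {c c' : Cmd} {s s' : Store} (h : Frame c s s') (h1 : c.nregs ⊆ c'.nregs)
    (h2 : c.narrs ⊆ c'.narrs) (h3 : c.rregs ⊆ c'.rregs) (h4 : c.rarrs ⊆ c'.rarrs) :
    Frame c' s s' :=
  ⟨fun r hr => h.nreg r fun h => hr (h1 h), fun r hr => h.narr r fun h => hr (h2 h),
    fun r hr => h.rreg r fun h => hr (h3 h), fun r hr => h.rarr r fun h => hr (h4 h)⟩

/-- This separates the effect of a program from its bookkeeping: that a register or array survives
is usually settled by `decide` on the lists of assigned locations. -/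
theorem Exec.frame {c : Cmd} {s s' : Store} {t : ℕ} (h : Exec c s t s') : Frame c s s' := by
  induction h with
  | skip s => exact .refl _ s
  | setN s r e =>
    refine ⟨fun r' hr => ?_, fun _ _ => rfl, fun _ _ => rfl, fun _ _ => rfl⟩
    exact Function.update_of_ne (by simpa [Cmd.nregs] using hr) _ _
  | putN s a i e =>
    refine ⟨fun _ _ => rfl, fun a' ha => ?_, fun _ _ => rfl, fun _ _ => rfl⟩
    exact Function.update_of_ne (by simpa [Cmd.narrs] using ha) _ _
  | setR s r e =>
    refine ⟨fun _ _ => rfl, fun _ _ => rfl, fun r' hr => ?_, fun _ _ => rfl⟩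
    exact Function.update_of_ne (by simpa [Cmd.rregs] using hr) _ _
  | putR s a i e =>
    refine ⟨fun _ _ => rfl, fun _ _ => rfl, fun _ _ => rfl, fun a' ha => ?_⟩
    exact Function.update_of_ne (by simpa [Cmd.rarrs] using ha) _ _
  | seq _ _ ih ih' =>
    refine (ih.mono ?_ ?_ ?_ ?_).trans (ih'.mono ?_ ?_ ?_ ?_) <;>
      simp [Cmd.nregs, Cmd.narrs, Cmd.rregs, Cmd.rarrs]
  | ite_true _ _ ih => refine ih.mono ?_ ?_ ?_ ?_ <;>
      simp [Cmd.nregs, Cmd.narrs, Cmd.rregs, Cmd.rarrs]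
  | ite_false _ _ ih => refine ih.mono ?_ ?_ ?_ ?_ <;>
      simp [Cmd.nregs, Cmd.narrs, Cmd.rregs, Cmd.rarrs]
  | loop_stop _ => exact .refl _ _
  | loop_step _ _ _ ih ih' =>
    refine Frame.trans (c := .loop _ _) (ih.mono ?_ ?_ ?_ ?_) ih' <;> exact List.Subset.refl _

/-- Started in `s`, the program `c` halts after at most `T` steps in a state that satisfies `Q`. -/
def Runs (c : Cmd) (s : Store) (T : ℕ) (Q : Store → Prop) : Prop :=
  ∃ t s', Exec c s t s' ∧ t ≤ T ∧ Q s'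

theorem Runs.mono {c : Cmd} {s : Store} {T T' : ℕ} {Q Q' : Store → Prop} (h : Runs c s T Q)
    (hT : T ≤ T') (hQ : ∀ s', Frame c s s' → Q s' → Q' s') : Runs c s T' Q' := by
  obtain ⟨t, s', h1, h2, h3⟩ := h
  exact ⟨t, s', h1, h2.trans hT, hQ s' h1.frame h3⟩

/-- The frame of the first program is passed on to the second, so the intermediate assertion `Q`
need not repeat values that were not touched. -/
theorem Runs.seq {p q : Cmd} {s : Store} {T T' : ℕ} {Q Q' : Store → Prop} (hp : Runs p s T Q)
    (hq : ∀ s', Frame p s s' → Q s' → Runs q s' T' Q') : Runs (p ;; q) s (T + T') Q' := by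
  obtain ⟨t, s', h1, h2, h3⟩ := hp
  obtain ⟨t', s'', h1', h2', h3'⟩ := hq s' h1.frame h3
  exact ⟨t + t', s'', .seq h1 h1', by lia, h3'⟩

/-! ### Loop-free programs -/

/-- The effect of a program without loops. -/
noncomputable def Cmd.out : Cmd → Store → Store
  | .skip, s => s
  | .setN r e, s => { s with nreg := Function.update s.nreg r (e.eval s) }
  | .putN a i e, s => { s with
      narr := Function.update s.narr a (Function.update (s.narr a) (i.eval s) (e.eval s)) }
  | .setR r e, s => { s with rreg := Function.update s.rreg r (e.eval s) }
  | .putR a i e, s => { s with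
      rarr := Function.update s.rarr a (Function.update (s.rarr a) (i.eval s) (e.eval s)) }
  | .seq p q, s => q.out (p.out s)
  | .ite b p q, s => open Classical in if b.Holds s then p.out s else q.out s
  | .loop _ _, s => s

theorem Cmd.out_seq (p q : Cmd) (s : Store) : (p ;; q).out s = q.out (p.out s) := rfl

theorem Cmd.out_ite_pos {b : BExp} {s : Store} (h : b.Holds s) (p q : Cmd) :
    (Cmd.ite b p q).out s = p.out s := if_pos h

theorem Cmd.out_ite_neg {b : BExp} {s : Store} (h : ¬ b.Holds s) (p q : Cmd) :
    (Cmd.ite b p q).out s = q.out s := if_neg h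

/-- A bound for the number of steps of a program without loops. -/
def Cmd.time : Cmd → ℕ
  | .skip => 1
  | .setN _ e => e.size + 1
  | .putN _ i e => i.size + e.size + 1
  | .setR _ e => e.size + 1
  | .putR _ i e => i.size + e.size + 1
  | .seq p q => p.time + q.time
  | .ite b p q => b.size + (p.time + q.time)
  | .loop _ _ => 0

/-- The program has no loops. -/
def Cmd.straight : Cmd → Bool
  | .seq p q => p.straight && q.straight
  | .ite _ p q => p.straight && q.straight
  | .loop _ _ => false
  | _ => true

/-- Without loops the final store is computable by `simp`. The time bound adds both branches of a
conditional, so it does not depend on the store. -/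
theorem Cmd.exec_out (c : Cmd) (hc : c.straight = true) (s : Store) :
    ∃ t ≤ c.time, Exec c s t (c.out s) := by
  induction c generalizing s with
  | skip => exact ⟨_, le_rfl, .skip s⟩
  | setN r e => exact ⟨_, le_rfl, .setN s r e⟩
  | putN a i e => exact ⟨_, le_rfl, .putN s a i e⟩
  | setR r e => exact ⟨_, le_rfl, .setR s r e⟩
  | putR a i e => exact ⟨_, le_rfl, .putR s a i e⟩
  | seq p q ihp ihq =>
    simp only [Cmd.straight, Bool.and_eq_true] at hc
    obtain ⟨t, ht, h⟩ := ihp hc.1 s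
    obtain ⟨t', ht', h'⟩ := ihq hc.2 (p.out s)
    exact ⟨_, add_le_add ht ht', .seq h h'⟩
  | ite b p q ihp ihq =>
    simp only [Cmd.straight, Bool.and_eq_true] at hc
    by_cases hb : b.Holds s
    · obtain ⟨t, ht, h⟩ := ihp hc.1 s
      refine ⟨b.size + t, by simp only [Cmd.time]; lia, ?_⟩
      rw [Cmd.out, if_pos hb]
      exact .ite_true hb h
    · obtain ⟨t, ht, h⟩ := ihq hc.2 s
      refine ⟨b.size + t, by simp only [Cmd.time]; lia, ?_⟩
      rw [Cmd.out, if_neg hb]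
      exact .ite_false hb h
  | loop b p => simp [Cmd.straight] at hc

theorem runs_straight {c : Cmd} (hc : c.straight = true) {s : Store} {Q : Store → Prop}
    (h : Q (c.out s)) : Runs c s c.time Q := by
  obtain ⟨t, ht, he⟩ := c.exec_out hc s
  exact ⟨t, _, he, ht, h⟩

theorem runs_ite {b : BExp} {p q : Cmd} {s : Store} {T : ℕ} {Q : Store → Prop}
    (hp : b.Holds s → Runs p s T Q) (hq : ¬ b.Holds s → Runs q s T Q) :
    Runs (.ite b p q) s (b.size + T) Q := by
  by_cases hb : b.Holds s
  · obtain ⟨t, s', h1, h2, h3⟩ := hp hb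
    exact ⟨_, s', .ite_true hb h1, by lia, h3⟩
  · obtain ⟨t, s', h1, h2, h3⟩ := hq hb
    exact ⟨_, s', .ite_false hb h1, by lia, h3⟩

theorem Runs.le {c : Cmd} {s : Store} {T T' : ℕ} {Q : Store → Prop} (h : Runs c s T Q)
    (hT : T ≤ T') : Runs c s T' Q := h.mono hT fun _ _ h => h

/-! ### Counted loops -/

/-- `for r := 0 to b - 1 do p`. -/
def forTo (r : ℕ) (b : NExp) (p : Cmd) : Cmd :=
  .setN r (.const 0) ;;
    .loop (.not (.nle b (.var r))) (p ;; .setN r (.add (.var r) (.const 1)))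

/-- The store with a changed natural-number register. -/
def Store.setN (s : Store) (r v : ℕ) : Store := { s with nreg := Function.update s.nreg r v }

@[simp] theorem Store.setN_narr (s : Store) (r v : ℕ) : (s.setN r v).narr = s.narr := rfl
@[simp] theorem Store.setN_rreg (s : Store) (r v : ℕ) : (s.setN r v).rreg = s.rreg := rfl
@[simp] theorem Store.setN_rarr (s : Store) (r v : ℕ) : (s.setN r v).rarr = s.rarr := rfl
@[simp] theorem Store.setN_nreg (s : Store) (r v r' : ℕ) :
    (s.setN r v).nreg r' = if r' = r then v else s.nreg r' := Function.update_apply _ _ _ _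

theorem frame_forTo_setN (r : ℕ) (b : NExp) (p : Cmd) (s : Store) (v : ℕ) :
    Frame (forTo r b p) s (s.setN r v) := by
  refine ⟨fun r' hr => ?_, fun _ _ => rfl, fun _ _ => rfl, fun _ _ => rfl⟩
  rw [Store.setN_nreg, if_neg]
  rintro rfl
  simp [forTo, Cmd.nregs] at hr

theorem Frame.forTo {r : ℕ} {b : NExp} {p : Cmd} {s s' : Store} (h : Frame p s s') :
    Frame (forTo r b p) s s' := by
  apply h.mono <;>
    simp only [RealRAM.forTo, Cmd.nregs, Cmd.narrs, Cmd.rregs, Cmd.rarrs, List.append_nil,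
      List.nil_append, List.Subset.refl]
  exact fun x hx => by simp [hx]

/-- Number of steps of a loop with `N` rounds. -/
def forTime (bs N Tb : ℕ) : ℕ := N * (bs + 7 + Tb) + (bs + 5)

theorem forTime_mono {bs N N' Tb Tb' : ℕ} (hN : N ≤ N') (hT : Tb ≤ Tb') :
    forTime bs N Tb ≤ forTime bs N' Tb' := by
  unfold forTime
  gcongr

/-- The bound is evaluated anew in every round, so it must be stable under the frame of the loop. A
round costs `b.size + 3` for the test and `4` for the increment besides the body; the initialization
costs `2` and the last, failing test `b.size + 3`. -/
theorem runs_forTo {r : ℕ} {b : NExp} {p : Cmd} {s : Store} {N Tb : ℕ} {Q : Store → Prop}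
    (Inv : ℕ → Store → Prop) (hr : r ∉ p.nregs)
    (hb : ∀ s', Frame (forTo r b p) s s' → b.eval s' = N)
    (h0 : Inv 0 (s.setN r 0))
    (hstep : ∀ i < N, ∀ s', Frame (forTo r b p) s s' → s'.nreg r = i → Inv i s' →
      Runs p s' Tb fun s'' => Inv (i + 1) (s''.setN r (i + 1)))
    (hend : ∀ s', Frame (forTo r b p) s s' → Inv N s' → Q s') :
    Runs (forTo r b p) s (forTime b.size N Tb) Q := by
  have key : ∀ d i s', i + d = N → Frame (forTo r b p) s s' → s'.nreg r = i → Inv i s' →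
      ∃ t s'', Exec (.loop (.not (.nle b (.var r))) (p ;; .setN r (.add (.var r) (.const 1))))
        s' t s'' ∧ t ≤ d * (b.size + 7 + Tb) + (b.size + 3) ∧ Q s'' := by
    intro d
    induction d with
    | zero =>
      intro i s' hi hF hri hI
      refine ⟨_, s', Exec.loop_stop ?_, ?_, hend s' hF ?_⟩
      · simp only [BExp.Holds, hb s' hF, NExp.eval, hri, not_not]; lia
      · simp [BExp.size, NExp.size]
      · have : i = N := by lia
        exact this ▸ hI
    | succ d ih =>
      intro i s' hi hF hri hI
      obtain ⟨t, s₁, h1, h2, h3⟩ := hstep i (by lia) s' hF hri hI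
      have hr1 : s₁.nreg r = i := (h1.frame.nreg r hr).trans hri
      have hset : Exec (.setN r (.add (.var r) (.const 1))) s₁ 4 (s₁.setN r (i + 1)) := by
        have := Exec.setN s₁ r (.add (.var r) (.const 1))
        simpa [NExp.eval, NExp.size, hr1, Store.setN] using this
      have hF1 : Frame (forTo r b p) s s₁ := hF.trans h1.frame.forTo
      obtain ⟨t', s₂, h1', h2', h3'⟩ := ih (i + 1) (s₁.setN r (i + 1)) (by lia)
        (hF1.trans (frame_forTo_setN _ _ _ _ _)) (by simp) h3
      refine ⟨_, s₂, .loop_step ?_ (.seq h1 hset) h1', ?_, h3'⟩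
      · simp only [BExp.Holds, hb s' hF, NExp.eval, hri]; lia
      · simp only [BExp.size, NExp.size, add_mul, one_mul]; lia
  obtain ⟨t, s', h1, h2, h3⟩ := key N 0 (s.setN r 0) (by lia) (frame_forTo_setN _ _ _ _ _)
    (by simp) h0
  refine ⟨_, s', .seq (.setN s r (.const 0)) h1, ?_, h3⟩
  simp only [NExp.size, forTime]
  lia

end RealRAM

namespace Delivery

open RealRAM

/-! ## The program: construction of the state graph -/

/-- The memory contains the list `L` of edges. -/
def HasEdges (s : Store) (L : List Edge) : Prop :=
  s.nreg 4 = L.length ∧ ∀ x e, L[x]? = some e →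
    s.narr 8 x = e.src ∧ s.narr 9 x = e.dst ∧ s.narr 10 x = e.c0 ∧ s.narr 11 x = e.c1 ∧
    s.narr 12 x = e.c2 ∧ s.narr 13 x = e.c3 ∧ s.rarr 3 x = e.len

theorem HasEdges.congr {s s' : Store} {L : List Edge} (h : HasEdges s L)
    (h4 : s'.nreg 4 = s.nreg 4) (h8 : ∀ a, 8 ≤ a → a ≤ 13 → s'.narr a = s.narr a)
    (h3 : s'.rarr 3 = s.rarr 3) : HasEdges s' L := by
  refine ⟨h4.trans h.1, fun x e he => ?_⟩
  rw [h8 8, h8 9, h8 10, h8 11, h8 12, h8 13, h3]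
  · exact h.2 x e he
  all_goals norm_num

theorem HasEdges.setN {s : Store} {L : List Edge} (h : HasEdges s L) {r : ℕ} (hr : r ≠ 4)
    (v : ℕ) : HasEdges (s.setN r v) L :=
  h.congr (by simp [hr.symm]) (fun _ _ _ => rfl) rfl

/-- Append the edge described by the given expressions to the list of edges. -/
def emitEdge (a b c₀ c₁ c₂ c₃ : NExp) (l : RExp) : Cmd :=
  .setN 23 a ;; .setN 24 b ;; .setN 25 c₀ ;; .setN 26 c₁ ;; .setN 27 c₂ ;; .setN 28 c₃ ;;
  .putR 3 (.var 4) l ;;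
  .putN 8 (.var 4) (.var 23) ;; .putN 9 (.var 4) (.var 24) ;; .putN 10 (.var 4) (.var 25) ;;
  .putN 11 (.var 4) (.var 26) ;; .putN 12 (.var 4) (.var 27) ;; .putN 13 (.var 4) (.var 28) ;;
  .setN 4 (.add (.var 4) (.const 1))

/-- The six natural-number fields are first buffered in registers `23` to `28`, and the length is
evaluated before any natural-number array is written. Therefore the expressions only have to be
insensitive to these scratch registers. -/
theorem runs_emitEdge {s : Store} {L : List Edge} (h : HasEdges s L) (e : Edge)
    {a b c₀ c₁ c₂ c₃ : NExp} {l : RExp}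
    (he : ∀ s' : Store, s'.narr = s.narr → s'.rarr = s.rarr → s'.rreg = s.rreg →
      (∀ r, r < 23 ∨ 28 < r → s'.nreg r = s.nreg r) →
      a.eval s' = e.src ∧ b.eval s' = e.dst ∧ c₀.eval s' = e.c0 ∧ c₁.eval s' = e.c1 ∧
      c₂.eval s' = e.c2 ∧ c₃.eval s' = e.c3 ∧ l.eval s' = e.len) :
    Runs (emitEdge a b c₀ c₁ c₂ c₃ l) s (emitEdge a b c₀ c₁ c₂ c₃ l).time
      fun s' => HasEdges s' (L ++ [e]) := by
  refine runs_straight rfl ?_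
  set s1 : Store := s.setN 23 (a.eval s) with hs1
  set s2 : Store := s1.setN 24 (b.eval s1) with hs2
  set s3 : Store := s2.setN 25 (c₀.eval s2) with hs3
  set s4 : Store := s3.setN 26 (c₁.eval s3) with hs4
  set s5 : Store := s4.setN 27 (c₂.eval s4) with hs5
  set s6 : Store := s5.setN 28 (c₃.eval s5) with hs6
  have e0 := (he s rfl rfl rfl fun _ _ => rfl).1
  have e1 := (he s1 rfl rfl rfl fun r hr => by
    simp only [hs1, Store.setN_nreg]; rw [if_neg (by lia)]).2.1
  have e2 := (he s2 rfl rfl rfl fun r hr => by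
    simp only [hs1, hs2, Store.setN_nreg]; rw [if_neg (by lia), if_neg (by lia)]).2.2.1
  have e3 := (he s3 rfl rfl rfl fun r hr => by
    simp only [hs1, hs2, hs3, Store.setN_nreg]
    rw [if_neg (by lia), if_neg (by lia), if_neg (by lia)]).2.2.2.1
  have e4 := (he s4 rfl rfl rfl fun r hr => by
    simp only [hs1, hs2, hs3, hs4, Store.setN_nreg]
    rw [if_neg (by lia), if_neg (by lia), if_neg (by lia), if_neg (by lia)]).2.2.2.2.1
  have e5 := (he s5 rfl rfl rfl fun r hr => by
    simp only [hs1, hs2, hs3, hs4, hs5, Store.setN_nreg]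
    rw [if_neg (by lia), if_neg (by lia), if_neg (by lia), if_neg (by lia),
      if_neg (by lia)]).2.2.2.2.2.1
  have e6 := (he s6 rfl rfl rfl fun r hr => by
    simp only [hs1, hs2, hs3, hs4, hs5, hs6, Store.setN_nreg]
    rw [if_neg (by lia), if_neg (by lia), if_neg (by lia), if_neg (by lia), if_neg (by lia),
      if_neg (by lia)]).2.2.2.2.2.2
  have h4 : s6.nreg 4 = L.length := by simp [hs6, hs5, hs4, hs3, hs2, hs1, h.1]
  have h23 : s6.nreg 23 = e.src := by simp [hs6, hs5, hs4, hs3, hs2, hs1, e0]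
  have h24 : s6.nreg 24 = e.dst := by simp [hs6, hs5, hs4, hs3, hs2, e1]
  have h25 : s6.nreg 25 = e.c0 := by simp [hs6, hs5, hs4, hs3, e2]
  have h26 : s6.nreg 26 = e.c1 := by simp [hs6, hs5, hs4, e3]
  have h27 : s6.nreg 27 = e.c2 := by simp [hs6, hs5, e4]
  have h28 : s6.nreg 28 = e.c3 := by simp [hs6, e5]
  have hn : s6.narr = s.narr := rfl
  have hr : s6.rarr = s.rarr := rfl
  have hout : ∀ p : Cmd, (Cmd.setN 23 a ;; .setN 24 b ;; .setN 25 c₀ ;; .setN 26 c₁ ;;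
      .setN 27 c₂ ;; .setN 28 c₃ ;; p).out s = p.out s6 := fun p => rfl
  rw [emitEdge, hout]
  clear_value s6
  refine ⟨?_, fun x e' he' => ?_⟩
  · simp [Cmd.out, NExp.eval, h4]
  · have hlt : x < L.length + 1 := by
      have := (List.getElem?_eq_some_iff.1 he').1
      simpa using this
    by_cases hx : x = L.length
    · subst hx
      simp only [List.getElem?_concat_length, Option.some.injEq] at he'
      subst he'
      simp [Cmd.out, NExp.eval, h4, h23, h24, h25, h26, h27, h28, e6]
    · have hx' : x < L.length := by lia
      rw [List.getElem?_append_left hx'] at he'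
      have := h.2 x e' he'
      simp [Cmd.out, NExp.eval, h4, hx, hn, hr, this]

/-- Emit the edges for one node `u` (register 10), agent (9) and load. -/
def walkRowProg : Cmd :=
  forTo 11 (.var 0)
    (.ite (.nle (.const 1) (.get 0 (.var 6)))
      (emitEdge (.add (.var 5) (.var 10)) (.add (.var 5) (.var 11)) (.const 0) (.var 9) (.var 10)
        (.var 11) (.get 0 (.var 6))) .skip ;;
    .setN 6 (.add (.var 6) (.const 1)))

/-- The edges emitted by `walkRowProg`. -/
def walkRow (n : ℕ) (adj : ℕ → ℕ) (len : ℕ → ℝ) (q i u : ℕ) (v : ℕ) : List Edge :=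
  if 1 ≤ adj (u * n + v) then [⟨q + u, q + v, 0, i, u, v, len (u * n + v)⟩] else []

/-- Register `6` is a running matrix index equal to `u * n + v`; it is incremented once per entry
and so replaces the missing multiplication. -/
theorem runs_walkRowProg {s : Store} {L : List Edge} (h : HasEdges s L) {n q i u : ℕ}
    (h0 : s.nreg 0 = n) (h5 : s.nreg 5 = q) (h6 : s.nreg 6 = u * n) (h9 : s.nreg 9 = i)
    (h10 : s.nreg 10 = u) :
    Runs walkRowProg s (forTime 1 n 100) fun s' =>
      HasEdges s' (L ++ (List.range n).flatMap (walkRow n (s.narr 0) (s.rarr 0) q i u)) ∧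
      s'.nreg 6 = (u + 1) * n := by
  refine runs_forTo (b := .var 0) (fun v s' => HasEdges s' (L ++ (List.range v).flatMap
    (walkRow n (s.narr 0) (s.rarr 0) q i u)) ∧ s'.nreg 6 = u * n + v) (by decide) ?_ ?_ ?_ ?_
  · intro s' hF
    exact (hF.nreg 0 (by decide)).trans h0
  · exact ⟨by simpa using h.setN (by decide) 0, by simpa using h6⟩
  · rintro v hv s' hF h11 ⟨hE, h6'⟩
    have f0 := hF.narr 0 (by decide)
    have f1 := hF.rarr 0 (by decide)
    have f5 := (hF.nreg 5 (by decide)).trans h5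
    have f9 := (hF.nreg 9 (by decide)).trans h9
    have f10 := (hF.nreg 10 (by decide)).trans h10
    refine Runs.seq (T := 96) (T' := 4) (Q := fun s' => HasEdges s' (L ++
      (List.range (v + 1)).flatMap (walkRow n (s.narr 0) (s.rarr 0) q i u))) ?_ ?_
    · rw [List.range_succ, List.flatMap_append, ← List.append_assoc, List.flatMap_singleton]
      refine (runs_ite (T := 90) (fun hb => ?_) fun hb => ?_).le (by decide)
      · have hb' : 1 ≤ s.narr 0 (u * n + v) := by
          simpa [BExp.Holds, NExp.eval, f0, h6'] using hb
        rw [walkRow, if_pos hb']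
        refine (runs_emitEdge hE _ fun s₁ e1 e2 e3 e4 => ?_).le (by decide)
        simp [NExp.eval, RExp.eval, e2, e4, f1, f5, f9, f10, h6', h11]
      · have hb' : ¬ 1 ≤ s.narr 0 (u * n + v) := by
          simpa [BExp.Holds, NExp.eval, f0, h6'] using hb
        rw [walkRow, if_neg hb']
        exact (runs_straight (c := .skip) rfl (by simpa [Cmd.out] using hE)).le (by decide)
    · intro s₁ hF₁ hE₁
      refine runs_straight rfl ?_
      have := (hF₁.nreg 6 (by decide)).trans h6'
      refine ⟨hE₁.congr ?_ (fun _ _ _ => rfl) rfl, ?_⟩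
      · simp [Cmd.out]
      · simp [Cmd.out, NExp.eval, this, add_assoc]
  · rintro s' hF ⟨hE, h6'⟩
    exact ⟨hE, by rw [h6']; ring⟩

/-- Emit the edges for one agent (register 9) and load. -/
def walkAgentProg : Cmd :=
  .setN 6 (.const 0) ;; forTo 10 (.var 0) walkRowProg ;; .setN 5 (.add (.var 5) (.var 0))

theorem runs_walkAgentProg {s : Store} {L : List Edge} (h : HasEdges s L) {n q i : ℕ}
    (h0 : s.nreg 0 = n) (h5 : s.nreg 5 = q) (h9 : s.nreg 9 = i) :
    Runs walkAgentProg s (forTime 1 n (forTime 1 n 100) + 6) fun s' =>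
      HasEdges s' (L ++ (List.range n).flatMap fun u =>
        (List.range n).flatMap (walkRow n (s.narr 0) (s.rarr 0) q i u)) ∧
      s'.nreg 5 = q + n := by
  refine (Runs.seq (T := 2) (Q := fun s' => HasEdges s' L ∧ s'.nreg 6 = 0)
    (runs_straight rfl ⟨h.congr (by simp [Cmd.out]) (fun _ _ _ => rfl) rfl,
      by simp [Cmd.out, NExp.eval]⟩) fun s₁ hF₁ ⟨hE₁, h6⟩ =>
    (Runs.seq (T := forTime 1 n (forTime 1 n 100)) (T' := 4) (Q := fun s' =>
      HasEdges s' (L ++ (List.range n).flatMap fun u =>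
        (List.range n).flatMap (walkRow n (s.narr 0) (s.rarr 0) q i u))) ?_ ?_)).le (by lia)
  · refine runs_forTo (b := .var 0) (fun u s' => HasEdges s' (L ++ (List.range u).flatMap fun u =>
        (List.range n).flatMap (walkRow n (s.narr 0) (s.rarr 0) q i u)) ∧ s'.nreg 6 = u * n)
        (by decide) ?_ ?_ ?_ ?_
    · intro s' hF
      exact (hF.nreg 0 (by decide)).trans ((hF₁.nreg 0 (by decide)).trans h0)
    · exact ⟨by simpa using hE₁.setN (by decide) 0, by simpa using h6⟩
    · rintro u hu s' hF h10 ⟨hE, h6'⟩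
      refine (runs_walkRowProg hE
        ((hF.nreg 0 (by decide)).trans ((hF₁.nreg 0 (by decide)).trans h0))
        ((hF.nreg 5 (by decide)).trans ((hF₁.nreg 5 (by decide)).trans h5)) h6'
        ((hF.nreg 9 (by decide)).trans ((hF₁.nreg 9 (by decide)).trans h9)) h10).mono le_rfl ?_
      rintro s₂ hF₂ ⟨hE₂, h6₂⟩
      rw [hF.narr 0 (by decide), hF.rarr 0 (by decide), hF₁.narr 0 (by decide),
        hF₁.rarr 0 (by decide)] at hE₂
      refine ⟨HasEdges.setN ?_ (by decide) _, by simpa using h6₂⟩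
      rw [List.range_succ, List.flatMap_append, ← List.append_assoc, List.flatMap_singleton]
      exact hE₂
    · exact fun s' hF h => h.1
  · intro s₂ hF₂ hE₂
    refine runs_straight rfl ⟨hE₂.congr ?_ (fun _ _ _ => rfl) rfl, ?_⟩
    · simp [Cmd.out]
    · have g0 := (hF₂.nreg 0 (by decide)).trans ((hF₁.nreg 0 (by decide)).trans h0)
      have g5 := (hF₂.nreg 5 (by decide)).trans ((hF₁.nreg 5 (by decide)).trans h5)
      simp [Cmd.out, NExp.eval, g0, g5]

/-- Emit all edges of `walkEdges`. -/
def walkProg : Cmd :=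
  forTo 8 (.add (.var 1) (.const 1)) (forTo 9 (.var 2) walkAgentProg)

/-- Bound for the number of steps of `walkProg`. -/
def walkTime (n m k : ℕ) : ℕ :=
  forTime 3 (m + 1) (forTime 1 k (forTime 1 n (forTime 1 n 100) + 6))

/-- Register `5` is the base number of the current load and agent. Its final value, the number of
states per delivered set, is the stride for all later shifts. -/
theorem runs_walkProg {s : Store} (h : HasEdges s []) {n m k : ℕ}
    (h0 : s.nreg 0 = n) (h1 : s.nreg 1 = m) (h2 : s.nreg 2 = k) (h5 : s.nreg 5 = 0) :
    Runs walkProg s (walkTime n m k) fun s' =>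
      HasEdges s' (walkEdges n m k (s.narr 0) (s.rarr 0)) ∧ s'.nreg 5 = (m + 1) * (k * n) := by
  set f : ℕ → ℕ → List Edge := fun c i => (List.range n).flatMap fun u =>
    (List.range n).flatMap (walkRow n (s.narr 0) (s.rarr 0) ((c * k + i) * n) i u) with hf
  refine runs_forTo (b := .add (.var 1) (.const 1)) (fun c s' => HasEdges s'
    ((List.range c).flatMap fun c => (List.range k).flatMap (f c)) ∧ s'.nreg 5 = c * (k * n))
    (by decide) ?_ ?_ ?_ ?_
  · intro s' hF
    simp [NExp.eval, hF.nreg 1 (by decide), h1]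
  · exact ⟨by simpa using h.setN (by decide) 0, by simpa using h5⟩
  · rintro c hc s₁ hF₁ h8 ⟨hE₁, h5₁⟩
    refine runs_forTo (b := .var 2) (fun i s' => HasEdges s' (((List.range c).flatMap fun c =>
      (List.range k).flatMap (f c)) ++ (List.range i).flatMap (f c)) ∧
      s'.nreg 5 = (c * k + i) * n) (by decide) ?_ ?_ ?_ ?_
    · intro s' hF
      exact (hF.nreg 2 (by decide)).trans ((hF₁.nreg 2 (by decide)).trans h2)
    · exact ⟨by simpa using hE₁.setN (by decide) 0, by simp [h5₁]; ring⟩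
    · rintro i hi s' hF h9 ⟨hE, h5'⟩
      refine (runs_walkAgentProg hE
        ((hF.nreg 0 (by decide)).trans ((hF₁.nreg 0 (by decide)).trans h0)) h5' h9).mono le_rfl ?_
      rintro s₂ hF₂ ⟨hE₂, h5₂⟩
      rw [hF.narr 0 (by decide), hF.rarr 0 (by decide), hF₁.narr 0 (by decide),
        hF₁.rarr 0 (by decide)] at hE₂
      refine ⟨HasEdges.setN ?_ (by decide) _, by simp [h5₂]; ring⟩
      rw [List.range_succ, List.flatMap_append, ← List.append_assoc, List.flatMap_singleton]
      exact hE₂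
    · rintro s' hF ⟨hE, h5'⟩
      refine ⟨HasEdges.setN ?_ (by decide) _, by simp [h5']; ring⟩
      rw [List.range_succ, List.flatMap_append, List.flatMap_singleton]
      exact hE
  · exact fun s' hF h => h

/-- Emit the edges without action, and compute the number of the last state. -/
def switchProg : Cmd :=
  .setN 5 (.const 0) ;;
  forTo 9 (.sub (.var 2) (.const 1))
    (emitEdge (.add (.var 5) (.get 3 (.var 9)))
      (.add (.add (.var 5) (.var 0)) (.get 3 (.add (.var 9) (.const 1))))
      (.const 3) (.const 0) (.const 0) (.const 0) (.const 0) ;;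
    .setN 5 (.add (.var 5) (.var 0))) ;;
  .setN 30 (.add (.var 5) (.get 3 (.sub (.var 2) (.const 1)))) ;;
  emitEdge (.var 30) (.var 30) (.const 3) (.const 0) (.const 0) (.const 0) (.const 0)

theorem runs_switchProg {s : Store} {L : List Edge} (h : HasEdges s L) {n k : ℕ}
    (h0 : s.nreg 0 = n) (h2 : s.nreg 2 = k) :
    Runs switchProg s (forTime 3 k 100 + 100) fun s' =>
      HasEdges s' (L ++ switchEdges n k (s.narr 3) ++ [stayEdge n k (s.narr 3)]) ∧
      s'.nreg 30 = (k - 1) * n + s.narr 3 (k - 1) := by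
  refine (Runs.seq (T := 2) (Q := fun s' => HasEdges s' L ∧ s'.nreg 5 = 0)
    (runs_straight rfl ⟨h.congr (by simp [Cmd.out]) (fun _ _ _ => rfl) rfl,
      by simp [Cmd.out, NExp.eval]⟩) fun s₁ hF₁ ⟨hE₁, h5₁⟩ =>
    (Runs.seq (T := forTime 3 k 100) (T' := 90) (Q := fun s' =>
      HasEdges s' (L ++ switchEdges n k (s.narr 3)) ∧ s'.nreg 5 = (k - 1) * n) ?_ ?_)).le (by lia)
  · refine (runs_forTo (b := .sub (.var 2) (.const 1)) (N := k - 1) (Tb := 100)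
      (fun i s' => HasEdges s' (L ++ (List.range i).flatMap fun i =>
        [⟨i * n + s.narr 3 i, i * n + n + s.narr 3 (i + 1), 3, 0, 0, 0, 0⟩]) ∧
        s'.nreg 5 = i * n)
        (by decide) ?_ ?_ ?_ ?_).le (forTime_mono (by lia) le_rfl)
    · intro s' hF
      simp [NExp.eval, hF.nreg 2 (by decide), hF₁.nreg 2 (by decide), h2]
    · exact ⟨by simpa using hE₁.setN (by decide) 0, by simpa using h5₁⟩
    · rintro i hi s' hF h9 ⟨hE, h5'⟩
      have g0 := (hF.nreg 0 (by decide)).trans ((hF₁.nreg 0 (by decide)).trans h0)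
      have g3 := (hF.narr 3 (by decide)).trans (hF₁.narr 3 (by decide))
      refine (Runs.seq (T' := 4) ((runs_emitEdge hE ⟨i * n + s.narr 3 i,
        i * n + n + s.narr 3 (i + 1), 3, 0, 0, 0, 0⟩ fun s₂ e1 e2 e3 e4 => ?_))
        fun s₂ hF₂ hE₂ => ?_).le (by decide)
      · simp [NExp.eval, RExp.eval, e1, e4, g0, g3, h5', h9]
      · refine runs_straight rfl ⟨?_, ?_⟩
        · rw [List.range_succ, List.flatMap_append, List.flatMap_singleton, ← List.append_assoc]
          exact hE₂.congr (by simp [Cmd.out]) (fun _ _ _ => rfl) rfl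
        · have g0' := (hF₂.nreg 0 (by decide)).trans g0
          have g5' := (hF₂.nreg 5 (by decide)).trans h5'
          simp [Cmd.out, NExp.eval, g0', g5']
          ring
    · exact fun s' hF h => h
  · rintro s₂ hF₂ ⟨hE₂, h5₂⟩
    have g2 := (hF₂.nreg 2 (by decide)).trans ((hF₁.nreg 2 (by decide)).trans h2)
    have g3 := (hF₂.narr 3 (by decide)).trans (hF₁.narr 3 (by decide))
    refine (Runs.seq (T := 8) (Q := fun s' => HasEdges s' (L ++ switchEdges n k (s.narr 3)) ∧
      s'.nreg 30 = (k - 1) * n + s.narr 3 (k - 1))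
      ((runs_straight rfl ⟨hE₂.congr (by simp [Cmd.out]) (fun _ _ _ => rfl) rfl,
        by simp [Cmd.out, NExp.eval, g2, g3, h5₂]⟩).le (by decide)) fun s₃ hF₃ ⟨hE₃, h30₃⟩ =>
      (runs_emitEdge hE₃ (stayEdge n k (s.narr 3)) fun s₄ e1 e2 e3 e4 => ?_).mono le_rfl
        fun s₄ hF₄ hE₄ => ⟨hE₄, (hF₄.nreg 30 (by decide)).trans h30₃⟩).le (by decide)
    simp [NExp.eval, RExp.eval, e4, h30₃, stayEdge]

/-- Append shifted copies of all edges. -/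
def copyProg : Cmd :=
  .setN 16 (.var 4) ;;
  forTo 20 (.var 16)
    (emitEdge (.add (.get 8 (.var 20)) (.var 13)) (.add (.get 9 (.var 20)) (.var 13))
      (.get 10 (.var 20)) (.get 11 (.var 20)) (.get 12 (.var 20)) (.get 13 (.var 20))
      (.get 3 (.var 20)))

/-- The old length is saved in register `16`, because register `4` grows while the copies are
appended. -/
theorem runs_copyProg {s : Store} {L : List Edge} (h : HasEdges s L) {N : ℕ}
    (h13 : s.nreg 13 = N) :
    Runs copyProg s (forTime 1 L.length 100 + 2) fun s' =>
      HasEdges s' (L ++ L.map (Edge.shift N)) := by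
  refine (Runs.seq (T := 2) (Q := fun s' => HasEdges s' L ∧ s'.nreg 16 = L.length)
    (runs_straight rfl ⟨h.congr (by simp [Cmd.out]) (fun _ _ _ => rfl) rfl,
      by simp [Cmd.out, NExp.eval, h.1]⟩) fun s₁ hF₁ ⟨hE₁, h16⟩ =>
    runs_forTo (b := .var 16) (N := L.length) (Tb := 100)
      (fun i s' => HasEdges s' (L ++ (L.take i).map (Edge.shift N)))
      (by decide) ?_ ?_ ?_ ?_).le (by change _ + forTime 1 _ _ ≤ _; lia)
  · intro s' hF
    exact (hF.nreg 16 (by decide)).trans h16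
  · simpa using hE₁.setN (by decide) 0
  · intro i hi s' hF h20 hE
    have g13 := (hF.nreg 13 (by decide)).trans ((hF₁.nreg 13 (by decide)).trans h13)
    have hLi : L[i]? = some L[i] := List.getElem?_eq_getElem hi
    have hi' := hE.2 i L[i] (by rw [List.getElem?_append_left hi, hLi])
    refine (runs_emitEdge hE (Edge.shift N L[i]) fun s₂ e1 e2 e3 e4 => ?_).mono (by decide)
      fun s₂ hF₂ hE₂ => ?_
    · simp [NExp.eval, RExp.eval, e1, e2, e4, g13, h20, hi', Edge.shift]
    · rw [List.take_add_one, hLi, Option.toList_some, List.map_append, ← List.append_assoc]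
      exact hE₂.setN (by decide) _
  · intro s' hF hE
    simpa using hE

/-- Emit pickup and drop of package `j` (register 19) for all agents and all sets of delivered
packages. -/
def deliveryProg : Cmd :=
  .setN 18 (.const 0) ;;
  forTo 21 (.var 17)
    (.setN 5 (.var 18) ;;
    forTo 9 (.var 2)
      (emitEdge (.add (.var 5) (.get 1 (.var 19)))
        (.add (.add (.var 5) (.var 14)) (.get 1 (.var 19)))
        (.const 1) (.var 9) (.var 19) (.const 0) (.const 0) ;;
      emitEdge (.add (.add (.var 5) (.var 14)) (.get 2 (.var 19)))
        (.add (.add (.var 5) (.var 13)) (.get 2 (.var 19)))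
        (.const 2) (.var 9) (.var 19) (.const 0) (.const 0) ;;
      .setN 5 (.add (.var 5) (.var 0))) ;;
    .setN 18 (.add (.var 18) (.var 29)))

theorem runs_deliveryProg {s : Store} {L : List Edge} (h : HasEdges s L) {n m k j : ℕ}
    (h0 : s.nreg 0 = n) (h2 : s.nreg 2 = k) (h19 : s.nreg 19 = j) (h17 : s.nreg 17 = 2 ^ j)
    (h14 : s.nreg 14 = (j + 1) * (k * n)) (h13 : s.nreg 13 = 2 ^ j * ((m + 1) * (k * n)))
    (h29 : s.nreg 29 = (m + 1) * (k * n)) :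
    Runs deliveryProg s (forTime 1 (2 ^ j) (forTime 1 k 150 + 6) + 2) fun s' =>
      HasEdges s' (L ++ deliveryEdges n m k (s.narr 1) (s.narr 2) j) := by
  set f : ℕ → ℕ → List Edge := fun S i =>
    [⟨S * ((m + 1) * (k * n)) + i * n + s.narr 1 j,
      S * ((m + 1) * (k * n)) + i * n + (j + 1) * (k * n) + s.narr 1 j, 1, i, j, 0, 0⟩,
     ⟨S * ((m + 1) * (k * n)) + i * n + (j + 1) * (k * n) + s.narr 2 j,
      S * ((m + 1) * (k * n)) + i * n + 2 ^ j * ((m + 1) * (k * n)) + s.narr 2 j, 2, i, j, 0, 0⟩]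
    with hf
  refine (Runs.seq (T := 2) (Q := fun s' => HasEdges s' L ∧ s'.nreg 18 = 0)
    (runs_straight rfl ⟨h.congr (by simp [Cmd.out]) (fun _ _ _ => rfl) rfl,
      by simp [Cmd.out, NExp.eval]⟩) fun s₁ hF₁ ⟨hE₁, h18⟩ =>
    runs_forTo (b := .var 17) (N := 2 ^ j) (Tb := forTime 1 k 150 + 6)
      (fun S s' => HasEdges s' (L ++ (List.range S).flatMap fun S => (List.range k).flatMap (f S)) ∧
        s'.nreg 18 = S * ((m + 1) * (k * n)))
      (by decide) ?_ ?_ ?_ ?_).le (by change _ + forTime 1 _ _ ≤ _; lia)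
  · intro s' hF
    exact (hF.nreg 17 (by decide)).trans ((hF₁.nreg 17 (by decide)).trans h17)
  · exact ⟨by simpa using hE₁.setN (by decide) 0, by simpa using h18⟩
  · rintro S hS s₂ hF₂ h21 ⟨hE₂, h18₂⟩
    refine (Runs.seq (T := 2) (Q := fun s' => HasEdges s' (L ++ (List.range S).flatMap fun S =>
      (List.range k).flatMap (f S)) ∧ s'.nreg 5 = S * ((m + 1) * (k * n)))
      (runs_straight rfl ⟨hE₂.congr (by simp [Cmd.out]) (fun _ _ _ => rfl) rfl,
      by simp [Cmd.out, NExp.eval, h18₂]⟩) fun s₃ hF₃ ⟨hE₃, h5₃⟩ =>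
      (Runs.seq (T := forTime 1 k 150) (T' := 4) (Q := fun s' => HasEdges s' (L ++
        (List.range (S + 1)).flatMap fun S => (List.range k).flatMap (f S))) ?_ ?_)).le (by lia)
    · have fr : ∀ r, r ∉ deliveryProg.nregs → s₃.nreg r = s.nreg r := fun r hr =>
        (hF₃.nreg r fun h => hr (by
          revert h; simp +contextual [deliveryProg, Cmd.nregs, forTo])).trans
          ((hF₂.nreg r fun h => hr (by
            revert h; simp +contextual [deliveryProg, Cmd.nregs, forTo])).trans
            (hF₁.nreg r fun h => hr (by
              revert h; simp +contextual [deliveryProg, Cmd.nregs, forTo])))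
      have fa1 : s₃.narr 1 = s.narr 1 := (hF₃.narr 1 (by decide)).trans
        ((hF₂.narr 1 (by decide)).trans (hF₁.narr 1 (by decide)))
      have fa2 : s₃.narr 2 = s.narr 2 := (hF₃.narr 2 (by decide)).trans
        ((hF₂.narr 2 (by decide)).trans (hF₁.narr 2 (by decide)))
      refine runs_forTo (b := .var 2) (N := k) (Tb := 150) (fun i s' => HasEdges s'
        ((L ++ (List.range S).flatMap fun S => (List.range k).flatMap (f S)) ++
          (List.range i).flatMap (f S)) ∧
        s'.nreg 5 = S * ((m + 1) * (k * n)) + i * n) (by decide) ?_ ?_ ?_ ?_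
      · intro s' hF
        exact (hF.nreg 2 (by decide)).trans ((fr 2 (by decide)).trans h2)
      · exact ⟨by simpa using hE₃.setN (by decide) 0, by simpa using h5₃⟩
      · rintro i hi s₄ hF₄ h9 ⟨hE₄, h5₄⟩
        have g1 := (hF₄.narr 1 (by decide)).trans fa1
        have g2 := (hF₄.narr 2 (by decide)).trans fa2
        have g0 := (hF₄.nreg 0 (by decide)).trans ((fr 0 (by decide)).trans h0)
        have g13 := (hF₄.nreg 13 (by decide)).trans ((fr 13 (by decide)).trans h13)
        have g14 := (hF₄.nreg 14 (by decide)).trans ((fr 14 (by decide)).trans h14)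
        have g19 := (hF₄.nreg 19 (by decide)).trans ((fr 19 (by decide)).trans h19)
        refine (Runs.seq (runs_emitEdge hE₄ ⟨S * ((m + 1) * (k * n)) + i * n + s.narr 1 j,
          S * ((m + 1) * (k * n)) + i * n + (j + 1) * (k * n) + s.narr 1 j, 1, i, j, 0, 0⟩
          fun s₂ e1 e2 e3 e4 => ?_) fun s₅ hF₅ hE₅ =>
          Runs.seq (T' := 4) (runs_emitEdge hE₅
            ⟨S * ((m + 1) * (k * n)) + i * n + (j + 1) * (k * n) + s.narr 2 j,
            S * ((m + 1) * (k * n)) + i * n + 2 ^ j * ((m + 1) * (k * n)) + s.narr 2 j,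
            2, i, j, 0, 0⟩ fun s₂ e1 e2 e3 e4 => ?_) fun s₆ hF₆ hE₆ => ?_).le (by decide)
        · simp [NExp.eval, RExp.eval, e1, e4, g1, g14, g19, h5₄, h9]
        · have g2' := (hF₅.narr 2 (by decide)).trans g2
          have g5' := (hF₅.nreg 5 (by decide)).trans h5₄
          have g9' := (hF₅.nreg 9 (by decide)).trans h9
          have g13' := (hF₅.nreg 13 (by decide)).trans g13
          have g14' := (hF₅.nreg 14 (by decide)).trans g14
          have g19' := (hF₅.nreg 19 (by decide)).trans g19
          simp [NExp.eval, RExp.eval, e1, e4, g2', g13', g14', g19', g5', g9']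
        · refine runs_straight rfl ⟨?_, ?_⟩
          · rw [List.range_succ, List.flatMap_append, List.flatMap_singleton, ← List.append_assoc]
            rw [List.append_assoc, List.singleton_append] at hE₆
            exact hE₆.congr (by simp [Cmd.out]) (fun _ _ _ => rfl) rfl
          · have g5' := (hF₆.nreg 5 (by decide)).trans ((hF₅.nreg 5 (by decide)).trans h5₄)
            have g0' := (hF₆.nreg 0 (by decide)).trans ((hF₅.nreg 0 (by decide)).trans g0)
            simp [Cmd.out, NExp.eval, g5', g0']
            ring
      · rintro s' hF ⟨hE, h5'⟩
        rw [List.range_succ, List.flatMap_append, List.flatMap_singleton, ← List.append_assoc]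
        exact hE
    · intro s₄ hF₄ hE₄
      refine runs_straight rfl ⟨?_, ?_⟩
      · exact hE₄.congr (by simp [Cmd.out]) (fun _ _ _ => rfl) rfl
      · have g18 := (hF₄.nreg 18 (by decide)).trans ((hF₃.nreg 18 (by decide)).trans h18₂)
        have g29 := (hF₄.nreg 29 (by decide)).trans ((hF₃.nreg 29 (by decide)).trans
          ((hF₂.nreg 29 (by decide)).trans ((hF₁.nreg 29 (by decide)).trans h29)))
        simp [Cmd.out, NExp.eval, g18, g29]
        ring
  · exact fun s' hF h => h.1

end Delivery

namespace Delivery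

open RealRAM

/-! ### The doubling stages and the number of rounds -/

/-- One package (register 19): double the state graph and connect the two copies. -/
def stageProg : Cmd :=
  .setN 14 (.add (.var 14) (.var 12)) ;; copyProg ;; deliveryProg ;;
  .ite (.and (.nle (.get 1 (.var 19)) (.get 2 (.var 19)))
      (.nle (.get 2 (.var 19)) (.get 1 (.var 19))))
    (.setN 15 (.add (.var 15) (.var 13))) .skip ;;
  .setN 13 (.add (.var 13) (.var 13)) ;;
  .setN 17 (.add (.var 17) (.var 17))

/-- The set of packages below `j` that lie at their targets from the beginning, as a binary
number. -/
def trivialBits (s t : ℕ → ℕ) : ℕ → ℕ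
  | 0 => 0
  | j + 1 => trivialBits s t j + if s j = t j then 2 ^ j else 0

/-- One step of the recursion of `stateEdges`. Register `15` meanwhile accumulates the number of the
first state: the current bit is added if the package starts at its target. The bounds `E` and `P`
allow one time bound for all stages. -/
theorem runs_stageProg {s : Store} {n m k j x E P : ℕ} {adj src tgt p : ℕ → ℕ} {len : ℕ → ℝ}
    (h : HasEdges s (stateEdges n m k adj len src tgt p j)) (h0 : s.nreg 0 = n)
    (h2 : s.nreg 2 = k) (h12 : s.nreg 12 = k * n) (h19 : s.nreg 19 = j)
    (h17 : s.nreg 17 = 2 ^ j) (h14 : s.nreg 14 = j * (k * n))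
    (h13 : s.nreg 13 = 2 ^ j * ((m + 1) * (k * n))) (h29 : s.nreg 29 = (m + 1) * (k * n))
    (h15 : s.nreg 15 = x + trivialBits src tgt j * ((m + 1) * (k * n)))
    (hs : s.narr 1 = src) (ht : s.narr 2 = tgt)
    (hE : (stateEdges n m k adj len src tgt p j).length ≤ E) (hP : 2 ^ j ≤ P) :
    Runs stageProg s (forTime 1 E 100 + forTime 1 P (forTime 1 k 150 + 6) + 40) fun s' =>
      HasEdges s' (stateEdges n m k adj len src tgt p (j + 1)) ∧
      s'.nreg 17 = 2 ^ (j + 1) ∧ s'.nreg 14 = (j + 1) * (k * n) ∧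
      s'.nreg 13 = 2 ^ (j + 1) * ((m + 1) * (k * n)) ∧
      s'.nreg 15 = x + trivialBits src tgt (j + 1) * ((m + 1) * (k * n)) := by
  have first : Runs (.setN 14 (.add (.var 14) (.var 12))) s 4 fun s' =>
      HasEdges s' (stateEdges n m k adj len src tgt p j) ∧ s'.nreg 14 = (j + 1) * (k * n) := by
    refine runs_straight rfl ⟨h.congr (by simp [Cmd.out]) (fun _ _ _ => rfl) rfl, ?_⟩
    simp [Cmd.out, NExp.eval, h12, h14]
    ring
  refine (first.seq fun s₁ hF₁ ⟨hE₁, h14₁⟩ => (runs_copyProg hE₁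
    ((hF₁.nreg 13 (by decide)).trans h13)).seq fun s₂ hF₂ hE₂ =>
    (runs_deliveryProg hE₂ (n := n) (m := m) (k := k) (j := j)
    ((hF₂.nreg 0 (by decide)).trans ((hF₁.nreg 0 (by decide)).trans h0))
    ((hF₂.nreg 2 (by decide)).trans ((hF₁.nreg 2 (by decide)).trans h2))
    ((hF₂.nreg 19 (by decide)).trans ((hF₁.nreg 19 (by decide)).trans h19))
    ((hF₂.nreg 17 (by decide)).trans ((hF₁.nreg 17 (by decide)).trans h17))
    ((hF₂.nreg 14 (by decide)).trans h14₁)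
    ((hF₂.nreg 13 (by decide)).trans ((hF₁.nreg 13 (by decide)).trans h13))
    ((hF₂.nreg 29 (by decide)).trans ((hF₁.nreg 29 (by decide)).trans h29))).seq
    (T' := 30) fun s₃ hF₃ hE₃ => (runs_straight rfl ?_).le (by decide)).le ?_
  · rw [hF₂.narr 1 (by decide), hF₁.narr 1 (by decide), hs, hF₂.narr 2 (by decide),
      hF₁.narr 2 (by decide), ht] at hE₃
    have fr : ∀ r, r ∉ [14] ++ copyProg.nregs ++ deliveryProg.nregs → s₃.nreg r = s.nreg r := by
      intro r hr
      simp only [List.mem_append, not_or] at hr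
      exact (hF₃.nreg r hr.2).trans ((hF₂.nreg r hr.1.2).trans (hF₁.nreg r hr.1.1))
    have g12 := (fr 12 (by decide)).trans h12
    have g13 := (fr 13 (by decide)).trans h13
    have g15 := (fr 15 (by decide)).trans h15
    have g17 := (fr 17 (by decide)).trans h17
    have g19 := (fr 19 (by decide)).trans h19
    have g14 := (hF₃.nreg 14 (by decide)).trans ((hF₂.nreg 14 (by decide)).trans h14₁)
    have g1 : s₃.narr 1 = src := (hF₃.narr 1 (by decide)).trans ((hF₂.narr 1 (by decide)).trans
      ((hF₁.narr 1 (by decide)).trans hs))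
    have g2 : s₃.narr 2 = tgt := (hF₃.narr 2 (by decide)).trans ((hF₂.narr 2 (by decide)).trans
      ((hF₁.narr 2 (by decide)).trans ht))
    by_cases hst : src j = tgt j
    · have hb : ((BExp.nle (.get 1 (.var 19)) (.get 2 (.var 19))).and
          (.nle (.get 2 (.var 19)) (.get 1 (.var 19)))).Holds s₃ := by
        simp [BExp.Holds, NExp.eval, g1, g2, g19, hst]
      simp only [Cmd.out, if_pos hb]
      refine ⟨hE₃.congr (by simp) (fun _ _ _ => rfl) rfl, ?_, ?_, ?_, ?_⟩
      · simp [NExp.eval, g17]; ring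
      · simp [g14]
      · simp [NExp.eval, g13]; ring
      · simp [NExp.eval, g15, g13, trivialBits, hst]; ring
    · have hb : ¬ ((BExp.nle (.get 1 (.var 19)) (.get 2 (.var 19))).and
          (.nle (.get 2 (.var 19)) (.get 1 (.var 19)))).Holds s₃ := by
        simp only [BExp.Holds, NExp.eval, g1, g2, g19]
        exact fun h => hst (le_antisymm h.1 h.2)
      simp only [Cmd.out, if_neg hb]
      refine ⟨hE₃.congr (by simp) (fun _ _ _ => rfl) rfl, ?_, ?_, ?_, ?_⟩
      · simp [NExp.eval, g17]; ring
      · simp [g14]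
      · simp [NExp.eval, g13]; ring
      · simp [g15, trivialBits, hst]
  · have h1 : forTime 1 (stateEdges n m k adj len src tgt p j).length 100 ≤ forTime 1 E 100 :=
      forTime_mono hE le_rfl
    have h2 : forTime 1 (2 ^ j) (forTime 1 k 150 + 6) ≤ forTime 1 P (forTime 1 k 150 + 6) :=
      forTime_mono hP le_rfl
    lia

/-- Construct the list of edges of the state graph. -/
def constructProg : Cmd :=
  walkProg ;; .setN 29 (.var 5) ;; switchProg ;;
  .setN 12 (.const 0) ;; forTo 9 (.var 2) (.setN 12 (.add (.var 12) (.var 0))) ;;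
  (.setN 13 (.var 29) ;; .setN 17 (.const 1) ;; .setN 14 (.const 0) ;;
    .setN 15 (.get 3 (.const 0))) ;;
  forTo 19 (.var 1) stageProg ;;
  -- All packages delivered means the bit pattern `2 ^ m - 1`, hence one stride is subtracted.
  .setN 30 (.add (.sub (.var 13) (.var 29)) (.var 30))

theorem length_stateEdges_mono (n m k : ℕ) (adj : ℕ → ℕ) (len : ℕ → ℝ) (s t p : ℕ → ℕ) {j j' : ℕ}
    (h : j ≤ j') : (stateEdges n m k adj len s t p j).length ≤
      (stateEdges n m k adj len s t p j').length := by
  induction h with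
  | refl => rfl
  | step _ ih => refine ih.trans ?_; simp only [stateEdges, List.length_append]; lia

/-- Bound for the number of steps of `constructProg` when there are `E` edges. -/
def constructTime (n m k E : ℕ) : ℕ :=
  walkTime n m k + forTime 3 k 100 + forTime 1 k 4 +
    forTime 1 m (forTime 1 E 100 + forTime 1 (2 ^ m) (forTime 1 k 150 + 6) + 40) + 130

theorem runs_constructProg {s : Store} {n m k : ℕ} (h0 : s.nreg 0 = n) (h1 : s.nreg 1 = m)
    (h2 : s.nreg 2 = k) (h4 : s.nreg 4 = 0) (h5 : s.nreg 5 = 0) {L : List Edge}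
    (hL : L = stateEdges n m k (s.narr 0) (s.rarr 0) (s.narr 1) (s.narr 2) (s.narr 3) m) :
    Runs constructProg s (constructTime n m k L.length) fun s' =>
      HasEdges s' L ∧ s'.nreg 13 = 2 ^ m * ((m + 1) * (k * n)) ∧
      s'.nreg 15 = s.narr 3 0 +
        trivialBits (s.narr 1) (s.narr 2) m * ((m + 1) * (k * n)) ∧
      s'.nreg 30 = 2 ^ m * ((m + 1) * (k * n)) - (m + 1) * (k * n) +
        ((k - 1) * n + s.narr 3 (k - 1)) := by
  have hnil : HasEdges s [] := ⟨h4, fun x e he => by simp at he⟩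
  have s1 := runs_walkProg hnil h0 h1 h2 h5
  refine (s1.seq (T' := 2 + (forTime 3 k 100 + 100 + (2 + (forTime 1 k 4 + (20 +
    (forTime 1 m (forTime 1 L.length 100 + forTime 1 (2 ^ m) (forTime 1 k 150 + 6) + 40) + 6))))))
    fun s₁ hF₁ ⟨hE₁, h5₁⟩ => ?_).le ?_
  swap
  · unfold constructTime; lia
  have b0 := (hF₁.nreg 0 (by decide)).trans h0
  have b1 := (hF₁.nreg 1 (by decide)).trans h1
  have b2 := (hF₁.nreg 2 (by decide)).trans h2
  have a1 := hF₁.narr 1 (by decide)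
  have a2 := hF₁.narr 2 (by decide)
  have a3 := hF₁.narr 3 (by decide)
  refine Runs.seq (Q := fun s' => HasEdges s' (walkEdges n m k (s.narr 0) (s.rarr 0)) ∧
    s'.nreg 29 = (m + 1) * (k * n)) (runs_straight rfl ⟨hE₁.congr (by simp [Cmd.out])
      (fun _ _ _ => rfl) rfl, by simp [Cmd.out, NExp.eval, h5₁]⟩) fun s₂ hF₂ ⟨hE₂, h29₂⟩ => ?_
  replace b0 := (hF₂.nreg 0 (by decide)).trans b0
  replace b1 := (hF₂.nreg 1 (by decide)).trans b1
  replace b2 := (hF₂.nreg 2 (by decide)).trans b2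
  replace a1 := (hF₂.narr 1 (by decide)).trans a1
  replace a2 := (hF₂.narr 2 (by decide)).trans a2
  replace a3 := (hF₂.narr 3 (by decide)).trans a3
  refine (runs_switchProg hE₂ b0 b2).seq fun s₃ hF₃ ⟨hE₃, h30₃⟩ => ?_
  rw [a3] at hE₃ h30₃
  replace b0 := (hF₃.nreg 0 (by decide)).trans b0
  replace b1 := (hF₃.nreg 1 (by decide)).trans b1
  replace b2 := (hF₃.nreg 2 (by decide)).trans b2
  replace a1 := (hF₃.narr 1 (by decide)).trans a1
  replace a2 := (hF₃.narr 2 (by decide)).trans a2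
  replace a3 := (hF₃.narr 3 (by decide)).trans a3
  replace h29₂ := (hF₃.nreg 29 (by decide)).trans h29₂
  set L₀ := walkEdges n m k (s.narr 0) (s.rarr 0) ++ switchEdges n k (s.narr 3) ++
    [stayEdge n k (s.narr 3)] with hL₀
  refine Runs.seq (T := 2) (Q := fun s' => HasEdges s' L₀ ∧ s'.nreg 12 = 0)
    (runs_straight rfl ⟨hE₃.congr (by simp [Cmd.out])
      (fun _ _ _ => rfl) rfl, by simp [Cmd.out, NExp.eval]⟩) fun s₄ hF₄ ⟨hE₄, h12₄⟩ => ?_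
  -- The product `k * n` is formed by repeated addition.
  have hK : Runs (forTo 9 (.var 2) (.setN 12 (.add (.var 12) (.var 0)))) s₄ (forTime 1 k 4)
      fun s' => HasEdges s' L₀ ∧ s'.nreg 12 = k * n := by
    refine runs_forTo (b := .var 2) (fun i s' => HasEdges s' L₀ ∧ s'.nreg 12 = i * n) (by decide)
      ?_ ?_ ?_ ?_
    · intro s' hF
      exact (hF.nreg 2 (by decide)).trans ((hF₄.nreg 2 (by decide)).trans b2)
    · exact ⟨hE₄.setN (by decide) _, by simpa using h12₄⟩
    · rintro i hi s' hF h9 ⟨hE, h12⟩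
      have := (hF.nreg 0 (by decide)).trans ((hF₄.nreg 0 (by decide)).trans b0)
      refine runs_straight rfl ⟨hE.congr (by simp [Cmd.out]) (fun _ _ _ => rfl) rfl, ?_⟩
      simp [Cmd.out, NExp.eval, h12, this]
      ring
    · exact fun s' hF h => h
  refine hK.seq fun s₅ hF₅ ⟨hE₅, h12₅⟩ => ?_
  replace b0 := (hF₅.nreg 0 (by decide)).trans ((hF₄.nreg 0 (by decide)).trans b0)
  replace b1 := (hF₅.nreg 1 (by decide)).trans ((hF₄.nreg 1 (by decide)).trans b1)
  replace b2 := (hF₅.nreg 2 (by decide)).trans ((hF₄.nreg 2 (by decide)).trans b2)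
  replace a1 := (hF₅.narr 1 (by decide)).trans ((hF₄.narr 1 (by decide)).trans a1)
  replace a2 := (hF₅.narr 2 (by decide)).trans ((hF₄.narr 2 (by decide)).trans a2)
  replace a3 := (hF₅.narr 3 (by decide)).trans ((hF₄.narr 3 (by decide)).trans a3)
  replace h29₂ := (hF₅.nreg 29 (by decide)).trans ((hF₄.nreg 29 (by decide)).trans h29₂)
  replace h30₃ := (hF₅.nreg 30 (by decide)).trans ((hF₄.nreg 30 (by decide)).trans h30₃)
  refine Runs.seq (T := 20) (Q := fun s' => HasEdges s' L₀ ∧ s'.nreg 13 = (m + 1) * (k * n) ∧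
    s'.nreg 17 = 1 ∧ s'.nreg 14 = 0 ∧ s'.nreg 15 = s.narr 3 0)
    ((runs_straight rfl ⟨hE₅.congr (by simp [Cmd.out]) (fun _ _ _ => rfl) rfl,
      by simp [Cmd.out, NExp.eval, h29₂], by simp [Cmd.out, NExp.eval],
      by simp [Cmd.out, NExp.eval], by simp [Cmd.out, NExp.eval, a3]⟩).le (by decide))
    fun s₆ hF₆ ⟨hE₆, h13₆, h17₆, h14₆, h15₆⟩ => ?_
  replace b0 := (hF₆.nreg 0 (by decide)).trans b0
  replace b1 := (hF₆.nreg 1 (by decide)).trans b1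
  replace b2 := (hF₆.nreg 2 (by decide)).trans b2
  replace a1 := (hF₆.narr 1 (by decide)).trans a1
  replace a2 := (hF₆.narr 2 (by decide)).trans a2
  replace h29₂ := (hF₆.nreg 29 (by decide)).trans h29₂
  replace h30₃ := (hF₆.nreg 30 (by decide)).trans h30₃
  replace h12₅ := (hF₆.nreg 12 (by decide)).trans h12₅
  have hStages : Runs (forTo 19 (.var 1) stageProg) s₆ (forTime 1 m (forTime 1 L.length 100 +
      forTime 1 (2 ^ m) (forTime 1 k 150 + 6) + 40)) fun s' => HasEdges s' L ∧
      s'.nreg 13 = 2 ^ m * ((m + 1) * (k * n)) ∧ s'.nreg 15 = s.narr 3 0 +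
        trivialBits (s.narr 1) (s.narr 2) m * ((m + 1) * (k * n)) := by
    refine runs_forTo (b := .var 1) (fun j s' =>
      HasEdges s' (stateEdges n m k (s.narr 0) (s.rarr 0) (s.narr 1) (s.narr 2) (s.narr 3) j) ∧
      s'.nreg 17 = 2 ^ j ∧ s'.nreg 14 = j * (k * n) ∧
      s'.nreg 13 = 2 ^ j * ((m + 1) * (k * n)) ∧
      s'.nreg 15 = s.narr 3 0 + trivialBits (s.narr 1) (s.narr 2) j * ((m + 1) * (k * n)))
      (by decide) ?_ ?_ ?_ ?_
    · intro s' hF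
      exact (hF.nreg 1 (by decide)).trans b1
    · exact ⟨hE₆.setN (by decide) _, by simpa using h17₆, by simpa using h14₆, by simpa using h13₆,
        by simpa [trivialBits] using h15₆⟩
    · rintro j hj s' hF h19 ⟨hE, h17, h14, h13, h15⟩
      refine (runs_stageProg hE ((hF.nreg 0 (by decide)).trans b0)
        ((hF.nreg 2 (by decide)).trans b2) ((hF.nreg 12 (by decide)).trans h12₅) h19 h17 h14 h13
        ((hF.nreg 29 (by decide)).trans h29₂) h15 ((hF.narr 1 (by decide)).trans a1)
        ((hF.narr 2 (by decide)).trans a2) (hL ▸ length_stateEdges_mono _ _ _ _ _ _ _ _ hj.le)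
        (Nat.pow_le_pow_right (by decide) hj.le)).mono le_rfl ?_
      rintro s'' hF' ⟨hE', h17', h14', h13', h15'⟩
      exact ⟨hE'.setN (by decide) _, by simpa using h17', by simpa using h14', by simpa using h13',
        by simpa using h15'⟩
    · rintro s' hF ⟨hE, h17, h14, h13, h15⟩
      exact ⟨hL ▸ hE, h13, h15⟩
  refine hStages.seq fun s₇ hF₇ ⟨hE₇, h13₇, h15₇⟩ => ?_
  have g29 := (hF₇.nreg 29 (by decide)).trans h29₂
  have g30 := (hF₇.nreg 30 (by decide)).trans h30₃
  refine (runs_straight rfl ⟨hE₇.congr (by simp [Cmd.out]) (fun _ _ _ => rfl) rfl, ?_, ?_, ?_⟩).le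
    (by decide)
  · simp [Cmd.out, h13₇]
  · simp [Cmd.out, h15₇]
  · simp [Cmd.out, NExp.eval, h13₇, g29, g30]

/-- Compute the number of rounds (register 22) and the sum of all lengths (real register 1). -/
def roundsProg : Cmd :=
  .setN 22 (.const 0) ;; .setN 6 (.const 0) ;;
  forTo 10 (.var 0)
    (.setN 22 (.add (.var 22) (.add (.var 2) (.add (.var 1) (.var 1)))) ;;
    forTo 11 (.var 0)
      (.setR 1 (.add (.var 1) (.get 0 (.var 6))) ;; .setN 6 (.add (.var 6) (.const 1))))

theorem runs_roundsProg {s : Store} {n m k : ℕ} (h0 : s.nreg 0 = n) (h1 : s.nreg 1 = m)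
    (h2 : s.nreg 2 = k) (hr : s.rreg 1 = 0) :
    Runs roundsProg s (forTime 1 n (forTime 1 n 20 + 10) + 10) fun s' =>
      s'.nreg 22 = n * (k + 2 * m) ∧ s'.rreg 1 = ∑ x ∈ Finset.range (n * n), s.rarr 0 x := by
  refine (Runs.seq (T := 2) (Q := fun s' => s'.nreg 22 = 0)
    (runs_straight rfl (by simp [Cmd.out, NExp.eval])) fun s₁ hF₁ h22₁ =>
    Runs.seq (T := 2) (Q := fun s' => s'.nreg 6 = 0)
    (runs_straight rfl (by simp [Cmd.out, NExp.eval])) fun s₂ hF₂ h6₂ =>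
    runs_forTo (b := .var 0) (N := n) (Tb := forTime 1 n 20 + 10)
      (fun u s' => s'.nreg 22 = u * (k + 2 * m) ∧ s'.nreg 6 = u * n ∧
        s'.rreg 1 = ∑ x ∈ Finset.range (u * n), s.rarr 0 x) (by decide) ?_ ?_ ?_ ?_).le ?_
  · intro s' hF
    exact (hF.nreg 0 (by decide)).trans ((hF₂.nreg 0 (by decide)).trans
      ((hF₁.nreg 0 (by decide)).trans h0))
  · refine ⟨?_, by simpa using h6₂, ?_⟩
    · simpa using (hF₂.nreg 22 (by decide)).trans h22₁
    · simpa using (hF₂.rreg 1 (by decide)).trans ((hF₁.rreg 1 (by decide)).trans hr)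
  · rintro u hu s' hF h10 ⟨h22, h6, hr1⟩
    have b1 := (hF.nreg 1 (by decide)).trans ((hF₂.nreg 1 (by decide)).trans
      ((hF₁.nreg 1 (by decide)).trans h1))
    have b2 := (hF.nreg 2 (by decide)).trans ((hF₂.nreg 2 (by decide)).trans
      ((hF₁.nreg 2 (by decide)).trans h2))
    have b0 := (hF.nreg 0 (by decide)).trans ((hF₂.nreg 0 (by decide)).trans
      ((hF₁.nreg 0 (by decide)).trans h0))
    have ra := (hF.rarr 0 (by decide)).trans ((hF₂.rarr 0 (by decide)).trans
      (hF₁.rarr 0 (by decide)))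
    have first : Runs (.setN 22 (.add (.var 22) (.add (.var 2) (.add (.var 1) (.var 1))))) s' 10
        fun s' => s'.nreg 22 = (u + 1) * (k + 2 * m) := by
      refine (runs_straight rfl ?_).le (by decide)
      simp [Cmd.out, NExp.eval, h22, b1, b2]
      ring
    refine (first.seq fun s₃ hF₃ h22₃ => runs_forTo (b := .var 0) (N := n) (Tb := 20)
      (fun v s' => s'.nreg 6 = u * n + v ∧
        s'.rreg 1 = ∑ x ∈ Finset.range (u * n + v), s.rarr 0 x) (by decide) ?_ ?_ ?_ ?_).le
        (by change _ + forTime 1 _ _ ≤ _; lia)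
    · intro s₄ hF₄
      exact (hF₄.nreg 0 (by decide)).trans ((hF₃.nreg 0 (by decide)).trans b0)
    · exact ⟨by simpa using (hF₃.nreg 6 (by decide)).trans h6,
        by simpa using (hF₃.rreg 1 (by decide)).trans hr1⟩
    · rintro v hv s₄ hF₄ h11 ⟨h6₄, hr₄⟩
      have ra₄ := (hF₄.rarr 0 (by decide)).trans ((hF₃.rarr 0 (by decide)).trans ra)
      refine (runs_straight rfl ⟨?_, ?_⟩).le (by decide)
      · simp [Cmd.out, NExp.eval, h6₄, add_assoc]
      · simp [Cmd.out, NExp.eval, RExp.eval, h6₄, hr₄, ra₄, ← add_assoc, Finset.sum_range_succ]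
    · rintro s₄ hF₄ ⟨h6₄, hr₄⟩
      refine ⟨?_, ?_, ?_⟩
      · simpa using (hF₄.nreg 22 (by decide)).trans h22₃
      · simp [h6₄]; ring
      · simp [hr₄, add_mul]
  · exact fun s' hF h => ⟨h.1, h.2.2⟩
  · change _ + (_ + forTime 1 _ _) ≤ _; lia

end Delivery

namespace Delivery

open RealRAM

/-! ## The program: shortest walks with a given number of edges -/

/-- The arrays `reach`, `next` and `val` describe, for every state `x`, the cheapest walks of `r'`
edges from `x` to `y` at index `r' * N + x`; all `r' ≤ r` and the first `c` edges of the list for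
`r' = r + 1` have been taken into account. -/
structure Table (L : List Edge) (W : ℕ → ℝ) (N y r c : ℕ) (reach next : ℕ → ℕ) (val : ℕ → ℝ) :
    Prop where
  eq_of_reach : ∀ x < N, reach x ≠ 0 → x = y
  reach_last : reach y ≠ 0
  val_last : val y = 0
  sound : ∀ r' ≤ r, ∀ x < N, reach ((r' + 1) * N + x) ≠ 0 →
    ∃ e, L[next ((r' + 1) * N + x)]? = some e ∧ e.src = x ∧ reach (r' * N + e.dst) ≠ 0 ∧
      val ((r' + 1) * N + x) = W e.c1 * e.len + val (r' * N + e.dst)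
  complete : ∀ r' ≤ r, ∀ (i : ℕ) (e : Edge), L[i]? = some e → r' < r ∨ i < c →
    reach (r' * N + e.dst) ≠ 0 → reach ((r' + 1) * N + e.src) ≠ 0 ∧
      val ((r' + 1) * N + e.src) ≤ W e.c1 * e.len + val (r' * N + e.dst)
  fresh : ∀ x, (r + 2) * N ≤ x → reach x = 0

namespace Table

variable {L : List Edge} {W : ℕ → ℝ} {N y r c : ℕ} {reach next : ℕ → ℕ} {val : ℕ → ℝ}

theorem init (hy : y < N) (W : ℕ → ℝ) (L : List Edge) (next : ℕ → ℕ) :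
    Table L W N y 0 0 (Function.update (fun _ => 0) y 1) next (fun _ => 0) where
  eq_of_reach x hx h := by
    by_contra hne
    exact h (Function.update_of_ne hne _ _)
  reach_last := by simp
  val_last := rfl
  sound r' hr' x hx h := by
    refine absurd (Function.update_of_ne ?_ _ _) h
    rw [add_mul]
    lia
  complete r' hr' i e he h := by lia
  fresh x hx := Function.update_of_ne (by lia) _ _

/-- With all edges treated, layer `r + 1` is complete; layer `r + 2` is still blank by `fresh`, so
nothing has to be shown for it. -/
theorem next_round (h : Table L W N y r L.length reach next val) :
    Table L W N y (r + 1) 0 reach next val where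
  eq_of_reach := h.eq_of_reach
  reach_last := h.reach_last
  val_last := h.val_last
  sound r' hr' x hx hreach := by
    by_cases hr : r' ≤ r
    · exact h.sound r' hr x hx hreach
    · obtain rfl : r' = r + 1 := by lia
      exact absurd (h.fresh _ (by lia)) hreach
  complete r' hr' i e he hri hreach := by
    refine h.complete r' (by lia) i e he (.inr ?_) hreach
    exact (List.getElem?_eq_some_iff.1 he).1
  fresh x hx := h.fresh x ((Nat.mul_le_mul_right N (by lia)).trans hx)

theorem keep (h : Table L W N y r c reach next val) {e : Edge} (he : L[c]? = some e)
    (hkeep : reach (r * N + e.dst) ≠ 0 → reach ((r + 1) * N + e.src) ≠ 0 ∧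
      val ((r + 1) * N + e.src) ≤ W e.c1 * e.len + val (r * N + e.dst)) :
    Table L W N y r (c + 1) reach next val where
  eq_of_reach := h.eq_of_reach
  reach_last := h.reach_last
  val_last := h.val_last
  sound := h.sound
  complete r' hr' i e' he' hri hreach := by
    by_cases hic : r' < r ∨ i < c
    · exact h.complete r' hr' i e' he' hic hreach
    · obtain rfl : r' = r := by lia
      obtain rfl : i = c := by lia
      obtain rfl : e = e' := Option.some.inj (he.symm.trans he')
      exact hkeep hreach
  fresh := h.fresh

/-- Relaxation reads layer `r` and writes only layer `r + 1`. Finished layers therefore stay valid,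
and `sound` can be an exact equation. The new value is at most the old one, so edges treated before
remain dominated. -/
theorem update (h : Table L W N y r c reach next val) (hL : ∀ e ∈ L, e.src < N ∧ e.dst < N)
    (hy : y < N) {e : Edge} (he : L[c]? = some e) (hreach : reach (r * N + e.dst) ≠ 0)
    (hnew : reach ((r + 1) * N + e.src) ≠ 0 →
      W e.c1 * e.len + val (r * N + e.dst) ≤ val ((r + 1) * N + e.src)) :
    Table L W N y r (c + 1) (Function.update reach ((r + 1) * N + e.src) 1)
      (Function.update next ((r + 1) * N + e.src) c)
      (Function.update val ((r + 1) * N + e.src) (W e.c1 * e.len + val (r * N + e.dst))) := by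
  have hmem : ∀ {i : ℕ} {e : Edge}, L[i]? = some e → e.src < N ∧ e.dst < N := fun he' =>
    hL _ (List.mem_of_getElem? he')
  -- The written cell lies outside all layers up to `r`.
  have hlow : ∀ r' ≤ r, ∀ x < N, r' * N + x ≠ (r + 1) * N + e.src := by
    intro r' hr' x hx
    have := mul_add_lt hx (show r' < r + 1 by lia)
    lia
  have hy' := hlow 0 (by lia)
  simp only [zero_mul, zero_add] at hy'
  refine ⟨fun x hx => ?_, ?_, ?_, fun r' hr' x hx hreach' => ?_, fun r' hr' i e' he' hri hreach' =>
    ?_, fun x hx => ?_⟩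
  · rw [Function.update_of_ne (hy' x hx)]
    exact h.eq_of_reach x hx
  · rw [Function.update_of_ne (hy' y hy)]
    exact h.reach_last
  · rw [Function.update_of_ne (hy' y hy)]
    exact h.val_last
  · by_cases hx' : (r' + 1) * N + x = (r + 1) * N + e.src
    · obtain ⟨h1, rfl⟩ := mul_add_inj hx (hmem he).1 hx'
      obtain rfl : r' = r := by lia
      refine ⟨e, by simpa using he, rfl, ?_, ?_⟩
      · rwa [Function.update_of_ne (hlow _ le_rfl _ (hmem he).2)]
      · rw [Function.update_self, Function.update_of_ne (hlow _ le_rfl _ (hmem he).2)]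
    · rw [Function.update_of_ne hx'] at hreach'
      obtain ⟨e', h1, h2, h3, h4⟩ := h.sound r' hr' x hx hreach'
      refine ⟨e', ?_, h2, ?_, ?_⟩
      · rwa [Function.update_of_ne hx']
      · rwa [Function.update_of_ne (hlow _ hr' _ (hmem h1).2)]
      · rw [Function.update_of_ne hx', Function.update_of_ne (hlow _ hr' _ (hmem h1).2), h4]
  · rw [Function.update_of_ne (hlow _ hr' _ (hmem he').2)] at hreach' ⊢
    by_cases hx' : (r' + 1) * N + e'.src = (r + 1) * N + e.src
    · obtain ⟨h1, h2⟩ := mul_add_inj (hmem he').1 (hmem he).1 hx'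
      obtain rfl : r' = r := by lia
      rw [hx', Function.update_self, Function.update_self]
      refine ⟨one_ne_zero, ?_⟩
      by_cases hic : i < c
      · obtain ⟨h3, h4⟩ := h.complete r' hr' i e' he' (.inr hic) hreach'
        rw [hx'] at h3 h4
        exact (hnew h3).trans h4
      · obtain rfl : i = c := by lia
        obtain rfl : e = e' := Option.some.inj (he.symm.trans he')
        exact le_rfl
    · rw [Function.update_of_ne hx', Function.update_of_ne hx']
      refine h.complete r' hr' i e' he' ?_ hreach'
      by_contra hic
      obtain rfl : r' = r := by lia
      obtain rfl : i = c := by lia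
      obtain rfl : e = e' := Option.some.inj (he.symm.trans he')
      exact hx' rfl
  · rw [Function.update_of_ne]
    · exact h.fresh x hx
    · have := mul_add_lt (hmem he).1 (show r + 1 < r + 2 by lia)
      lia

/-- Induction along the walk, since layers count the edges that remain until `y`. The number of
edges is fixed, so the signs of weights and lengths play no role. -/
theorem le_walkCost (h : Table L W N y r 0 reach next val) {ω : List Edge} {x : ℕ}
    (hω : IsWalk L x ω y) (hr : ω.length ≤ r) :
    reach (ω.length * N + x) ≠ 0 ∧ val (ω.length * N + x) ≤ walkCost W ω := by
  induction ω generalizing x with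
  | nil =>
    obtain rfl : x = y := hω
    simpa [walkCost, h.val_last] using h.reach_last
  | cons e ω ih =>
    obtain ⟨he, rfl, hω⟩ := hω
    rw [List.length_cons] at hr ⊢
    obtain ⟨i, hi⟩ := List.mem_iff_getElem?.1 he
    obtain ⟨h1, h2⟩ := ih hω (by lia)
    obtain ⟨h3, h4⟩ := h.complete ω.length (by lia) i e hi (.inl (by lia)) h1
    refine ⟨h3, h4.trans ?_⟩
    simp only [walkCost, List.map_cons, List.sum_cons] at h2 ⊢
    gcongr

end Table

/-- The cost of the best walk that begins with edge number `e` (register 20). -/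
def candidate : RExp :=
  .add (.mul (.get 1 (.get 11 (.var 20))) (.get 3 (.var 20))) (.get 4 (.var 23))

/-- Improve the table with edge number `e` (register 20). -/
def relaxProg : Cmd :=
  .setN 23 (.add (.var 31) (.get 9 (.var 20))) ;;
  .setN 24 (.add (.add (.var 31) (.var 13)) (.get 8 (.var 20))) ;;
  .ite (.and (.nle (.const 1) (.get 14 (.var 23)))
      (.not (.and (.nle (.const 1) (.get 14 (.var 24))) (.rle (.get 4 (.var 24)) candidate))))
    (.putR 4 (.var 24) candidate ;; .putN 14 (.var 24) (.const 1) ;;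
      .putN 15 (.var 24) (.var 20))
    .skip

/-- The value infinity is represented by `reach = 0`: a cell is overwritten if the end of the edge
is reachable and the cell is either blank or strictly worse than the candidate. -/
theorem runs_relaxProg {s : Store} {L : List Edge} {N y r c : ℕ} (hE : HasEdges s L)
    (h : Table L (s.rarr 1) N y r c (s.narr 14) (s.narr 15) (s.rarr 4))
    (hL : ∀ e ∈ L, e.src < N ∧ e.dst < N) (hy : y < N) (hc : c < L.length)
    (h20 : s.nreg 20 = c) (h13 : s.nreg 13 = N) (h31 : s.nreg 31 = r * N) :
    Runs relaxProg s 80 fun s' =>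
      Table L (s.rarr 1) N y r (c + 1) (s'.narr 14) (s'.narr 15) (s'.rarr 4) := by
  obtain ⟨e, he⟩ : ∃ e, L[c]? = some e := ⟨_, List.getElem?_eq_getElem hc⟩
  obtain ⟨e8, e9, e10, e11, e12, e13, e3⟩ := hE.2 c e he
  refine (Runs.seq (T := 5) (T' := 75) (Q := fun s' => s'.nreg 23 = r * N + e.dst)
    (runs_straight rfl (by simp [Cmd.out, NExp.eval, h31, h20, e9])) fun s₁ hF₁ h23 =>
    Runs.seq (T := 7) (T' := 68) (Q := fun s' => s'.nreg 24 = (r + 1) * N + e.src)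
    (runs_straight rfl ?_) fun s₂ hF₂ h24 => ?_)
  · have g31 := (hF₁.nreg 31 (by decide)).trans h31
    have g13 := (hF₁.nreg 13 (by decide)).trans h13
    have g20 := (hF₁.nreg 20 (by decide)).trans h20
    have g8 := hF₁.narr 8 (by decide)
    simp [Cmd.out, NExp.eval, g31, g13, g20, g8, e8]
    ring
  · replace h23 := (hF₂.nreg 23 (by decide)).trans h23
    have g20 := (hF₂.nreg 20 (by decide)).trans ((hF₁.nreg 20 (by decide)).trans h20)
    have gn : ∀ a, s₂.narr a = s.narr a := fun a =>
      (hF₂.narr a (by simp [Cmd.narrs])).trans (hF₁.narr a (by simp [Cmd.narrs]))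
    have gr : ∀ a, s₂.rarr a = s.rarr a := fun a =>
      (hF₂.rarr a (by simp [Cmd.rarrs])).trans (hF₁.rarr a (by simp [Cmd.rarrs]))
    have hcand : candidate.eval s₂ = s.rarr 1 e.c1 * e.len + s.rarr 4 (r * N + e.dst) := by
      simp [candidate, RExp.eval, NExp.eval, gr, gn, g20, h23, e11, e3]
    have hb : ((BExp.nle (.const 1) (.get 14 (.var 23))).and
        (.not (.and (.nle (.const 1) (.get 14 (.var 24)))
          (.rle (.get 4 (.var 24)) candidate)))).Holds s₂ ↔
        s.narr 14 (r * N + e.dst) ≠ 0 ∧ ¬ (s.narr 14 ((r + 1) * N + e.src) ≠ 0 ∧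
          s.rarr 4 ((r + 1) * N + e.src) ≤
            s.rarr 1 e.c1 * e.len + s.rarr 4 (r * N + e.dst)) := by
      simp only [BExp.Holds, hcand]
      simp [NExp.eval, RExp.eval, gr, gn, h23, h24, Nat.one_le_iff_ne_zero]
    refine (runs_ite (T := 30) (fun hh => (runs_straight rfl ?_).le (by decide)) fun hh =>
      (runs_straight (c := .skip) rfl ?_).le (by decide)).le (by decide)
    · rw [hb] at hh
      have := h.update hL hy he hh.1 fun hreach => by
        by_contra hlt
        exact hh.2 ⟨hreach, (not_le.1 hlt).le⟩
      simpa [Cmd.out, NExp.eval, hcand, gn, gr, h24, g20] using this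
    · rw [hb] at hh
      simp only [Cmd.out, gn, gr]
      refine h.keep he fun hreach => ?_
      by_contra hne
      exact hh ⟨hreach, hne⟩

/-- Compute the table and the product (real register 2) of the number of rounds and the sum of all
lengths. -/
def tableProg : Cmd :=
  (.putN 14 (.var 30) (.const 1) ;; .setN 31 (.const 0)) ;;
  forTo 32 (.var 22)
    (forTo 20 (.var 4) relaxProg ;;
      .setN 31 (.add (.var 31) (.var 13)) ;; .setR 2 (.add (.var 2) (.var 1)))

/-- The loop over the rounds also adds up `R * s.rreg 1`, the bound used in the payments, because a
natural number cannot be converted to a real one. -/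
theorem runs_tableProg {s : Store} {L : List Edge} {N y R : ℕ} (hE : HasEdges s L)
    (hL : ∀ e ∈ L, e.src < N ∧ e.dst < N) (hy : y < N)
    (h13 : s.nreg 13 = N) (h30 : s.nreg 30 = y) (h22 : s.nreg 22 = R)
    (h14 : s.narr 14 = fun _ => 0) (h4 : s.rarr 4 = fun _ => 0) (hr : s.rreg 2 = 0) :
    Runs tableProg s (forTime 1 R (forTime 1 L.length 80 + 10) + 10) fun s' =>
      Table L (s.rarr 1) N y R 0 (s'.narr 14) (s'.narr 15) (s'.rarr 4) ∧
      s'.nreg 31 = R * N ∧ s'.rreg 2 = R * s.rreg 1 := by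
  refine (Runs.seq (T := 10) (Q := fun s' => Table L (s.rarr 1) N y 0 0 (s'.narr 14) (s'.narr 15)
    (s'.rarr 4) ∧ s'.nreg 31 = 0) ((runs_straight rfl ⟨?_, ?_⟩).le (by decide))
    fun s₁ hF₁ ⟨hT₁, h31₁⟩ =>
    runs_forTo (b := .var 22) (N := R) (Tb := forTime 1 L.length 80 + 10)
      (fun r s' => Table L (s.rarr 1) N y r 0 (s'.narr 14) (s'.narr 15) (s'.rarr 4) ∧
        s'.nreg 31 = r * N ∧ s'.rreg 2 = r * s.rreg 1) (by decide)
      (fun s' hF => (hF.nreg 22 (by decide)).trans ((hF₁.nreg 22 (by decide)).trans h22))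
      ⟨by simpa using hT₁, by simpa using h31₁,
        by simpa using (hF₁.rreg 2 (by decide)).trans hr⟩ ?_ fun s' hF h => h).le
      (by change _ + forTime 1 _ _ ≤ _; lia)
  · simpa [Cmd.out, NExp.eval, h30, h14, h4] using Table.init hy (s.rarr 1) L (s.narr 15)
  · simp [Cmd.out, NExp.eval]
  · rintro r hr' s₂ hF₂ h32 ⟨hT₂, h31₂, hr₂⟩
    have hE₂ : HasEdges s₂ L := hE.congr
      ((hF₂.nreg 4 (by decide)).trans (hF₁.nreg 4 (by decide)))
      (fun a ha ha' => (hF₂.narr a (by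
        have h1 : a ≠ 14 := by lia
        have h2 : a ≠ 15 := by lia
        simp [forTo, relaxProg, Cmd.narrs, h1, h2])).trans (hF₁.narr a (by
          have h1 : a ≠ 14 := by lia
          simp [Cmd.narrs, h1])))
      ((hF₂.rarr 3 (by decide)).trans (hF₁.rarr 3 (by decide)))
    have hW₂ : s₂.rarr 1 = s.rarr 1 :=
      (hF₂.rarr 1 (by decide)).trans (hF₁.rarr 1 (by decide))
    have h13₂ := (hF₂.nreg 13 (by decide)).trans ((hF₁.nreg 13 (by decide)).trans h13)
    have hr1 := (hF₂.rreg 1 (by decide)).trans (hF₁.rreg 1 (by decide))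
    have hround : Runs (forTo 20 (.var 4) relaxProg) s₂ (forTime 1 L.length 80) fun s' =>
        Table L (s.rarr 1) N y (r + 1) 0 (s'.narr 14) (s'.narr 15) (s'.rarr 4) := by
      refine runs_forTo (b := .var 4)
        (fun c s' => Table L (s.rarr 1) N y r c (s'.narr 14) (s'.narr 15) (s'.rarr 4))
        (by decide) (fun s' hF => (hF.nreg 4 (by decide)).trans hE₂.1) (by simpa using hT₂) ?_ ?_
      · intro c hc s₃ hF₃ h20 hT₃
        have hE₃ : HasEdges s₃ L := hE₂.congr (hF₃.nreg 4 (by decide))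
          (fun a ha ha' => hF₃.narr a (by
            have h1 : a ≠ 14 := by lia
            have h2 : a ≠ 15 := by lia
            simp [forTo, relaxProg, Cmd.narrs, h1, h2])) (hF₃.rarr 3 (by decide))
        have hW₃ : s₃.rarr 1 = s.rarr 1 := (hF₃.rarr 1 (by decide)).trans hW₂
        have := runs_relaxProg (y := y) (r := r) hE₃ (by rwa [hW₃]) hL hy hc h20
          ((hF₃.nreg 13 (by decide)).trans h13₂) ((hF₃.nreg 31 (by decide)).trans h31₂)
        rw [hW₃] at this
        exact this
      · exact fun s' hF h => h.next_round
    refine (hround.seq (T' := 10) fun s₃ hF₃ hT₃ => (runs_straight rfl ⟨hT₃, ?_, ?_⟩).le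
      (by decide))
    · have g31 := (hF₃.nreg 31 (by decide)).trans h31₂
      have g13 := (hF₃.nreg 13 (by decide)).trans h13₂
      simp [Cmd.out, NExp.eval, g31, g13]
      ring
    · have g2 := (hF₃.rreg 2 (by decide)).trans hr₂
      have g1 := (hF₃.rreg 1 (by decide)).trans hr1
      simp [Cmd.out, RExp.eval, g2, g1]
      ring

/-! ## The program: output -/

/-- The codes of the actions in a walk. -/
def codes (ω : List Edge) : List (ℕ × ℕ × ℕ × ℕ) :=
  (ω.filter fun e => e.c0 ≠ 3).map fun e => (e.c0, e.c1, e.c2, e.c3)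

/-- The memory contains the list `C` of action codes. -/
def HasCodes (s : Store) (C : List (ℕ × ℕ × ℕ × ℕ)) : Prop :=
  s.nreg 3 = C.length ∧ ∀ (l : ℕ) (c : ℕ × ℕ × ℕ × ℕ), C[l]? = some c →
    (s.narr 4 l, s.narr 5 l, s.narr 6 l, s.narr 7 l) = c

/-- Follow one edge of the best walk. -/
def followProg : Cmd :=
  .setN 20 (.get 15 (.add (.var 31) (.var 15))) ;;
  .ite (.nle (.const 3) (.get 10 (.var 20))) .skip
    (.putN 4 (.var 3) (.get 10 (.var 20)) ;; .putN 5 (.var 3) (.get 11 (.var 20)) ;;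
      .putN 6 (.var 3) (.get 12 (.var 20)) ;; .putN 7 (.var 3) (.get 13 (.var 20)) ;;
      .setN 3 (.add (.var 3) (.const 1))) ;;
  .putR 5 (.get 11 (.var 20)) (.add (.get 5 (.get 11 (.var 20))) (.get 3 (.var 20))) ;;
  .setN 15 (.get 9 (.var 20)) ;; .setN 31 (.sub (.var 31) (.var 13))

/-- A void edge produces no output but still counts as a round. By `he3` the test `3 ≤ c0`
recognizes exactly these edges. -/
theorem runs_followProg {s : Store} {L : List Edge} {e : Edge} {ω : List Edge} {N r x : ℕ}
    (hE : HasEdges s L) (h15 : s.nreg 15 = x) (h31 : s.nreg 31 = (r + 1) * N)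
    (h13 : s.nreg 13 = N) (he : L[s.narr 15 ((r + 1) * N + x)]? = some e) (he3 : e.c0 ≤ 3)
    (hC : HasCodes s (codes ω)) (hd : s.rarr 5 = fun a => travel a ω) :
    Runs followProg s 100 fun s' => HasCodes s' (codes (ω ++ [e])) ∧
      (s'.rarr 5 = fun a => travel a (ω ++ [e])) ∧ s'.nreg 15 = e.dst ∧
      s'.nreg 31 = r * N := by
  obtain ⟨e8, e9, e10, e11, e12, e13, e3⟩ := hE.2 _ e he
  have htr : Function.update (fun a => travel a ω) e.c1 (travel e.c1 ω + e.len) =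
      fun a => travel a (ω ++ [e]) := by
    ext a
    by_cases ha : a = e.c1
    · subst ha; simp [travel]
    · simp [ha, travel, Ne.symm ha]
  have hsub : (r + 1) * N - N = r * N := by rw [add_mul, one_mul, Nat.add_sub_cancel]
  by_cases h3 : e.c0 = 3
  · have hcodes : codes (ω ++ [e]) = codes ω := by simp [codes, h3]
    have hb : (BExp.nle (.const 3) (.get 10 (.var 20))).Holds
        (Cmd.out (.setN 20 (.get 15 (.add (.var 31) (.var 15)))) s) := by
      simp [BExp.Holds, NExp.eval, Cmd.out, h15, h31, e10, h3]
    refine (runs_straight rfl ?_).le (by decide)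
    rw [hcodes]
    rw [followProg, Cmd.out_seq, Cmd.out_seq, Cmd.out_ite_pos hb]
    refine ⟨?_, ?_, ?_, ?_⟩
    · simpa [HasCodes, Cmd.out] using hC
    · simpa [Cmd.out, NExp.eval, RExp.eval, h15, h31, e11, e3, hd] using htr
    · simp [Cmd.out, NExp.eval, h15, h31, e9]
    · simpa [Cmd.out, NExp.eval, h15, h31, h13] using hsub
  · have hcodes : codes (ω ++ [e]) = codes ω ++ [(e.c0, e.c1, e.c2, e.c3)] := by simp [codes, h3]
    have hb : ¬ (BExp.nle (.const 3) (.get 10 (.var 20))).Holds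
        (Cmd.out (.setN 20 (.get 15 (.add (.var 31) (.var 15)))) s) := by
      simp [BExp.Holds, NExp.eval, Cmd.out, h15, h31, e10]
      lia
    refine (runs_straight rfl ?_).le (by decide)
    rw [hcodes]
    rw [followProg, Cmd.out_seq, Cmd.out_seq, Cmd.out_ite_neg hb]
    refine ⟨⟨?_, fun l c hc => ?_⟩, ?_, ?_, ?_⟩
    · simp [Cmd.out, NExp.eval, hC.1]
    · have hl : l < (codes ω).length + 1 := by
        simpa using (List.getElem?_eq_some_iff.1 hc).1
      by_cases hl' : l = (codes ω).length
      · subst hl'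
        rw [List.getElem?_concat_length, Option.some.injEq] at hc
        rw [← hc]
        simp [Cmd.out, NExp.eval, h15, h31, hC.1, e10, e11, e12, e13]
      · rw [List.getElem?_append_left (by lia)] at hc
        have := hC.2 l c hc
        simpa [Cmd.out, NExp.eval, hC.1, hl'] using this
    · simpa [Cmd.out, NExp.eval, RExp.eval, h15, h31, e11, e3, hd] using htr
    · simp [Cmd.out, NExp.eval, h15, h31, e9]
    · simpa [Cmd.out, NExp.eval, h15, h31, h13] using hsub

/-- Output the actions of the best walk, and compute the distances (real array 5). -/
def extractProg : Cmd := forTo 32 (.var 22) followProg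

theorem isWalk_concat {L : List Edge} {x y : ℕ} {ω : List Edge} {e : Edge} (h : IsWalk L x ω y)
    (he : e ∈ L) (hy : e.src = y) : IsWalk L x (ω ++ [e]) e.dst :=
  isWalk_append h ⟨he, hy, rfl⟩

/-- The table looks from each state towards `y`, so the walk is read off in forward order while the
layer decreases. Invariant: cost so far plus tabulated cost of the rest equals the tabulated cost of
the start. -/
theorem runs_extractProg {s : Store} {L : List Edge} {W : ℕ → ℝ} {N x y R : ℕ}
    (hE : HasEdges s L) (hT : Table L W N y R 0 (s.narr 14) (s.narr 15) (s.rarr 4))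
    (hL : ∀ e ∈ L, e.dst < N ∧ e.c0 ≤ 3) (hx : x < N)
    (hreach : s.narr 14 (R * N + x) ≠ 0)
    (h13 : s.nreg 13 = N) (h15 : s.nreg 15 = x) (h22 : s.nreg 22 = R)
    (h31 : s.nreg 31 = R * N) (h3 : s.nreg 3 = 0) (h5 : s.rarr 5 = fun _ => 0) :
    Runs extractProg s (forTime 1 R 100) fun s' => ∃ ω, IsWalk L x ω y ∧ ω.length = R ∧
      walkCost W ω = s.rarr 4 (R * N + x) ∧ HasCodes s' (codes ω) ∧
      s'.rarr 5 = fun a => travel a ω := by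
  refine runs_forTo (b := .var 22) (N := R) (Tb := 100) (fun i s' => ∃ ω z, IsWalk L x ω z ∧
      ω.length = i ∧ walkCost W ω + s.rarr 4 ((R - i) * N + z) = s.rarr 4 (R * N + x) ∧ z < N ∧
      s.narr 14 ((R - i) * N + z) ≠ 0 ∧ HasCodes s' (codes ω) ∧
      (s'.rarr 5 = fun a => travel a ω) ∧ s'.nreg 15 = z ∧ s'.nreg 31 = (R - i) * N)
    (by decide) (fun s' hF => (hF.nreg 22 (by decide)).trans h22) ?_ ?_ ?_
  · refine ⟨[], x, rfl, rfl, by simp [walkCost], hx, hreach, ⟨?_, ?_⟩, ?_, ?_, ?_⟩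
    · simpa [codes] using h3
    · simp [codes]
    · simpa [travel] using h5
    · simpa using h15
    · simpa using h31
  · rintro i hi s₁ hF₁ h32 ⟨ω, z, h1, h2, h4, hz, h6, h7, h8, h9, h10⟩
    obtain ⟨r, hr⟩ : ∃ r, R - i = r + 1 := ⟨R - i - 1, by lia⟩
    rw [hr] at h4 h6 h10
    obtain ⟨e, he, rfl, he', hv⟩ := hT.sound r (by lia) z hz h6
    have hmem := List.mem_of_getElem? he
    have hE₁ : HasEdges s₁ L := hE.congr (hF₁.nreg 4 (by decide))
      (fun a ha ha' => hF₁.narr a (by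
        have h1 : a ≠ 4 := by lia
        have h2 : a ≠ 5 := by lia
        have h3 : a ≠ 6 := by lia
        have h4 : a ≠ 7 := by lia
        simp [forTo, followProg, Cmd.narrs, h1, h2, h3, h4])) (hF₁.rarr 3 (by decide))
    refine (runs_followProg hE₁ h9 h10 ((hF₁.nreg 13 (by decide)).trans h13)
      (by rw [hF₁.narr 15 (by decide)]; exact he) (hL e hmem).2 h7 h8).mono le_rfl ?_
    rintro s₂ hF₂ ⟨g1, g2, g3, g4⟩
    have hr' : R - (i + 1) = r := by lia
    rw [hr']
    refine ⟨ω ++ [e], e.dst, isWalk_concat h1 hmem rfl, by simp [h2], ?_, (hL e hmem).1, he',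
      ⟨by simpa using g1.1, g1.2⟩, g2, by simpa using g3, by simpa using g4⟩
    rw [← h4, hv]
    simp [walkCost, add_assoc]
  · rintro s' hF ⟨ω, z, h1, h2, h4, hz, h6, h7, h8, h9, h10⟩
    simp only [Nat.sub_self, zero_mul, zero_add] at h4 h6
    -- In layer `0` only `y` is reachable, so the walk has arrived.
    obtain rfl := hT.eq_of_reach z hz h6
    refine ⟨ω, h1, h2, ?_, h7, h8⟩
    rw [← h4, hT.val_last, add_zero]

/-- The bonus of agent `i` (register 9) for not travelling further. -/
def bonus : RExp := .mul (.get 1 (.var 9)) (.sub (.var 2) (.get 5 (.var 9)))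

/-- Compute the payments. -/
def payProg : Cmd :=
  .setR 3 (.const 0) ;;
  forTo 9 (.var 2) (.setR 3 (.add (.var 3) bonus)) ;;
  forTo 9 (.var 2) (.putR 2 (.var 9) (.sub (.var 3) bonus))

/-- The sum over the other agents is obtained as the full sum minus the agent's own term, so two
simple loops suffice. -/
theorem runs_payProg {s : Store} {k : ℕ} (h2 : s.nreg 2 = k) :
    Runs payProg s (2 * forTime 1 k 20 + 2) fun s' => ∀ i < k, s'.rarr 2 i =
      ∑ a ∈ Finset.range k, s.rarr 1 a * (s.rreg 2 - s.rarr 5 a) -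
        s.rarr 1 i * (s.rreg 2 - s.rarr 5 i) := by
  refine (Runs.seq (T := 2) (Q := fun s' => s'.rreg 3 = 0)
    (runs_straight rfl (by simp [Cmd.out, RExp.eval])) fun s₁ hF₁ h3 =>
    Runs.seq (Q := fun s' => s'.rreg 3 =
      ∑ a ∈ Finset.range k, s.rarr 1 a * (s.rreg 2 - s.rarr 5 a))
    (runs_forTo (b := .var 2) (N := k) (Tb := 20)
      (fun i s' => s'.rreg 3 = ∑ a ∈ Finset.range i, s.rarr 1 a * (s.rreg 2 - s.rarr 5 a))
      (by decide) (fun s' hF => (hF.nreg 2 (by decide)).trans ((hF₁.nreg 2 (by decide)).trans h2))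
      (by simpa using h3) ?_ fun s' hF h => h) fun s₂ hF₂ h3' =>
    runs_forTo (b := .var 2) (N := k) (Tb := 20) (fun i s' => ∀ j < i, s'.rarr 2 j =
      ∑ a ∈ Finset.range k, s.rarr 1 a * (s.rreg 2 - s.rarr 5 a) -
        s.rarr 1 j * (s.rreg 2 - s.rarr 5 j))
      (by decide) (fun s' hF => (hF.nreg 2 (by decide)).trans ((hF₂.nreg 2 (by decide)).trans
        ((hF₁.nreg 2 (by decide)).trans h2))) (by simp) ?_ fun s' hF h => h).le
    (by change _ + (forTime 1 _ _ + forTime 1 _ _) ≤ _; lia)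
  · intro i hi s' hF h9 h3'
    have g1 := (hF.rarr 1 (by decide)).trans (hF₁.rarr 1 (by decide))
    have g5 := (hF.rarr 5 (by decide)).trans (hF₁.rarr 5 (by decide))
    have g2 := (hF.rreg 2 (by decide)).trans (hF₁.rreg 2 (by decide))
    refine (runs_straight rfl ?_).le (by decide)
    simp [Cmd.out, RExp.eval, NExp.eval, bonus, h3', h9, g1, g5, g2, Finset.sum_range_succ]
  · intro i hi s' hF h9 hj
    have g1 := (hF.rarr 1 (by decide)).trans ((hF₂.rarr 1 (by decide)).trans
      (hF₁.rarr 1 (by decide)))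
    have g5 := (hF.rarr 5 (by decide)).trans ((hF₂.rarr 5 (by decide)).trans
      (hF₁.rarr 5 (by decide)))
    have g2 := (hF.rreg 2 (by decide)).trans ((hF₂.rreg 2 (by decide)).trans
      (hF₁.rreg 2 (by decide)))
    have g3 := (hF.rreg 3 (by decide)).trans h3'
    refine (runs_straight rfl fun j hj' => ?_).le (by decide)
    by_cases hji : j = i
    · subst hji
      simp [Cmd.out, RExp.eval, NExp.eval, bonus, h9, g1, g5, g2, g3]
    · have := hj j (by lia)
      simpa [Cmd.out, NExp.eval, h9, hji] using this

end Delivery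

namespace Delivery

open RealRAM

/-! ## The mechanism -/

/-- The program that computes the mechanism. -/
def mechanismProg : Cmd :=
  constructProg ;; roundsProg ;; tableProg ;; extractProg ;; payProg

/-- Bound for the number of steps of `mechanismProg` when there are `E` edges. -/
def mechanismTime (n m k E : ℕ) : ℕ :=
  constructTime n m k E + ((forTime 1 n (forTime 1 n 20 + 10) + 10) +
    ((forTime 1 (n * (k + 2 * m)) (forTime 1 E 80 + 10) + 10) +
      (forTime 1 (n * (k + 2 * m)) 100 + (2 * forTime 1 k 20 + 2))))

/-! ### Running time -/

theorem length_flatMap_range_le {α : Type*} (a b : ℕ) (f : ℕ → List α)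
    (h : ∀ i, (f i).length ≤ b) : ((List.range a).flatMap f).length ≤ a * b := by
  induction a with
  | zero => simp
  | succ a ih =>
    rw [List.range_succ, List.flatMap_append, List.length_append, List.flatMap_singleton, add_mul,
      one_mul]
    exact add_le_add ih (h a)

/-- Relative to `2 ^ j`, doubling changes nothing and the deliveries of one stage add a term linear
in `k`. The coefficient `2 * k` is generous and keeps the algebra short. -/
theorem length_stateEdges_le (n m k : ℕ) (adj : ℕ → ℕ) (len : ℕ → ℝ) (s t p : ℕ → ℕ) (j : ℕ) :
    (stateEdges n m k adj len s t p j).length ≤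
      2 ^ j * ((m + 1) * (k * (n * n)) + k + 1 + 2 * k * j) := by
  induction j with
  | zero =>
    have h1 : (walkEdges n m k adj len).length ≤ (m + 1) * (k * (n * (n * 1))) :=
      length_flatMap_range_le _ _ _ fun c => length_flatMap_range_le _ _ _ fun i =>
        length_flatMap_range_le _ _ _ fun u => length_flatMap_range_le _ _ _ fun v => by
          split_ifs <;> simp
    have h2 : (switchEdges n k p).length ≤ (k - 1) * 1 :=
      length_flatMap_range_le _ _ _ fun i => by simp
    simp only [stateEdges, List.length_append, List.length_singleton, pow_zero, mul_zero, add_zero,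
      one_mul, mul_one] at h1 h2 ⊢
    lia
  | succ j ih =>
    have h3 : (deliveryEdges n m k s t j).length ≤ 2 ^ j * (k * 2) :=
      length_flatMap_range_le _ _ _ fun S => length_flatMap_range_le _ _ _ fun i => by simp
    simp only [stateEdges, List.length_append, List.length_map]
    calc _ ≤ 2 ^ j * ((m + 1) * (k * (n * n)) + k + 1 + 2 * k * j) +
          2 ^ j * ((m + 1) * (k * (n * n)) + k + 1 + 2 * k * j) + 2 ^ j * (k * 2) := by gcongr
      _ ≤ 2 ^ j * ((m + 1) * (k * (n * n)) + k + 1 + 2 * k * j) +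
          2 ^ j * ((m + 1) * (k * (n * n)) + k + 1 + 2 * k * j) + 2 * (2 ^ j * (k * 2)) := by lia
      _ = _ := by ring

/-- A bound of product form composes over nested loops: each level multiplies by its size and
increases the constant by `2 * bs + 12`. -/
theorem forTime_le {bs N Tb c A B : ℕ} (hN : N ≤ A) (hT : Tb ≤ c * B) (hA : 1 ≤ A) (hB : 1 ≤ B) :
    forTime bs N Tb ≤ (2 * bs + 12 + c) * (A * B) := by
  have h1 : 1 ≤ A * B := Nat.one_le_iff_ne_zero.2 (by positivity)
  calc forTime bs N Tb ≤ A * (bs + 7 + c * B) + (bs + 5) := by unfold forTime; gcongr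
    _ ≤ A * ((bs + 7) * B + c * B) + (bs + 5) * (A * B) := by
      gcongr
      · exact Nat.le_mul_of_pos_right _ hB
      · exact Nat.le_mul_of_pos_right _ h1
    _ = _ := by ring

/-- The dominant part is the table: at most `3 * X ^ 2` rounds over at most `5 * (2 ^ m * X ^ 4)`
edges, hence exponent `6`. The constant `4000` merely dominates the sum of all coefficients. -/
theorem mechanismTime_le {n m k E : ℕ} (hk : 2 ≤ k)
    (hE : E ≤ 2 ^ m * ((m + 1) * (k * (n * n)) + k + 1 + 2 * k * m)) :
    mechanismTime n m k E ≤ 4000 * (n + m + k) ^ 6 * k ^ m := by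
  obtain ⟨X, hX⟩ : ∃ X, X = n + m + k := ⟨_, rfl⟩
  obtain ⟨P, hP⟩ : ∃ P, P = 2 ^ m := ⟨_, rfl⟩
  have hn : n ≤ X := by lia
  have hm : m + 1 ≤ X := by lia
  have hk' : k ≤ X := by lia
  have hX1 : 1 ≤ X := by lia
  have hP1 : 1 ≤ P := hP ▸ Nat.one_le_two_pow
  -- Subsets of packages number `2 ^ m`; two agents suffice to absorb this in `k ^ m`.
  have hPk : P ≤ k ^ m := hP ▸ Nat.pow_le_pow_left hk m
  have hX2 : X ≤ X ^ 4 := Nat.le_self_pow (by decide) X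
  have hpow : ∀ a, 1 ≤ X ^ a := fun a => Nat.one_le_pow _ _ hX1
  have hE' : E ≤ 5 * (P * X ^ 4) := by
    have h1 : X * (X * (X * X)) = X ^ 4 := by ring
    have h2 : 2 * X * X ≤ 2 * X ^ 4 := by
      have h3 : X ^ 2 ≤ X ^ 4 := Nat.pow_le_pow_right hX1 (by decide)
      rw [mul_assoc, ← pow_two]
      lia
    have h4 := hpow 4
    calc E ≤ P * (X * (X * (X * X)) + X + 1 + 2 * X * X) := by
          rw [hP]; refine hE.trans ?_; gcongr; lia
      _ ≤ P * (5 * X ^ 4) := Nat.mul_le_mul_left P (by lia)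
      _ = _ := by ring
  have hPX : 1 ≤ P * X ^ 4 := Nat.one_le_iff_ne_zero.2 (by positivity)
  have hR : n * (k + 2 * m) ≤ 3 * X ^ 2 := by
    calc n * (k + 2 * m) ≤ X * (X + 2 * X) := by gcongr; lia
      _ = _ := by ring
  have hR1 : 1 ≤ 3 * X ^ 2 := by have := hpow 2; lia
  have w1 : forTime 1 n 100 ≤ 114 * (X * 1) := forTime_le (c := 100) hn le_rfl hX1 le_rfl
  have w2 : forTime 1 n (forTime 1 n 100) ≤ 128 * (X * (X * 1)) :=
    forTime_le hn w1 hX1 (by simpa using hX1)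
  have w3 : forTime 1 k (forTime 1 n (forTime 1 n 100) + 6) ≤ 148 * (X * (X * X)) := by
    have : 1 ≤ X * X := Nat.one_le_iff_ne_zero.2 (by positivity)
    exact forTime_le (c := 134) hk' (by rw [mul_one] at w2; lia) hX1 this
  have w4 : walkTime n m k ≤ 166 * (X * (X * (X * X))) :=
    forTime_le hm w3 hX1 (Nat.one_le_iff_ne_zero.2 (by positivity))
  have c1 : forTime 3 k 100 ≤ 118 * (X * 1) :=
    forTime_le (c := 100) hk' le_rfl hX1 le_rfl
  have c2 : forTime 1 k 4 ≤ 18 * (X * 1) := forTime_le (c := 4) hk' le_rfl hX1 le_rfl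
  have c3 : forTime 1 E 100 ≤ 114 * (5 * (P * X ^ 4) * 1) :=
    forTime_le (c := 100) hE' le_rfl (by lia) le_rfl
  have c4 : forTime 1 k 150 ≤ 164 * (X * 1) := forTime_le (c := 150) hk' le_rfl hX1 le_rfl
  have c5 : forTime 1 (2 ^ m) (forTime 1 k 150 + 6) ≤ 184 * (P * X) :=
    forTime_le (c := 170) hP.ge (by lia) hP1 hX1
  have c5' : P * X ≤ P * X ^ 4 := by gcongr
  have c6 : forTime 1 m (forTime 1 E 100 + forTime 1 (2 ^ m) (forTime 1 k 150 + 6) + 40) ≤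
      808 * (X * (P * X ^ 4)) :=
    forTime_le (c := 794) (by lia) (by lia) hX1 hPX
  have r1 : forTime 1 n 20 ≤ 34 * (X * 1) := forTime_le (c := 20) hn le_rfl hX1 le_rfl
  have r2 : forTime 1 n (forTime 1 n 20 + 10) ≤ 58 * (X * X) :=
    forTime_le (c := 44) hn (by lia) hX1 hX1
  have t1 : forTime 1 E 80 ≤ 94 * (5 * (P * X ^ 4) * 1) :=
    forTime_le (c := 80) hE' le_rfl (by lia) le_rfl
  have t2 : forTime 1 (n * (k + 2 * m)) (forTime 1 E 80 + 10) ≤ 494 * (3 * X ^ 2 * (P * X ^ 4)) :=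
    forTime_le (c := 480) hR (by lia) hR1 hPX
  have e1 : forTime 1 (n * (k + 2 * m)) 100 ≤ 114 * (3 * X ^ 2 * 1) :=
    forTime_le (c := 100) hR le_rfl hR1 le_rfl
  have p1 : forTime 1 k 20 ≤ 34 * (X * 1) := forTime_le (c := 20) hk' le_rfl hX1 le_rfl
  have y1 : X * (X * (X * X)) ≤ X ^ 6 * P := by
    calc X * (X * (X * X)) = X ^ 4 * 1 := by ring
      _ ≤ X ^ 6 * P := by gcongr; lia
  have y2 : X * 1 ≤ X ^ 6 * P := by
    calc X * 1 = X ^ 1 * 1 := by ring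
      _ ≤ X ^ 6 * P := by gcongr; lia
  have y3 : X * (P * X ^ 4) ≤ X ^ 6 * P := by
    calc X * (P * X ^ 4) = X ^ 5 * P := by ring
      _ ≤ X ^ 6 * P := by gcongr; lia
  have y4 : X * X ≤ X ^ 6 * P := by
    calc X * X = X ^ 2 * 1 := by ring
      _ ≤ X ^ 6 * P := by gcongr; lia
  have y5 : 3 * X ^ 2 * (P * X ^ 4) = 3 * (X ^ 6 * P) := by ring
  have y6 : 3 * X ^ 2 * 1 ≤ 3 * (X ^ 6 * P) := by
    calc 3 * X ^ 2 * 1 = 3 * (X * X) := by ring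
      _ ≤ _ := by gcongr
  have y7 : 1 ≤ X ^ 6 * P := Nat.one_le_iff_ne_zero.2 (by positivity)
  have : mechanismTime n m k E ≤ 4000 * (X ^ 6 * P) := by
    unfold mechanismTime constructTime
    lia
  calc _ ≤ 4000 * (X ^ 6 * P) := this
    _ ≤ 4000 * (X ^ 6 * k ^ m) := by gcongr
    _ = _ := by rw [hX]; ring

/-! ### Correctness -/

theorem trivialBits_eq_sum (s t : ℕ → ℕ) (J : ℕ) :
    trivialBits s t J = ∑ j ∈ Finset.range J, if s j = t j then 2 ^ j else 0 := by
  induction J with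
  | zero => rfl
  | succ J ih => rw [trivialBits, ih, Finset.sum_range_succ]

variable {n m k : ℕ}

namespace Instance

theorem code_firstState [NeZero k] (I : Instance n m k) (w : Fin k → ℝ≥0) :
    I.firstState.code = (I.input w).narr 3 0 +
      trivialBits ((I.input w).narr 1) ((I.input w).narr 2) m * ((m + 1) * (k * n)) := by
  have h0 := I.input_start w 0
  have hb : bits (Finset.univ.filter fun j => I.source j = I.target j) =
      trivialBits ((I.input w).narr 1) ((I.input w).narr 2) m := by
    rw [trivialBits_eq_sum, bits, Finset.sum_filter, ← Fin.sum_univ_eq_sum_range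
      (fun j => if (I.input w).narr 1 j = (I.input w).narr 2 j then 2 ^ j else 0)]
    simp only [I.input_source, I.input_target, Fin.ext_iff]
  rw [Fin.val_zero] at h0
  simp only [State.code, firstState, hb, loadCode, Fin.val_zero, h0]
  ring

theorem code_lastState [NeZero k] (I : Instance n m k) (w : Fin k → ℝ≥0) :
    I.lastState.code = 2 ^ m * ((m + 1) * (k * n)) - (m + 1) * (k * n) +
      ((k - 1) * n + (I.input w).narr 3 (k - 1)) := by
  have h0 : (I.input w).narr 3 (k - 1) = _ := I.input_start w (lastAgent k)
  rw [← bits_univ, add_mul, one_mul, Nat.add_sub_cancel, h0]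
  simp [State.code, lastState, loadCode, lastAgent]

theorem c0_le_three [NeZero k] (I : Instance n m k) {e : Edge} (h : e ∈ I.edges m) :
    e.c0 ≤ 3 := by
  obtain ⟨x, a, y, ht, rfl⟩ := (I.mem_edges le_rfl e).1 h
  cases ht <;> simp [edgeOf, optionCode, Action.code]

/-- The sum of all entries of the length matrix. -/
noncomputable def totalLen (I : Instance n m k) : ℝ :=
  ∑ x ∈ Finset.range (n * n), (I.input 0).rarr 0 x

theorem input_rarr_zero_nonneg (I : Instance n m k) (x : ℕ) : 0 ≤ (I.input 0).rarr 0 x := by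
  change 0 ≤ I.lenEntry (x / n) (x % n)
  unfold lenEntry
  split_ifs
  · exact NNReal.coe_nonneg _
  · exact le_rfl

theorem len_le_totalLen [NeZero k] (I : Instance n m k) {e : Edge} (h : e ∈ I.edges m) :
    e.len ≤ I.totalLen := by
  have h0 : 0 ≤ I.totalLen := Finset.sum_nonneg fun x _ => I.input_rarr_zero_nonneg x
  obtain ⟨x, a, y, ht, rfl⟩ := (I.mem_edges le_rfl e).1 h
  cases ht with
  | walk S c i u v hS huv =>
    simp only [edgeOf, moveLen]
    rw [← I.input_len 0 huv]
    exact Finset.single_le_sum (f := fun x => (I.input 0).rarr 0 x)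
      (fun x _ => I.input_rarr_zero_nonneg x) (Finset.mem_range.2 (mul_add_lt v.2 u.2))
  | _ => simpa [edgeOf, moveLen] using h0

/-- Crude on purpose: every edge is at most the sum of the whole length matrix. The result is a
bound independent of the reports, which the VCG term needs. -/
theorem travel_le [NeZero k] (I : Instance n m k) (i : ℕ) {ω : List Edge}
    (h : ∀ e ∈ ω, e ∈ I.edges m) : travel i ω ≤ ω.length * I.totalLen := by
  have h0 : 0 ≤ I.totalLen := Finset.sum_nonneg fun x _ => I.input_rarr_zero_nonneg x
  induction ω with
  | nil => simp [travel]
  | cons e ω ih =>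
    have h1 := I.len_le_totalLen (h e (by simp))
    have h2 := ih fun e he => h e (by simp [he])
    simp only [travel, List.map_cons, List.sum_cons, List.length_cons] at h2 ⊢
    push_cast
    split_ifs <;> linarith

theorem runs_mechanismProg [NeZero k] (I : Instance n m k) (w : Fin k → ℝ≥0) :
    Runs mechanismProg (I.input w) (mechanismTime n m k (I.edges m).length) fun s =>
      ∃ ω, IsWalk (I.edges m) I.firstState.code ω I.lastState.code ∧
        ω.length = n * (k + 2 * m) ∧
        (∀ ω', IsWalk (I.edges m) I.firstState.code ω' I.lastState.code →
          ω'.length = n * (k + 2 * m) →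
          walkCost ((I.input w).rarr 1) ω ≤ walkCost ((I.input w).rarr 1) ω') ∧
        HasCodes s (codes ω) ∧
        ∀ i < k, s.rarr 2 i = ∑ a ∈ Finset.range k, (I.input w).rarr 1 a *
            ((n * (k + 2 * m) : ℕ) * I.totalLen - travel a ω) -
          (I.input w).rarr 1 i * ((n * (k + 2 * m) : ℕ) * I.totalLen - travel i ω) := by
  set L := I.edges m with hL
  set N := 2 ^ m * ((m + 1) * (k * n)) with hN
  have hfirst : I.firstState.code < N := State.code_lt _ fun j _ => j.2
  have hlast : I.lastState.code < N := State.code_lt _ fun j _ => j.2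
  have hbd : ∀ e ∈ L, e.src < N ∧ e.dst < N := fun e he =>
    ⟨(I.mem_edges_bounds he).1, (I.mem_edges_bounds he).2.1⟩
  -- Agent `0` alone delivers everything; this walk shows that the first state is reachable in the
  -- top layer.
  obtain ⟨ω₀, hω₀, hω₀', -⟩ := I.exists_walk_of_tours (fun _ => 0)
    (fun a => if a = 0 then (Finset.univ.filter fun j => I.source j ≠ I.target j).toList else [])
    (fun a => by split_ifs <;> simp [Finset.nodup_toList])
    (fun a j => by
      by_cases h : a = 0
      · simp [h]
      · simp [h, Ne.symm h])
  -- The final `rfl` identifies the list built from `I.input w` with `I.edges m`, since the public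
  -- arrays are the same for all reports.
  refine (runs_constructProg (s := I.input w) (n := n) (m := m) (k := k) (L := L)
    rfl rfl rfl rfl rfl rfl).seq fun s₁ hF₁ ⟨hE₁, h13₁, h15₁, h30₁⟩ => ?_
  rw [← I.code_firstState] at h15₁
  rw [← I.code_lastState] at h30₁
  refine (runs_roundsProg (s := s₁) (n := n) (m := m) (k := k) (hF₁.nreg 0 (by decide))
    (hF₁.nreg 1 (by decide)) (hF₁.nreg 2 (by decide)) (hF₁.rreg 1 (by decide))).seq
    fun s₂ hF₂ ⟨h22₂, hr₂⟩ => ?_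
  rw [hF₁.rarr 0 (by decide)] at hr₂
  have hE₂ : HasEdges s₂ L := hE₁.congr (hF₂.nreg 4 (by decide))
    (fun a _ _ => hF₂.narr a (by simp [roundsProg, forTo, Cmd.narrs])) (hF₂.rarr 3 (by decide))
  have h13₂ := (hF₂.nreg 13 (by decide)).trans h13₁
  have hW₂ : s₂.rarr 1 = (I.input w).rarr 1 :=
    (hF₂.rarr 1 (by decide)).trans (hF₁.rarr 1 (by decide))
  refine (runs_tableProg (N := N) (y := I.lastState.code) (R := n * (k + 2 * m)) hE₂ hbd hlast h13₂
    ((hF₂.nreg 30 (by decide)).trans h30₁) h22₂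
    ((hF₂.narr 14 (by decide)).trans (hF₁.narr 14 (by decide)))
    ((hF₂.rarr 4 (by decide)).trans (hF₁.rarr 4 (by decide)))
    ((hF₂.rreg 2 (by decide)).trans (hF₁.rreg 2 (by decide)))).seq
    fun s₃ hF₃ ⟨hT₃, h31₃, hr₃⟩ => ?_
  rw [hW₂] at hT₃
  have hE₃ : HasEdges s₃ L := hE₂.congr (hF₃.nreg 4 (by decide))
    (fun a ha ha' => hF₃.narr a (by
      have h1 : a ≠ 14 := by lia
      have h2 : a ≠ 15 := by lia
      simp [tableProg, relaxProg, forTo, Cmd.narrs, h1, h2])) (hF₃.rarr 3 (by decide))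
  have hreach := hT₃.le_walkCost hω₀ hω₀'.le
  rw [hω₀'] at hreach
  refine (runs_extractProg hE₃ hT₃ (fun e he => ⟨(hbd e he).2, I.c0_le_three he⟩) hfirst hreach.1
    ((hF₃.nreg 13 (by decide)).trans h13₂)
    ((hF₃.nreg 15 (by decide)).trans ((hF₂.nreg 15 (by decide)).trans h15₁))
    ((hF₃.nreg 22 (by decide)).trans h22₂) h31₃
    ((hF₃.nreg 3 (by decide)).trans ((hF₂.nreg 3 (by decide)).trans (hF₁.nreg 3 (by decide))))
    ((hF₃.rarr 5 (by decide)).trans ((hF₂.rarr 5 (by decide)).trans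
      (hF₁.rarr 5 (by decide))))).seq fun s₄ hF₄ ⟨ω, g1, g2, g3, g4, g5⟩ => ?_
  refine (runs_payProg (k := k) ((hF₄.nreg 2 (by decide)).trans ((hF₃.nreg 2 (by decide)).trans
    ((hF₂.nreg 2 (by decide)).trans (hF₁.nreg 2 (by decide)))))).mono le_rfl fun s₅ hF₅ hp => ?_
  refine ⟨ω, g1, g2, fun ω' h1 h2 => ?_, ⟨?_, ?_⟩, ?_⟩
  · rw [g3, ← h2]
    exact (hT₃.le_walkCost h1 h2.le).2
  · exact (hF₅.nreg 3 (by decide)).trans g4.1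
  · intro l c hc
    rw [← g4.2 l c hc, hF₅.narr 4 (by decide), hF₅.narr 5 (by decide), hF₅.narr 6 (by decide),
      hF₅.narr 7 (by decide)]
  · intro i hi
    have hB : s₄.rreg 2 = (n * (k + 2 * m) : ℕ) * I.totalLen := by
      rw [hF₄.rreg 2 (by decide), hr₃, hr₂]
      rfl
    have hW₄ : s₄.rarr 1 = (I.input w).rarr 1 :=
      (hF₄.rarr 1 (by decide)).trans ((hF₃.rarr 1 (by decide)).trans hW₂)
    rw [hp i hi, hB, hW₄, g5]

theorem input_weight (I : Instance n m k) (w : Fin k → ℝ≥0) (i : Fin k) :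
    (I.input w).rarr 1 i = w i := by
  simp [input]

theorem coe_cost (I : Instance n m k) (x : I.Solution) (w : Fin k → ℝ≥0) :
    (I.cost x w : ℝ) = ∑ i, (w i : ℝ) * (I.dist i x : ℝ) := by
  simp [cost]

/-- For all reported weights the program computes a solution that is described by a walk through
the state graph and not more expensive than any other such walk. -/
theorem exists_output [NeZero k] (I : Instance n m k) (w : Fin k → ℝ≥0) :
    ∃ (x : I.Solution) (P : Fin k → ℝ),
      (∃ t s, Exec mechanismProg (I.input w) t s ∧ t ≤ mechanismTime n m k (I.edges m).length ∧
        I.IsOutput s x P) ∧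
      (∃ ω, IsWalk (I.edges m) I.firstState.code ω I.lastState.code ∧
        ω.length = n * (k + 2 * m) ∧ ∀ i : Fin k, (I.dist i x : ℝ) = travel i ω) ∧
      (∀ ω, IsWalk (I.edges m) I.firstState.code ω I.lastState.code →
        ω.length = n * (k + 2 * m) → (I.cost x w : ℝ) ≤ ∑ i : Fin k, (w i : ℝ) * travel i ω) ∧
      ∀ i, P i = ∑ j ∈ Finset.univ.erase i,
        (w j : ℝ) * ((n * (k + 2 * m) : ℕ) * I.totalLen - I.dist j x) := by
  obtain ⟨t, s, hexec, ht, ω, h1, h2, h3, h4, h5⟩ := I.runs_mechanismProg w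
  obtain ⟨acts, hrun, hcodes, hdist⟩ := I.exists_run_of_isWalk h1
  rw [config_firstState] at hrun
  let x : I.Solution := ⟨acts, _, hrun, I.config_lastState_loc⟩
  have hx : ∀ i : Fin k, (I.dist i x : ℝ) = travel i ω := hdist
  refine ⟨x, fun i => s.rarr 2 i, ⟨t, s, hexec, ht, ?_, fun l hl => ?_, fun i => rfl⟩,
    ⟨ω, h1, h2, hx⟩, fun ω' h1' h2' => ?_, fun i => ?_⟩
  · rw [h4.1, ← List.length_map (as := acts) Action.code, hcodes]; rfl
  · refine h4.2 l _ ?_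
    rw [codes, ← hcodes, List.getElem?_map, List.getElem?_eq_getElem hl]
    rfl
  · have := h3 ω' h1' h2'
    rw [I.walkCost_eq _ h1.mem, I.walkCost_eq _ h1'.mem] at this
    simpa only [coe_cost, hx, I.input_weight] using this
  · change s.rarr 2 (i : ℕ) = _
    rw [h5 i i.2, ← Fin.sum_univ_eq_sum_range (fun a => (I.input w).rarr 1 a *
      ((n * (k + 2 * m) : ℕ) * I.totalLen - travel a ω)), ← Finset.add_sum_erase _ _
      (Finset.mem_univ i), add_sub_cancel_left]
    exact Finset.sum_congr rfl fun j _ => by rw [I.input_weight, hx]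

end Instance

/-! ### Payments, incentives and the approximation ratio -/

/-- The mechanism computed by `mechanismProg`, with its properties. -/
theorem exists_mechanism {n m k : ℕ} (hk : 2 ≤ k) (I : Instance n m k) : ∃ M : Mechanism I,
    M.ComputedBy mechanismProg (4000 * (n + m + k) ^ 6 * k ^ m) ∧
      M.IsVCG ∧ M.Truthful ∧ M.VoluntaryParticipation ∧ M.IsApprox 3.6 := by
  have : NeZero k := ⟨by lia⟩
  choose alg pay hout hrange hopt hpay using I.exists_output
  set B : ℝ := (n * (k + 2 * m) : ℕ) * I.totalLen with hB
  let M : Mechanism I := ⟨alg, pay⟩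
  have hpay' : ∀ w i, pay w i = B * ∑ j ∈ Finset.univ.erase i, (w j : ℝ) -
      ∑ j ∈ Finset.univ.erase i, (w j : ℝ) * (I.dist j (alg w) : ℝ) := by
    intro w i
    rw [hpay, Finset.mul_sum, ← Finset.sum_sub_distrib]
    exact Finset.sum_congr rfl fun j _ => by rw [mul_sub, mul_comm B]
  -- The utility is a term free of agent `i`'s report minus the cost of the chosen solution under
  -- the true weight `wi`.
  have hutil : ∀ (w : Fin k → ℝ≥0) (i : Fin k) (wi : ℝ≥0), M.utility w i wi =
      B * ∑ j ∈ Finset.univ.erase i, (w j : ℝ) -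
        ∑ j, (Function.update w i wi j : ℝ) * (I.dist j (alg w) : ℝ) := by
    intro w i wi
    have hs : ∑ j ∈ Finset.univ.erase i, (Function.update w i wi j : ℝ) * (I.dist j (alg w) : ℝ) =
        ∑ j ∈ Finset.univ.erase i, (w j : ℝ) * (I.dist j (alg w) : ℝ) :=
      Finset.sum_congr rfl fun j hj => by rw [Function.update_of_ne (Finset.ne_of_mem_erase hj)]
    rw [← Finset.add_sum_erase _ _ (Finset.mem_univ i), Function.update_self, hs]
    change pay w i - wi * (I.dist i (alg w) : ℝ) = _
    rw [hpay']
    ring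
  refine ⟨M, fun w => ?_, ⟨fun i v => B * ∑ j, (v j : ℝ), fun w i => ?_⟩, fun w i wi => ?_,
    fun w i => ?_, fun w y => ?_⟩
  · obtain ⟨t, s, h1, h2, h3⟩ := hout w
    exact ⟨t, s, h1, h2.trans (mechanismTime_le hk (length_stateEdges_le _ _ _ _ _ _ _ _ _)), h3⟩
  · have hs : ∑ j : {j // j ≠ i}, (w j.1 : ℝ) = ∑ j ∈ Finset.univ.erase i, (w j : ℝ) :=
      (Finset.sum_subtype (p := (· ≠ i)) (Finset.univ.erase i) (fun x => by simp)
        (fun j => (w j : ℝ))).symm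
    change pay w i = B * ∑ j : {j // j ≠ i}, (w j.1 : ℝ) -
      ∑ j ∈ Finset.univ.erase i, (w j : ℝ) * (I.dist j (alg w) : ℝ)
    rw [hs, hpay']
  · rw [hutil, hutil, Function.update_idem]
    -- The solution chosen after a false report is also in the range for the true one, where the
    -- chosen solution is optimal.
    obtain ⟨ω, h1, h2, h3⟩ := hrange w
    have := hopt (Function.update w i wi) ω h1 h2
    rw [Instance.coe_cost] at this
    simp only [← h3] at this
    have hs : ∑ j ∈ Finset.univ.erase i, (Function.update w i wi j : ℝ) =
        ∑ j ∈ Finset.univ.erase i, (w j : ℝ) :=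
      Finset.sum_congr rfl fun j hj => by rw [Function.update_of_ne (Finset.ne_of_mem_erase hj)]
    rw [hs]
    linarith
  · rw [hutil, Function.update_eq_self, ← Instance.coe_cost]
    have : Nontrivial (Fin k) := Fin.nontrivial_iff_two_le.2 hk
    -- A second agent exists as `k ≥ 2`. The walk in which `j` does everything costs at most `w j *
    -- B`, which `Q i` covers.
    obtain ⟨j, hj⟩ := exists_ne i
    obtain ⟨ω, h1, h2, h3⟩ := I.exists_walk_of_tours (fun _ => j)
      (fun a => if a = j then (Finset.univ.filter fun j => I.source j ≠ I.target j).toList else [])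
      (fun a => by split_ifs <;> simp [Finset.nodup_toList])
      (fun a j' => by
        by_cases h : a = j
        · simp [h]
        · simp [h, Ne.symm h])
    have hc := hopt w ω h1 h2
    rw [Finset.sum_eq_single j (fun a _ ha => by rw [h3]; simp [ha, Instance.tourLen])
      (by simp)] at hc
    have ht := I.travel_le j h1.mem
    rw [h2] at ht
    have hB0 : 0 ≤ B := mul_nonneg (Nat.cast_nonneg _)
      (Finset.sum_nonneg fun x _ => I.input_rarr_zero_nonneg x)
    have hle : (w j : ℝ) ≤ ∑ j ∈ Finset.univ.erase i, (w j : ℝ) :=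
      Finset.single_le_sum (f := fun j => (w j : ℝ)) (fun j _ => NNReal.coe_nonneg _)
        (Finset.mem_erase.2 ⟨hj, Finset.mem_univ j⟩)
    have : (w j : ℝ) * travel j ω ≤ B * ∑ j ∈ Finset.univ.erase i, (w j : ℝ) := by
      calc (w j : ℝ) * travel j ω ≤ w j * B := by gcongr
        _ = B * w j := mul_comm _ _
        _ ≤ _ := by gcongr
    change 0 ≤ _ - (I.cost (alg w) w : ℝ)
    linarith
  -- The range contains a solution of cost at most twice that of `y`; the constant 3.6 is weaker.
  · obtain ⟨asg, l, hl, hasg, hle⟩ := I.exists_tours_le w y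
    obtain ⟨ω, h1, h2, h3⟩ := I.exists_walk_of_tours asg l hl hasg
    have hc := hopt w ω h1 h2
    simp only [h3] at hc
    have hle' : (∑ i, (w i : ℝ) * (I.tourLen (I.start i)
        ((l i).map fun j => .carry j (I.target j)) (I.start i) : ℝ)) ≤ 2 * (I.cost y w : ℝ) := by
      exact_mod_cast hle
    have h0 : 0 ≤ (I.cost y w : ℝ) := NNReal.coe_nonneg _
    change (I.cost (alg w) w : ℝ) ≤ _
    linarith

end Delivery

theorem mainTheorem4 :
    ∃ (prog : RealRAM.Cmd) (C d : ℕ), ∀ (n m k : ℕ), 2 ≤ k →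
      ∀ I : Delivery.Instance n m k, ∃ M : Delivery.Mechanism I,
        M.ComputedBy prog (C * (n + m + k) ^ d * k ^ m) ∧
        M.IsVCG ∧ M.Truthful ∧ M.VoluntaryParticipation ∧ M.IsApprox 3.6 :=
  ⟨Delivery.mechanismProg, 4000, 6, fun _ _ _ hk I => Delivery.exists_mechanism hk I⟩
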